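/- **Setting.** For $t=1,2,3$ let $X^t\subseteq\mathbb R^{n_t}$ be compact and convex ($\mathbb R^{n_t}$ carries an arbitrary norm $\|\cdot\|$ with dual norm $\|\cdot\|_*$; $\mathbb R^{m_t}$ carries the Euclidean norm; $X^1,X^2$ have more than one point), let $K^t\subseteq\mathbb R^{m_t}$ be a nonempty closed convex cone with dual cone $K^t_*$, and let $h^t(\cdot,c)$ be convex and lower semicontinuous on $X^t$. Let $A^1\neq0$, $b^1$, $c^1$ be given. Let $\xi^2=(A^2,b^2,B^2,c^2)$ and $\xi^3=(A^3,b^3,B^3,c^3)$ be random with $A^2\ne 0$, $A^3\neq 0$ a.s. Put $$V^3(x^2,\xi^3)=\min\{h^3(x,c^3): x\in X^3,\ A^3x-b^3-B^3x^2\in K^3\},\qquad v^3(x^2)=\mathbb E[V^3(x^2,\xi^3)\mid\xi^2],$$ $$V^2(x^1,\xi^2)=\min\{h^2(x,c^2)+v^3(x): x\in X^2,\ A^2x-b^2-B^2x^1\in K^2\},\qquad v^2(x^1)=\mathbb E[V^2(x^1,\xi^2)],$$ which are assumed to be integrable for $x^2\in X^2$, $x^1\in X^1$. The first-stage problem is to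 minimize $f(x):=h^1(x,c^1)+v^2(x)$ over $x\in X^1$ with $A^1x-b^1\in K^1$. The second- and third-stage problems (a.s., for each $x^1\in X^1$, resp. $x^2\in X^2$) and the first-stage problem are assumed to have primal-dual pairs of optimal solutions, i.e. saddle points of $\langle b+Bu-Ax,y\rangle+h(x,c)+v(x)$ on $X\times K_*$, where $u$ is the preceding decision ($B^1u=0$) and $v=v^2,v^3,0$ at stages $1,2,3$. Fix an optimal pair $(x^*,y^1_*)$ of the first stage and measurable selections $y^2_*=y^2_*(x^1,\xi^2)$, $y^3_*=y^3_*(x^2,\xi^3)$ of optimal dual solutions. Let $\omega_t$ be continuously differentiable and strongly convex on $X^t$ with modulus $\alpha_t>0$ with respect to $\|\cdot\|$, let $P_t(x,x')=\omega_t(x')-\omega_t(x)-\langle\nabla\omega_t(x),x'-x\rangle$ and $\Omega_t^2=\max_{x,x'\in X^t}P_t(x,x')$. **Algorithm.** One step at a stage with data $A$, $r=b+Bu$, $c$ and a vector $G$ takes $(x,y,y_-)$ to $(x_+,y_+,y)$, where $$\tilde y=2y-y_-,\quad x_+=\arg\min_{x'\in X}\langle r-Ax',\tilde y\rangle+h(x',c)+\langle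 G,x'\rangle+\tau P(x,x'),\quad y_+=\arg\min_{y'\in K_*}\langle Ax_+-r,y'\rangle+\tfrac\eta2\|y'-y\|^2$$ (steps are assumed to be measurable in their inputs). A loop of $N$ steps at stage $t$ starts from fixed $x^t_0\in X^t$, $y^t_{0}=y^t_{-1}\in\mathbb R^{m_t}$ and returns the averages $\bar x^t,\bar y^t$ of $x_1,\dots,x_N$ and $y_1,\dots,y_N$. The outer loop has $N_1$ steps at stage 1. In step $i$ a new realization $\xi^2_i$ is drawn and $G=(B^2_i)^T\bar y^2$, where $\bar y^2$ is returned by a middle loop of $N_2$ steps at stage 2 with data $\xi^2_i$ and $u=x^1_{i-1}$. In step $j$ of the middle loop a new realization $\xi^3_j$ is drawn from the conditional law given $\xi_i^2$ and $G=(B^3_j)^T\bar y^3$, where $\bar y^3$ is returned by an innermost loop of $N_3$ steps at stage 3 with data $\xi^3_j$, $u=x^2_{j-1}$ and $G=0$. The output is the average $\bar x^1$ of the outer loop. With $M_1':=M_2$, $M_2':=M_3$, $M_3':=0$ for the three loops, the outer and innermost loops ($t=1,3$) use the aggressive parameters $$\tau=\max\Big\{\tfrac{M_t'\sqrt{3N_t}}{\Omega_t\sqrt{\alpha_t}},\tfrac{\sqrt2\|A^t\|}{\sqrt{\alpha_t}}\Big\},\qquad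 \eta=\tfrac{\sqrt2\|A^t\|}{\sqrt{\alpha_t}}$$ (the first entry is $0$ for $t=3$), and the middle loop the conservative ones $$\tau=\max\Big\{\tfrac{M_3\sqrt{3N_2}}{\Omega_2\sqrt{\alpha_2}},\tfrac{\sqrt2\|A^2\|}{\sqrt{\alpha_2N_2}}\Big\},\qquad \eta=\tfrac{\sqrt{2N_2}\,\|A^2\|}{\sqrt{\alpha_2}}.$$ For $\varepsilon>0$ the numbers of steps, rounded up to integers and at least $1$, are $$N_3=\tfrac{3\sqrt2\|A^3\|[2\Omega_3^2+\|y^3_*-y^3_0\|^2]}{\sqrt{\alpha_3}\,\varepsilon},\qquad N_2=\Big(\tfrac{12\sqrt2\|A^2\|\Omega_2^2}{\sqrt{\alpha_2}\,\varepsilon}\Big)^{2/3}+\Big[\tfrac{6(\|A^2\|\|y^2_*-y^2_0\|^2+4\sqrt3M_3\Omega_2)}{\sqrt{\alpha_2}\,\varepsilon}\Big]^2,$$ $$N_1=\max\Big\{\tfrac{6\sqrt2\|A^1\|[2\Omega_1^2+\|y^1_0\|^2]}{\sqrt{\alpha_1}\varepsilon}+\Big(\tfrac{24\sqrt3M_2\Omega_1}{\sqrt{\alpha_1}\varepsilon}\Big)^2,\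 \tfrac{6\|A^1\|(\sqrt{2\alpha_1}\|y^1_*-y^1_0\|+2\Omega_1+3\sqrt{\alpha_1})}{\alpha_1\varepsilon}+\Big(\tfrac{6\sqrt3M_2(\sqrt2\|A^1\|+\sqrt{\alpha_1})}{\alpha_1\varepsilon}\Big)^2\Big\},$$ with $A^2,y_*^2$ (resp. $A^3,y_*^3$) taken at the current $(x^1_{i-1},\xi^2_i)$ (resp. $(x^2_{j-1},\xi^3_j)$). **Constants.** Call $M_3\ge0$ admissible for $\varepsilon$ if, a.s. in $\xi^2$, $v^3$ is $M_3$-Lipschitz on $X^2$ and $\mathbb E[\|(B^3)^T\bar y^3\|_*^2\mid\xi^2]\le M_3^2$ for the innermost loop run with any fixed $u=x^2\in X^2$; call $M_2\ge0$ admissible (given $M_3$) if $v^2$ is $M_2$-Lipschitz on $X^1$ and $\mathbb E\|(B^2)^T\bar y^2\|_*^2\le M_2^2$ for the middle loop run with any fixed $u=x^1\in X^1$. **Theorem.** (a) For every $\varepsilon>0$ and all admissible $M_3,M_2$, the algorithm returns $\bar x^1\in X^1$, and there is a random vector $\delta\in\mathbb R^{m_1}$, such that $$\mathbb E[f(\bar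 x^1)-f(x^*)]\le\varepsilon,\qquad A^1\bar x^1-b^1-\delta\in K^1\ \text{a.s.},\qquad \mathbb E\|\delta\|\le\varepsilon.$$ (b) If $\|A^2\|$, $1/\|A^2\|$, $\|B^2\|$, $\|B^3\|$, $\|y^2_*\|$, $\|y^3_*\|$ are (a.s., uniformly over $x^1\in X^1$, $x^2\in X^2$) bounded by a constant, then there are constants $M_3,M_2,Q$, independent of $\varepsilon$, such that for all $\varepsilon\in(0,1]$ the constants $M_3,M_2$ are admissible, the algorithm uses $N_1\le Q/\varepsilon^2$ realizations of $\xi^2$, and almost surely at most $Q/\varepsilon^4$ realizations of $\xi^3$ in total. -/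

import Mathlib

open MeasureTheory ProbabilityTheory Set

namespace DSA

section SingleStage

/-- A realization `ξ = (A, b, B, c)` of the random data of a stage with decision space `E`,
constraint space `F`, preceding decision space `E'` and cost parameters in `C`. -/
abbrev Scenario (E' E F C : Type*)
    [NormedAddCommGroup E'] [NormedSpace ℝ E'] [NormedAddCommGroup E] [NormedSpace ℝ E]
    [NormedAddCommGroup F] [InnerProductSpace ℝ F] :=
  (E →L[ℝ] F) × F × (E' →L[ℝ] F) × C

namespace Scenario

variable {E' E F C : Type*}
  [NormedAddCommGroup E'] [NormedSpace ℝ E'] [NormedAddCommGroup E] [NormedSpace ℝ E]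
  [NormedAddCommGroup F] [InnerProductSpace ℝ F]

/-- The constraint matrix `A`. -/
def A (ξ : Scenario E' E F C) : E →L[ℝ] F := ξ.1

/-- The right-hand side `b`. -/
def b (ξ : Scenario E' E F C) : F := ξ.2.1

/-- The technology matrix `B`. -/
def B (ξ : Scenario E' E F C) : E' →L[ℝ] F := ξ.2.2.1

/-- The cost parameter `c`. -/
def c (ξ : Scenario E' E F C) : C := ξ.2.2.2

/-- The vector `b + B u` for the preceding decision `u`. -/
def rhs (ξ : Scenario E' E F C) (u : E') : F := ξ.b + ξ.B u

end Scenario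

/-- The deterministic data of one stage: the feasible set `X`, the cone `K` (a nonempty closed
convex cone), the objective `h`, the distance generating function `ω` on `X` with its derivative
`dω` and its modulus `α`, and the initial point `(x₀, y₀)` of the algorithm at this stage.
The space `E` carries an arbitrary norm, `F` is Euclidean. -/
structure Stage (E F C : Type*) [NormedAddCommGroup E] [NormedSpace ℝ E]
    [NormedAddCommGroup F] [InnerProductSpace ℝ F] where
  X : Set E
  K : ProperCone ℝ F
  h : E → C → ℝ
  ω : E → ℝ
  dω : E → StrongDual ℝ E
  α : ℝ
  x₀ : E
  y₀ : F

/-- The constant algorithmic parameters `(w, θ, τ, η)` of one loop. -/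
structure StepSizes where
  w : ℝ
  θ : ℝ
  τ : ℝ
  η : ℝ

/-- A minimizer of `f` over `S` (an arbitrary point if there is none). -/
noncomputable def argminOn {V : Type*} [Nonempty V] (S : Set V) (f : V → ℝ) : V :=
  Classical.epsilon fun x => x ∈ S ∧ IsMinOn f S x

namespace Stage

variable {E F C : Type*} [NormedAddCommGroup E] [NormedSpace ℝ E]
    [NormedAddCommGroup F] [InnerProductSpace ℝ F] [FiniteDimensional ℝ F]

/-- The dual cone `K_* = {y : ⟪k, y⟫ ≥ 0 for all k ∈ K}`. -/
noncomputable def dualCone (S : Stage E F C) : ProperCone ℝ F :=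
  ProperCone.innerDual (S.K : Set F)

/-- The prox-function `P_X(x, x₁) = ω(x₁) - ω(x) - ⟨∇ω(x), x₁ - x⟩`. -/
def bregman (S : Stage E F C) (x x₁ : E) : ℝ := S.ω x₁ - S.ω x - S.dω x (x₁ - x)

/-- The diameter `Ω_X`, given by `Ω_X² = max {P_X(x, x₁) : x, x₁ ∈ X}`. -/
noncomputable def Ω (S : Stage E F C) : ℝ := √(sSup (image2 S.bregman S.X S.X))

/-- The points `x ∈ X` with `A x - r ∈ K`. -/
def feasible (S : Stage E F C) (A : E →L[ℝ] F) (r : F) : Set E :=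
  {x | x ∈ S.X ∧ A x - r ∈ S.K}

/-- The optimal value of `min {h(x, c) + v(x) : A x - r ∈ K, x ∈ X}`. -/
noncomputable def value (S : Stage E F C) (A : E →L[ℝ] F) (r : F) (c : C) (v : E → ℝ) : ℝ :=
  sInf ((fun x => S.h x c + v x) '' S.feasible A r)

/-- The Lagrangian `⟪r - A x, y⟫ + h(x, c) + v(x)`. -/
noncomputable def lagrangian (S : Stage E F C) (A : E →L[ℝ] F) (r : F) (c : C) (v : E → ℝ)
    (x : E) (y : F) : ℝ :=
  inner ℝ (r - A x) y + S.h x c + v x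

/-- `(x, y)` is a pair of optimal solutions of `max_{y ∈ K_*} min_{x ∈ X}` of the Lagrangian. -/
def IsSaddle (S : Stage E F C) (A : E →L[ℝ] F) (r : F) (c : C) (v : E → ℝ)
    (x : E) (y : F) : Prop :=
  x ∈ S.X ∧ y ∈ S.dualCone ∧
    IsSaddlePointOn S.X (S.dualCone : Set F) (S.lagrangian A r c v) x y

open Classical in
/-- The primal step `argmin_{x ∈ X} ⟪r - A x, d⟫ + h(x, c) + ⟨G, x⟩ + τ P_X(p, x)`
(by convention `p` unless `p ∈ X` and `τ > 0`). -/
noncomputable def primalStep (S : Stage E F C) (A : E →L[ℝ] F) (r : F) (c : C) (τ : ℝ)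
    (G : StrongDual ℝ E) (p : E) (d : F) : E :=
  if p ∈ S.X ∧ 0 < τ then
    argminOn S.X fun x => inner ℝ (r - A x) d + S.h x c + G x + τ * S.bregman p x
  else p

open Classical in
/-- The dual step `argmin_{y ∈ K_*} ⟪-r + A p, y⟫ + (η / 2) ‖y - d‖²`
(by convention `d` unless `η > 0`). -/
noncomputable def dualStep (S : Stage E F C) (A : E →L[ℝ] F) (r : F) (η : ℝ)
    (p : E) (d : F) : F :=
  if 0 < η then
    argminOn (S.dualCone : Set F) fun y => inner ℝ (-r + A p) y + η / 2 * ‖y - d‖ ^ 2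
  else d

/-- One stochastic primal-dual transformation. The state `(p, d, d₋)` consists of the current
primal point, the current dual point and the previous dual point. -/
noncomputable def spdt (S : Stage E F C) (A : E →L[ℝ] F) (r : F) (c : C) (s : StepSizes)
    (G : StrongDual ℝ E) (z : E × F × F) : E × F × F :=
  let dt : F := s.θ • (z.2.1 - z.2.2) + z.2.1
  let p : E := S.primalStep A r c s.τ G z.1 dt
  (p, S.dualStep A r s.η p z.2.1, z.2.1)

/-- The iterates `(x_k, y_k, y_{k-1})` of the repeated transformation, with `y_{-1} = y_0`. The
linear functional used in step `k + 1` is `G k x_k`. -/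
noncomputable def iter (S : Stage E F C) (A : E →L[ℝ] F) (r : F) (c : C) (s : StepSizes)
    (G : ℕ → E → StrongDual ℝ E) : ℕ → E × F × F
  | 0 => (S.x₀, S.y₀, S.y₀)
  | k + 1 => S.spdt A r c s (G k (S.iter A r c s G k).1) (S.iter A r c s G k)

/-- The weighted average of the primal iterates `x_1, …, x_N`. -/
noncomputable def avgPrimal (S : Stage E F C) (A : E →L[ℝ] F) (r : F) (c : C) (s : StepSizes)
    (G : ℕ → E → StrongDual ℝ E) (N : ℕ) : E :=
  (∑ _k ∈ Finset.range N, s.w)⁻¹ • ∑ k ∈ Finset.range N, s.w • (S.iter A r c s G (k + 1)).1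

/-- The weighted average of the dual iterates `y_1, …, y_N`. -/
noncomputable def avgDual (S : Stage E F C) (A : E →L[ℝ] F) (r : F) (c : C) (s : StepSizes)
    (G : ℕ → E → StrongDual ℝ E) (N : ℕ) : F :=
  (∑ _k ∈ Finset.range N, s.w)⁻¹ • ∑ k ∈ Finset.range N, s.w • (S.iter A r c s G (k + 1)).2.1

/-- The aggressive parameter setting for `N` steps, subgradient bound `M` and `a = ‖A‖`. -/
noncomputable def aggressive (S : Stage E F C) (N : ℕ) (M a : ℝ) : StepSizes where
  w := 1
  θ := 1
  τ := max (M * √(3 * N) / (S.Ω * √S.α)) (√2 * a / √S.α)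
  η := √2 * a / √S.α

/-- The conservative parameter setting for `N` steps, subgradient bound `M` and `a = ‖A‖`. -/
noncomputable def conservative (S : Stage E F C) (N : ℕ) (M a : ℝ) : StepSizes where
  w := 1
  θ := 1
  τ := max (M * √(3 * N) / (S.Ω * √S.α)) (√2 * a / √(S.α * N))
  η := √(2 * N) * a / √S.α

/-- Standing assumptions on the deterministic data of a stage: `X` is compact and convex,
`h(·, c)` is convex and lower semicontinuous on `X`, `ω` is continuously differentiable and
`α`-strongly convex on `X`, the initial point is in `X`, and the primal step is Borel measurable
in its inputs. -/
structure IsValid [MeasurableSpace E] [MeasurableSpace F] [MeasurableSpace C]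
    (S : Stage E F C) : Prop where
  isCompact : IsCompact S.X
  convex : Convex ℝ S.X
  convexOn_h : ∀ c, ConvexOn ℝ S.X fun x => S.h x c
  lsc_h : ∀ c, LowerSemicontinuousOn (fun x => S.h x c) S.X
  hasDeriv_ω : ∀ x ∈ S.X, HasFDerivWithinAt S.ω (S.dω x) S.X x
  continuousOn_dω : ContinuousOn S.dω S.X
  α_pos : 0 < S.α
  strong : ∀ x ∈ S.X, ∀ x₁ ∈ S.X, S.α * ‖x₁ - x‖ ^ 2 ≤ (S.dω x₁ - S.dω x) (x₁ - x)
  x₀_mem : S.x₀ ∈ S.X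
  measurable_primalStep : Measurable
    fun q : (E →L[ℝ] F) × F × C × ℝ × StrongDual ℝ E × E × F =>
      S.primalStep q.1 q.2.1 q.2.2.1 q.2.2.2.1 q.2.2.2.2.1 q.2.2.2.2.2.1 q.2.2.2.2.2.2

end Stage

end SingleStage

section ThreeStages

variable {E₁ F₁ C₁ E₂ F₂ C₂ E₃ F₃ C₃ : Type*}
  [NormedAddCommGroup E₁] [NormedSpace ℝ E₁]
  [NormedAddCommGroup F₁] [InnerProductSpace ℝ F₁] [FiniteDimensional ℝ F₁]
  [NormedAddCommGroup E₂] [NormedSpace ℝ E₂]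
  [NormedAddCommGroup F₂] [InnerProductSpace ℝ F₂] [FiniteDimensional ℝ F₂] [MeasurableSpace F₂] [MeasurableSpace C₂]
  [NormedAddCommGroup E₃] [NormedSpace ℝ E₃]
  [NormedAddCommGroup F₃] [InnerProductSpace ℝ F₃] [FiniteDimensional ℝ F₃] [MeasurableSpace F₃] [MeasurableSpace C₃]

variable (E₁ F₁ C₁ E₂ F₂ C₂ E₃ F₃ C₃) in
/-- A three-stage stochastic conic problem: the stages, the first-stage data `A¹, b¹, c¹`, the
law `μ` of `ξ²`, and the conditional law `κ ξ²` of `ξ³` given `ξ²`. -/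
structure Problem where
  S₁ : Stage E₁ F₁ C₁
  S₂ : Stage E₂ F₂ C₂
  S₃ : Stage E₃ F₃ C₃
  A₁ : E₁ →L[ℝ] F₁
  b₁ : F₁
  c₁ : C₁
  μ : Measure (Scenario E₁ E₂ F₂ C₂)
  κ : Kernel (Scenario E₁ E₂ F₂ C₂) (Scenario E₂ E₃ F₃ C₃)

namespace Problem

variable (P : Problem E₁ F₁ C₁ E₂ F₂ C₂ E₃ F₃ C₃)

/-- The stochastic third-stage value function `V³(x², ξ³)`. -/
noncomputable def V₃ (x₂ : E₂) (ξ₃ : Scenario E₂ E₃ F₃ C₃) : ℝ :=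
  P.S₃.value ξ₃.A (ξ₃.rhs x₂) ξ₃.c 0

/-- The expected third-stage value function `v³(x²) = E[V³(x², ξ³) | ξ²]`. -/
noncomputable def v₃ (ξ₂ : Scenario E₁ E₂ F₂ C₂) (x₂ : E₂) : ℝ :=
  ∫ ξ₃, P.V₃ x₂ ξ₃ ∂(P.κ ξ₂)

/-- The stochastic second-stage value function `V²(x¹, ξ²)`. -/
noncomputable def V₂ (x₁ : E₁) (ξ₂ : Scenario E₁ E₂ F₂ C₂) : ℝ :=
  P.S₂.value ξ₂.A (ξ₂.rhs x₁) ξ₂.c (P.v₃ ξ₂)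

/-- The expected second-stage value function `v²(x¹) = E[V²(x¹, ξ²)]`. -/
noncomputable def v₂ (x₁ : E₁) : ℝ := ∫ ξ₂, P.V₂ x₁ ξ₂ ∂P.μ

/-- The first-stage objective `h¹(x, c¹) + v²(x)`. -/
noncomputable def objective (x : E₁) : ℝ := P.S₁.h x P.c₁ + P.v₂ x

/-- `x` and `y` are optimal primal and dual solutions of the first-stage problem. -/
def IsFirstStageSaddle (x : E₁) (y : F₁) : Prop :=
  P.S₁.IsSaddle P.A₁ P.b₁ P.c₁ P.v₂ x y

/-- Standing assumptions on the problem, and on the selections `y₂ x¹ ξ²` and `y₃ x² ξ³` of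
optimal dual solutions of the second- and third-stage problems on which the numbers of iterations
depend. The last two fields say that these problems have a primal-dual pair of optimal solutions
without duality gap, almost surely. -/
structure Assumptions [MeasurableSpace E₁] [MeasurableSpace F₁] [MeasurableSpace C₁]
    [MeasurableSpace E₂] [MeasurableSpace E₃]
    (y₂ : E₁ → Scenario E₁ E₂ F₂ C₂ → F₂) (y₃ : E₂ → Scenario E₂ E₃ F₃ C₃ → F₃) : Prop where
  isProbability_μ : IsProbabilityMeasure P.μ
  isMarkov_κ : IsMarkovKernel P.κ
  valid₁ : P.S₁.IsValid
  valid₂ : P.S₂.IsValid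
  valid₃ : P.S₃.IsValid
  nontrivial₁ : P.S₁.X.Nontrivial
  nontrivial₂ : P.S₂.X.Nontrivial
  A₁_ne : P.A₁ ≠ 0
  A₂_ne : ∀ᵐ ξ₂ ∂P.μ, ξ₂.A ≠ 0
  A₃_ne : ∀ᵐ ξ₂ ∂P.μ, ∀ᵐ ξ₃ ∂(P.κ ξ₂), ξ₃.A ≠ 0
  integrable_V₂ : ∀ x₁ ∈ P.S₁.X, Integrable (P.V₂ x₁) P.μ
  integrable_V₃ : ∀ᵐ ξ₂ ∂P.μ, ∀ x₂ ∈ P.S₂.X, Integrable (P.V₃ x₂) (P.κ ξ₂)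
  measurable_y₂ : Measurable fun q : E₁ × Scenario E₁ E₂ F₂ C₂ => y₂ q.1 q.2
  measurable_y₃ : Measurable fun q : E₂ × Scenario E₂ E₃ F₃ C₃ => y₃ q.1 q.2
  saddle₂ : ∀ x₁ ∈ P.S₁.X, ∀ᵐ ξ₂ ∂P.μ,
    ∃ x, P.S₂.IsSaddle ξ₂.A (ξ₂.rhs x₁) ξ₂.c (P.v₃ ξ₂) x (y₂ x₁ ξ₂)
  saddle₃ : ∀ᵐ ξ₂ ∂P.μ, ∀ x₂ ∈ P.S₂.X, ∀ᵐ ξ₃ ∂(P.κ ξ₂),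
    ∃ x, P.S₃.IsSaddle ξ₃.A (ξ₃.rhs x₂) ξ₃.c 0 x (y₃ x₂ ξ₃)

/-- Uniform bounds on the random data and on the selected dual solutions. -/
structure Bounded (y₂ : E₁ → Scenario E₁ E₂ F₂ C₂ → F₂)
    (y₃ : E₂ → Scenario E₂ E₃ F₃ C₃ → F₃) (D : ℝ) : Prop where
  pos : 0 < D
  norm_B₂_le : ∀ᵐ ξ₂ ∂P.μ, ‖ξ₂.B‖ ≤ D
  norm_B₃_le : ∀ᵐ ξ₂ ∂P.μ, ∀ᵐ ξ₃ ∂(P.κ ξ₂), ‖ξ₃.B‖ ≤ D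
  norm_A₂_le : ∀ᵐ ξ₂ ∂P.μ, ‖ξ₂.A‖ ≤ D
  le_norm_A₂ : ∀ᵐ ξ₂ ∂P.μ, D⁻¹ ≤ ‖ξ₂.A‖
  norm_y₂_le : ∀ x₁ ∈ P.S₁.X, ∀ᵐ ξ₂ ∂P.μ, ‖y₂ x₁ ξ₂‖ ≤ D
  norm_y₃_le : ∀ᵐ ξ₂ ∂P.μ, ∀ x₂ ∈ P.S₂.X, ∀ᵐ ξ₃ ∂(P.κ ξ₂), ‖y₃ x₂ ξ₃‖ ≤ D

/-! ### The innermost loop -/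

/-- The number of steps of the innermost loop (an integer, at least `1`). -/
noncomputable def N₃ (y₃ : E₂ → Scenario E₂ E₃ F₃ C₃ → F₃) (ε : ℝ)
    (x₂ : E₂) (ξ₃ : Scenario E₂ E₃ F₃ C₃) : ℕ :=
  max 1 ⌈3 * √2 * ‖ξ₃.A‖ * (2 * P.S₃.Ω ^ 2 + ‖y₃ x₂ ξ₃ - P.S₃.y₀‖ ^ 2) / (√P.S₃.α * ε)⌉₊

/-- The averaged dual point `ȳ³` returned by the innermost loop. -/
noncomputable def ybar₃ (y₃ : E₂ → Scenario E₂ E₃ F₃ C₃ → F₃) (ε : ℝ)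
    (x₂ : E₂) (ξ₃ : Scenario E₂ E₃ F₃ C₃) : F₃ :=
  P.S₃.avgDual ξ₃.A (ξ₃.rhs x₂) ξ₃.c (P.S₃.aggressive (P.N₃ y₃ ε x₂ ξ₃) 0 ‖ξ₃.A‖)
    (fun _ _ => 0) (P.N₃ y₃ ε x₂ ξ₃)

/-- The stochastic subgradient `(B³)ᵀ ȳ³` of `v³` at `x²`, as a linear functional. -/
noncomputable def G₃ (y₃ : E₂ → Scenario E₂ E₃ F₃ C₃ → F₃) (ε : ℝ)
    (x₂ : E₂) (ξ₃ : Scenario E₂ E₃ F₃ C₃) : StrongDual ℝ E₂ :=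
  (innerSL ℝ (P.ybar₃ y₃ ε x₂ ξ₃)).comp ξ₃.B

/-- `M₃` is a Lipschitz constant of `v³` on `X²` and bounds the conditional second moment of the
dual norm of the stochastic subgradients of `v³` by `M₃²`. -/
def IsBound₃ (y₃ : E₂ → Scenario E₂ E₃ F₃ C₃ → F₃) (ε M₃ : ℝ) : Prop :=
  0 ≤ M₃ ∧ ∀ᵐ ξ₂ ∂P.μ,
    (∀ x ∈ P.S₂.X, ∀ x' ∈ P.S₂.X, |P.v₃ ξ₂ x - P.v₃ ξ₂ x'| ≤ M₃ * ‖x - x'‖) ∧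
    ∀ x ∈ P.S₂.X, ∫⁻ ξ₃, ‖P.G₃ y₃ ε x ξ₃‖ₑ ^ 2 ∂(P.κ ξ₂) ≤ ENNReal.ofReal (M₃ ^ 2)

/-! ### The middle loop -/

/-- The number of steps of the middle loop (an integer, at least `1`). -/
noncomputable def N₂ (y₂ : E₁ → Scenario E₁ E₂ F₂ C₂ → F₂) (ε M₃ : ℝ)
    (x₁ : E₁) (ξ₂ : Scenario E₁ E₂ F₂ C₂) : ℕ :=
  max 1 ⌈(12 * √2 * ‖ξ₂.A‖ * P.S₂.Ω ^ 2 / (√P.S₂.α * ε)) ^ (2 / 3 : ℝ)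
    + (6 * (‖ξ₂.A‖ * ‖y₂ x₁ ξ₂ - P.S₂.y₀‖ ^ 2 + 4 * √3 * M₃ * P.S₂.Ω)
        / (√P.S₂.α * ε)) ^ 2⌉₊

/-- The averaged dual point `ȳ²` returned by the middle loop, run with the realization `ξ²` and
the realizations `ζ 0, ζ 1, …` of `ξ³`. -/
noncomputable def ybar₂ (y₂ : E₁ → Scenario E₁ E₂ F₂ C₂ → F₂)
    (y₃ : E₂ → Scenario E₂ E₃ F₃ C₃ → F₃) (ε M₃ : ℝ)
    (x₁ : E₁) (ξ₂ : Scenario E₁ E₂ F₂ C₂) (ζ : ℕ → Scenario E₂ E₃ F₃ C₃) : F₂ :=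
  P.S₂.avgDual ξ₂.A (ξ₂.rhs x₁) ξ₂.c (P.S₂.conservative (P.N₂ y₂ ε M₃ x₁ ξ₂) M₃ ‖ξ₂.A‖)
    (fun j x => P.G₃ y₃ ε x (ζ j)) (P.N₂ y₂ ε M₃ x₁ ξ₂)

/-- The stochastic subgradient `(B²)ᵀ ȳ²` of `v²` at `x¹`, as a linear functional. -/
noncomputable def G₂ (y₂ : E₁ → Scenario E₁ E₂ F₂ C₂ → F₂)
    (y₃ : E₂ → Scenario E₂ E₃ F₃ C₃ → F₃) (ε M₃ : ℝ)
    (x₁ : E₁) (ξ₂ : Scenario E₁ E₂ F₂ C₂) (ζ : ℕ → Scenario E₂ E₃ F₃ C₃) : StrongDual ℝ E₁ :=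
  (innerSL ℝ (P.ybar₂ y₂ y₃ ε M₃ x₁ ξ₂ ζ)).comp ξ₂.B

/-- `M₂` is a Lipschitz constant of `v²` on `X¹` and bounds the second moment of the dual norm of
the stochastic subgradients of `v²` by `M₂²`; here `ξ²` has law `μ` and, given `ξ²`, the
realizations `ζ j` are independent with law `κ ξ²`. -/
def IsBound₂ (y₂ : E₁ → Scenario E₁ E₂ F₂ C₂ → F₂)
    (y₃ : E₂ → Scenario E₂ E₃ F₃ C₃ → F₃) (ε M₃ M₂ : ℝ) : Prop :=
  0 ≤ M₂ ∧
    (∀ x ∈ P.S₁.X, ∀ x' ∈ P.S₁.X, |P.v₂ x - P.v₂ x'| ≤ M₂ * ‖x - x'‖) ∧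
    ∀ x ∈ P.S₁.X,
      ∫⁻ ξ₂, ∫⁻ ζ, ‖P.G₂ y₂ y₃ ε M₃ x ξ₂ ζ‖ₑ ^ 2
        ∂(Measure.infinitePi fun _ : ℕ => P.κ ξ₂) ∂P.μ ≤ ENNReal.ofReal (M₂ ^ 2)

/-! ### The outer loop -/

/-- The number of steps of the outer loop (an integer, at least `1`); `ys` is an optimal dual
solution of the first-stage problem. -/
noncomputable def N₁ (ys : F₁) (ε M₂ : ℝ) : ℕ :=
  max 1 ⌈max
    (6 * √2 * ‖P.A₁‖ * (2 * P.S₁.Ω ^ 2 + ‖P.S₁.y₀‖ ^ 2) / (√P.S₁.α * ε)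
      + (24 * √3 * M₂ * P.S₁.Ω / (√P.S₁.α * ε)) ^ 2)
    (6 * ‖P.A₁‖ * (√(2 * P.S₁.α) * ‖ys - P.S₁.y₀‖ + 2 * P.S₁.Ω + 3 * √P.S₁.α)
        / (P.S₁.α * ε)
      + (6 * √3 * M₂ * (√2 * ‖P.A₁‖ + √P.S₁.α) / (P.S₁.α * ε)) ^ 2)⌉₊

/-- The parameters of the outer loop. -/
noncomputable def outerSteps (ys : F₁) (ε M₂ : ℝ) : StepSizes :=
  P.S₁.aggressive (P.N₁ ys ε M₂) M₂ ‖P.A₁‖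

/-- The state `(x¹_i, y¹_i, y¹_{i-1})` of the outer loop after `i` steps, where iteration `i + 1`
uses the realization `ξ i` of `ξ²` and the realizations `ζ i 0, ζ i 1, …` of `ξ³`. -/
noncomputable def outerIter (y₂ : E₁ → Scenario E₁ E₂ F₂ C₂ → F₂)
    (y₃ : E₂ → Scenario E₂ E₃ F₃ C₃ → F₃) (ys : F₁) (ε M₃ M₂ : ℝ)
    (ξ : ℕ → Scenario E₁ E₂ F₂ C₂) (ζ : ℕ → ℕ → Scenario E₂ E₃ F₃ C₃) (i : ℕ) : E₁ × F₁ × F₁ :=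
  P.S₁.iter P.A₁ P.b₁ P.c₁ (P.outerSteps ys ε M₂)
    (fun i x => P.G₂ y₂ y₃ ε M₃ x (ξ i) (ζ i)) i

/-- The output `x̄¹` of the algorithm. -/
noncomputable def output (y₂ : E₁ → Scenario E₁ E₂ F₂ C₂ → F₂)
    (y₃ : E₂ → Scenario E₂ E₃ F₃ C₃ → F₃) (ys : F₁) (ε M₃ M₂ : ℝ)
    (ξ : ℕ → Scenario E₁ E₂ F₂ C₂) (ζ : ℕ → ℕ → Scenario E₂ E₃ F₃ C₃) : E₁ :=
  P.S₁.avgPrimal P.A₁ P.b₁ P.c₁ (P.outerSteps ys ε M₂)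
    (fun i x => P.G₂ y₂ y₃ ε M₃ x (ξ i) (ζ i)) (P.N₁ ys ε M₂)

/-- The number of realizations of `ξ²` used by the algorithm: one in each outer iteration. -/
noncomputable def samples₂ (ys : F₁) (ε M₂ : ℝ) : ℕ := P.N₁ ys ε M₂

/-- The number of realizations of `ξ³` used by the algorithm: one in each middle iteration. -/
noncomputable def samples₃ (y₂ : E₁ → Scenario E₁ E₂ F₂ C₂ → F₂)
    (y₃ : E₂ → Scenario E₂ E₃ F₃ C₃ → F₃) (ys : F₁) (ε M₃ M₂ : ℝ)
    (ξ : ℕ → Scenario E₁ E₂ F₂ C₂) (ζ : ℕ → ℕ → Scenario E₂ E₃ F₃ C₃) : ℕ :=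
  ∑ i ∈ Finset.range (P.N₁ ys ε M₂),
    P.N₂ y₂ ε M₃ (P.outerIter y₂ y₃ ys ε M₃ M₂ ξ ζ i).1 (ξ i)

/-- The sampling scheme: the blocks `(ξ i, (ζ i j)_j)` are independent and identically
distributed, `ξ i` has law `μ` and, given `ξ i`, the `ζ i j` are independent with law `κ (ξ i)`. -/
structure IsSampling {Ω : Type*} [MeasurableSpace Ω] (ν : Measure Ω)
    (ξ : ℕ → Ω → Scenario E₁ E₂ F₂ C₂) (ζ : ℕ → ℕ → Ω → Scenario E₂ E₃ F₃ C₃) : Prop where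
  measurable_ξ : ∀ i, Measurable (ξ i)
  measurable_ζ : ∀ i j, Measurable (ζ i j)
  indep : iIndepFun (fun i ω => (ξ i ω, fun j => ζ i j ω)) ν
  law : ∀ i, ∀ T : Set (Scenario E₁ E₂ F₂ C₂ × (ℕ → Scenario E₂ E₃ F₃ C₃)), MeasurableSet T →
    ν {ω | (ξ i ω, fun j => ζ i j ω) ∈ T} =
      ∫⁻ s, (Measure.infinitePi fun _ : ℕ => P.κ s) {z | (s, z) ∈ T} ∂P.μ

end Problem

end ThreeStages

end DSA

set_option linter.unusedSectionVars false
set_option linter.style.haveILetI false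

namespace DSA

/-! Everything rests on one deterministic inequality for a single primal-dual step, `step_gap_le`.
The optimality conditions of the two proximal subproblems bound the Lagrangian gap between the new
iterate and a comparison pair (x, y) by the decrease of a potential plus `noise`, the price of using
a random functional in place of a subgradient of v. The extrapolation 2y - y₋ makes the bilinear
coupling telescope, and 2‖A‖² ≤ τ α η lets the prox terms absorb what is left of it. The summed
inequality `sum_gap_le` is used with three kinds of comparison pair.

Take y optimal for the current right-hand side and x optimal for another one: the averaged dual
point is then an inexact subgradient of the optimal value as a function of the right-hand side
(`Stage.IsValid.value_add_inner_le`). Take y = 0: the objective at the averaged primal point is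
bounded. Take a saddle pair: the gap is nonnegative, so the dual iterates cannot drift far from y*.
Up to an element of K, the averaged residual telescopes to a multiple of y₀ - y_N, so this last
bound controls infeasibility.

Errors propagate through the stages as ε/6, ε/2, ε. The innermost loop has no noise and gives ε/6
pathwise. In the other two loops the current iterate is independent of the fresh sample, so the mean
noise of a step is computed by Fubini at a frozen point (`integral_noise_le`): it is at most
4M²/(τα) plus the bias inherited from the stage below. The choice of τ balances the variance term
against τΩ² (`max_stepSize_budget`), and the step counts are what the resulting bounds require.

For (b), M₂ must not depend on ε although the middle loop gets longer as ε decreases. Its error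
budget grows like √N₂ + N₂ε, but the conservative η grows like √N₂ and is divided out; as N₂ε² is
bounded, the dual iterates have bounded second moments (`conservative_dual_budget`,
`lintegral_ybar₂_le`). With both constants fixed, N₁ and N₂ are O(ε⁻²), and the sample count of ξ³
is at most their product. The bound on N₂ holds almost surely for each fixed x¹ and is carried over
to the random outer iterates by independence (`ae_outerIter`). -/

theorem argminOn_spec {V : Type*} [Nonempty V] {S : Set V} {f : V → ℝ}
    (h : ∃ x ∈ S, IsMinOn f S x) : argminOn S f ∈ S ∧ IsMinOn f S (argminOn S f) :=
  Classical.epsilon_spec (p := fun x => x ∈ S ∧ IsMinOn f S x) h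

theorem mul_le_quarter_mul_sq_add_sq_div {β : ℝ} (hβ : 0 < β) (c d : ℝ) :
    c * d ≤ β / 4 * d ^ 2 + c ^ 2 / β := by
  have h : 0 ≤ (β * d / 2 - c) ^ 2 / β := by positivity
  have e : (β * d / 2 - c) ^ 2 / β = β / 4 * d ^ 2 + c ^ 2 / β - c * d := by
    field_simp; ring
  linarith

namespace Stage

variable {E F C : Type*} [NormedAddCommGroup E] [NormedSpace ℝ E]
    [NormedAddCommGroup F] [InnerProductSpace ℝ F] [FiniteDimensional ℝ F]
    [MeasurableSpace E] [MeasurableSpace F] [MeasurableSpace C]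
    {S : Stage E F C}

/-! ### Bregman distance: strong convexity, continuity and diameter -/

namespace IsValid

theorem continuousOn_ω (hS : S.IsValid) : ContinuousOn S.ω S.X := fun x hx =>
  (hS.hasDeriv_ω x hx).continuousWithinAt

theorem hasDerivWithinAt_line (hS : S.IsValid) {x x₁ : E} (hx : x ∈ S.X) (hx₁ : x₁ ∈ S.X)
    {t : ℝ} (ht : t ∈ Icc (0 : ℝ) 1) :
    HasDerivWithinAt (fun s : ℝ => S.ω (x + s • (x₁ - x))) (S.dω (x + t • (x₁ - x)) (x₁ - x))
      (Icc 0 1) t := by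
  have hmem : ∀ s ∈ Icc (0 : ℝ) 1, x + s • (x₁ - x) ∈ S.X := fun s hs =>
    hS.convex.add_smul_sub_mem hx hx₁ hs
  have hl : HasDerivWithinAt (fun s : ℝ => x + s • (x₁ - x)) (x₁ - x) (Icc 0 1) t := by
    simpa using (((hasDerivAt_id t).smul_const (x₁ - x)).const_add x).hasDerivWithinAt
  exact (hS.hasDeriv_ω _ (hmem t ht)).comp_hasDerivWithinAt t hl hmem

/-- Along the segment, ω minus its linearization minus the quadratic has nonnegative derivative by
strong monotonicity of dω, so its value at 1 is at least its value at 0. -/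
theorem le_bregman (hS : S.IsValid) {x x₁ : E} (hx : x ∈ S.X) (hx₁ : x₁ ∈ S.X) :
    S.α / 2 * ‖x₁ - x‖ ^ 2 ≤ S.bregman x x₁ := by
  have hmem : ∀ s ∈ Icc (0 : ℝ) 1, x + s • (x₁ - x) ∈ S.X := fun s hs =>
    hS.convex.add_smul_sub_mem hx hx₁ hs
  have hd : ∀ t ∈ Icc (0 : ℝ) 1, HasDerivWithinAt
      (fun s : ℝ => S.ω (x + s • (x₁ - x)) - s * S.dω x (x₁ - x)
        - s ^ 2 * (S.α / 2 * ‖x₁ - x‖ ^ 2))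
      (S.dω (x + t • (x₁ - x)) (x₁ - x) - S.dω x (x₁ - x) - t * (S.α * ‖x₁ - x‖ ^ 2))
      (Icc 0 1) t := by
    intro t ht
    have h1 := (hasDerivWithinAt_id t (Icc (0 : ℝ) 1)).mul_const (S.dω x (x₁ - x))
    have h2 := ((hasDerivWithinAt_id t (Icc (0 : ℝ) 1)).pow 2).mul_const
      (S.α / 2 * ‖x₁ - x‖ ^ 2)
    refine (((hS.hasDerivWithinAt_line hx hx₁ ht).sub h1).sub h2).congr_deriv ?_
    simp; ring
  have hmono := monotoneOn_of_hasDerivWithinAt_nonneg (convex_Icc (0 : ℝ) 1)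
    (fun t ht => (hd t ht).continuousWithinAt)
    (fun t ht => (hd t (interior_subset ht)).mono interior_subset) (by
      intro t ht
      rw [interior_Icc] at ht
      have h := hS.strong x hx _ (hmem t ⟨ht.1.le, ht.2.le⟩)
      rw [add_sub_cancel_left, norm_smul, mul_pow, map_smul, Real.norm_eq_abs, sq_abs,
        smul_eq_mul, _root_.sub_apply] at h
      have ht0 := ht.1
      -- Strong monotonicity between x and x + t(x₁ - x) carries a factor t on the left and t² on
      -- the right; one factor t is cancelled.
      refine le_of_mul_le_mul_left ?_ ht0
      nlinarith)
  have h := hmono (left_mem_Icc.2 zero_le_one) (right_mem_Icc.2 zero_le_one) zero_le_one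
  simp only [zero_smul, add_zero, zero_mul, one_smul, add_sub_cancel, one_mul, one_pow] at h
  unfold bregman
  simp only [ne_eq, OfNat.ofNat_ne_zero, not_false_eq_true, zero_pow, zero_mul, sub_zero] at h
  linarith

theorem bregman_nonneg (hS : S.IsValid) {x x₁ : E} (hx : x ∈ S.X) (hx₁ : x₁ ∈ S.X) :
    0 ≤ S.bregman x x₁ := by
  have := hS.α_pos
  exact le_trans (by positivity) (hS.le_bregman hx hx₁)

theorem continuousOn_bregman (hS : S.IsValid) :
    ContinuousOn (fun q : E × E => S.bregman q.1 q.2) (S.X ×ˢ S.X) := by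
  unfold bregman
  have h1 : ContinuousOn (fun q : E × E => S.ω q.1) (S.X ×ˢ S.X) :=
    hS.continuousOn_ω.comp continuousOn_fst fun q hq => hq.1
  have h2 : ContinuousOn (fun q : E × E => S.ω q.2) (S.X ×ˢ S.X) :=
    hS.continuousOn_ω.comp continuousOn_snd fun q hq => hq.2
  have h3 : ContinuousOn (fun q : E × E => S.dω q.1) (S.X ×ˢ S.X) :=
    hS.continuousOn_dω.comp continuousOn_fst fun q hq => hq.1
  exact (h2.sub h1).sub (h3.clm_apply (continuousOn_snd.sub continuousOn_fst))

theorem bddAbove_bregman (hS : S.IsValid) : BddAbove (image2 S.bregman S.X S.X) := by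
  rw [← image_prod]
  exact ((hS.isCompact.prod hS.isCompact).image_of_continuousOn hS.continuousOn_bregman).bddAbove

theorem bregman_le (hS : S.IsValid) {x x₁ : E} (hx : x ∈ S.X) (hx₁ : x₁ ∈ S.X) :
    S.bregman x x₁ ≤ S.Ω ^ 2 := by
  have h := le_csSup hS.bddAbove_bregman (mem_image2_of_mem hx hx₁)
  rw [Ω, Real.sq_sqrt ((hS.bregman_nonneg hx hx₁).trans h)]
  exact h

theorem Ω_pos (hS : S.IsValid) (h : S.X.Nontrivial) : 0 < S.Ω := by
  obtain ⟨x, hx, y, hy, hne⟩ := h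
  have h1 := (hS.le_bregman hx hy).trans (hS.bregman_le hx hy)
  have h2 : 0 < ‖y - x‖ := norm_pos_iff.2 (sub_ne_zero.2 hne.symm)
  have := hS.α_pos
  have h3 : 0 < S.Ω ^ 2 := lt_of_lt_of_le (by positivity) h1
  exact lt_of_le_of_ne (Real.sqrt_nonneg _) fun h0 => by
    rw [← h0] at h3; norm_num at h3

theorem exists_norm_sub_le (hS : S.IsValid) :
    ∃ R, 0 ≤ R ∧ ∀ x ∈ S.X, ∀ y ∈ S.X, ‖x - y‖ ≤ R := by
  obtain ⟨R, hR⟩ := hS.isCompact.isBounded.exists_norm_le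
  refine ⟨2 * R, ?_, fun x hx y hy => ?_⟩
  · have := (norm_nonneg _).trans (hR _ hS.x₀_mem)
    linarith
  · have := norm_sub_le x y
    linarith [hR x hx, hR y hy]

end IsValid

theorem Ω_nonneg : 0 ≤ S.Ω := Real.sqrt_nonneg _

/-! ### The primal step -/

theorem IsValid.exists_primal_min (hS : S.IsValid) (A : E →L[ℝ] F) (r : F) (c : C) (τ : ℝ)
    (G : StrongDual ℝ E) {p : E} (hp : p ∈ S.X) (d : F) :
    ∃ x ∈ S.X, IsMinOn (fun x => inner ℝ (r - A x) d + S.h x c + G x + τ * S.bregman p x)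
      S.X x := by
  refine LowerSemicontinuousOn.exists_isMinOn ⟨p, hp⟩ hS.isCompact ?_
  have h1 : ContinuousOn (fun x => inner ℝ (r - A x) d) S.X := by fun_prop
  have h2 : ContinuousOn (fun x => S.bregman p x) S.X :=
    hS.continuousOn_bregman.comp (f := fun x => (p, x)) (by fun_prop) fun x hx => ⟨hp, hx⟩
  have h3 : ContinuousOn (fun x => G x) S.X := by fun_prop
  exact ((h1.lowerSemicontinuousOn.add (hS.lsc_h c)).add h3.lowerSemicontinuousOn).add
    (h2.const_mul τ).lowerSemicontinuousOn

theorem IsValid.primalStep_spec (hS : S.IsValid) (A : E →L[ℝ] F) (r : F) (c : C) {τ : ℝ}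
    (hτ : 0 < τ) (G : StrongDual ℝ E) {p : E} (hp : p ∈ S.X) (d : F) :
    S.primalStep A r c τ G p d ∈ S.X ∧
      IsMinOn (fun x => inner ℝ (r - A x) d + S.h x c + G x + τ * S.bregman p x) S.X
        (S.primalStep A r c τ G p d) := by
  rw [primalStep, if_pos ⟨hp, hτ⟩]
  exact argminOn_spec (hS.exists_primal_min A r c τ G hp d)

theorem IsValid.primalStep_mem (hS : S.IsValid) (A : E →L[ℝ] F) (r : F) (c : C) (τ : ℝ)
    (G : StrongDual ℝ E) {p : E} (hp : p ∈ S.X) (d : F) : S.primalStep A r c τ G p d ∈ S.X := by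
  by_cases hτ : 0 < τ
  · exact (hS.primalStep_spec A r c hτ G hp d).1
  · rw [primalStep, if_neg (fun h => hτ h.2)]
    exact hp

/-- As φ need not be differentiable, it is replaced on the segment from q to x by its chord, which
lies above it and agrees with it at q. The resulting one-variable function ψ is still minimal at 0
and has a one-sided derivative there; nonnegativity of that derivative, with the three-point
identity for Bregman distances, is the claim. -/
theorem IsValid.three_point (hS : S.IsValid) {φ : E → ℝ} (hφ : ConvexOn ℝ S.X φ) {τ : ℝ}
    {p q x : E} (hq : q ∈ S.X) (hx : x ∈ S.X)
    (hmin : IsMinOn (fun x => φ x + τ * S.bregman p x) S.X q) :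
    φ q - φ x ≤ τ * (S.bregman p x - S.bregman p q - S.bregman q x) := by
  set ψ : ℝ → ℝ := fun s => s * (φ x - φ q) + τ * (S.ω (q + s • (x - q)) - s * S.dω p (x - q))
    with hψ
  have hmem : ∀ s ∈ Icc (0 : ℝ) 1, q + s • (x - q) ∈ S.X := fun s hs =>
    hS.convex.add_smul_sub_mem hq hx hs
  have hd : HasDerivWithinAt ψ (φ x - φ q + τ * (S.dω q (x - q) - S.dω p (x - q)))
      (Icc 0 1) 0 := by
    have h0 := hS.hasDerivWithinAt_line hq hx (left_mem_Icc.2 zero_le_one)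
    have h1 := (hasDerivWithinAt_id (0 : ℝ) (Icc (0 : ℝ) 1)).mul_const (φ x - φ q)
    have h2 := (hasDerivWithinAt_id (0 : ℝ) (Icc (0 : ℝ) 1)).mul_const (S.dω p (x - q))
    refine (h1.add ((h0.sub h2).const_mul τ)).congr_deriv ?_
    simp
  have hm : IsMinOn ψ (Icc 0 1) 0 := by
    intro s hs
    have h1 := hmin (hmem s hs)
    have h2 := hφ.2 hq hx (sub_nonneg.2 hs.2) hs.1 (by ring)
    have e : (1 - s) • q + s • x = q + s • (x - q) := by
      rw [sub_smul, smul_sub, one_smul]; abel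
    rw [e, smul_eq_mul, smul_eq_mul] at h2
    simp only [mem_ofPred_eq, bregman, hψ] at h1 ⊢
    have e2 : S.dω p (q + s • (x - q) - p) = S.dω p (q - p) + s * S.dω p (x - q) := by
      rw [add_sub_right_comm, map_add, map_smul, smul_eq_mul]
    rw [e2] at h1
    simp only [zero_mul, zero_smul, add_zero, sub_zero]
    nlinarith
  have key := IsLocalMinOn.hasFDerivWithinAt_nonneg hm.localize hd.hasFDerivWithinAt
    (y := 1) (mem_posTangentConeAt_of_segment_subset (by simp [segment_eq_Icc]))
  simp only [ContinuousLinearMap.toSpanSingleton_apply, one_smul] at key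
  have e3 : S.bregman p x - S.bregman p q - S.bregman q x = S.dω q (x - q) - S.dω p (x - q) := by
    have : S.dω p (x - q) = S.dω p (x - p) - S.dω p (q - p) := by
      rw [← map_sub]; congr 1; abel
    simp only [bregman, this]; ring
  rw [e3]; linarith

theorem IsValid.primalStep_le (hS : S.IsValid) (A : E →L[ℝ] F) (r : F) (c : C) {τ : ℝ}
    (hτ : 0 < τ) (G : StrongDual ℝ E) {p : E} (hp : p ∈ S.X) (d : F) {x : E} (hx : x ∈ S.X)
    {q : E} (hq : q = S.primalStep A r c τ G p d) :
    (inner ℝ (r - A q) d + S.h q c + G q) - (inner ℝ (r - A x) d + S.h x c + G x)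
      ≤ τ * (S.bregman p x - S.bregman p q - S.bregman q x) := by
  subst hq
  obtain ⟨h1, h2⟩ := hS.primalStep_spec A r c hτ G hp d
  refine hS.three_point (φ := fun x => inner ℝ (r - A x) d + S.h x c + G x) ?_ h1 hx h2
  have hG : ConvexOn ℝ S.X fun x => G x := (G : E →ₗ[ℝ] ℝ).convexOn hS.convex
  have hA : ConvexOn ℝ S.X fun x => inner ℝ (r - A x) d := by
    refine ⟨hS.convex, fun u _ w _ a b _ _ hab => le_of_eq ?_⟩
    simp only [inner_sub_left, map_add, map_smul, inner_add_left, inner_smul_left, smul_eq_mul,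
      RCLike.conj_to_real]
    rw [← eq_sub_iff_add_eq'] at hab
    subst hab; ring
  exact (hA.add (hS.convexOn_h c)).add hG

/-! ### The dual step -/

theorem zero_mem_dualCone (S : Stage E F C) : (0 : F) ∈ S.dualCone := S.dualCone.zero_mem

/-- The bidual of a closed convex cone is the cone itself. This is how membership in K is obtained
from tests against dual vectors. -/
theorem mem_of_forall_dual {v : F} (h : ∀ y ∈ S.dualCone, 0 ≤ inner ℝ v y) : v ∈ S.K := by
  rw [← ProperCone.innerDual_innerDual S.K]
  intro y hy
  have := h y hy
  rwa [real_inner_comm] at this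

theorem inner_nonneg_of_mem {v y : F} (hv : v ∈ S.K) (hy : y ∈ S.dualCone) :
    0 ≤ inner ℝ v y := hy hv

theorem convex_dualCone (S : Stage E F C) : Convex ℝ (S.dualCone : Set F) :=
  fun _ hx _ hy _ _ ha hb _ => S.dualCone.add_mem (S.dualCone.smul_mem hx ha)
    (S.dualCone.smul_mem hy hb)

/-- The nearest point of the dual cone. -/
noncomputable def dualProj (S : Stage E F C) (w : F) : F :=
  argminOn (S.dualCone : Set F) fun y => ‖w - y‖

theorem dualProj_mem_and_inner_le (S : Stage E F C) (w : F) :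
    S.dualProj w ∈ S.dualCone ∧
      ∀ y ∈ S.dualCone, inner ℝ (w - S.dualProj w) (y - S.dualProj w) ≤ 0 := by
  have hne : (S.dualCone : Set F).Nonempty := ⟨0, S.zero_mem_dualCone⟩
  obtain ⟨v, hv, hvm⟩ := exists_norm_eq_iInf_of_complete_convex hne
    S.dualCone.isClosed.isComplete S.convex_dualCone w
  have hb : BddBelow (range fun y : (S.dualCone : Set F) => ‖w - y‖) :=
    ⟨0, by rintro _ ⟨y, rfl⟩; exact norm_nonneg _⟩
  obtain ⟨h1, h2⟩ := argminOn_spec (S := (S.dualCone : Set F)) (f := fun y => ‖w - y‖)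
    ⟨v, hv, fun y hy => by
      change ‖w - v‖ ≤ ‖w - y‖
      rw [hvm]
      exact ciInf_le hb ⟨y, hy⟩⟩
  refine ⟨h1, (norm_eq_iInf_iff_real_inner_le_zero S.convex_dualCone h1).1 ?_⟩
  haveI := hne.to_subtype
  exact le_antisymm (le_ciInf fun y => h2 y.2) (ciInf_le hb ⟨_, h1⟩)

/-- Adding the variational inequalities of two candidate projections forces their distance to
vanish. This identifies an arbitrarily selected minimizer with the projection. -/
theorem eq_dualProj {w v : F} (hv : v ∈ S.dualCone)
    (h : ∀ y ∈ S.dualCone, inner ℝ (w - v) (y - v) ≤ 0) : v = S.dualProj w := by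
  obtain ⟨h1, h2⟩ := S.dualProj_mem_and_inner_le w
  have a := h _ h1
  have b := h2 _ hv
  have e : inner ℝ (w - v) (S.dualProj w - v) + inner ℝ (w - S.dualProj w) (v - S.dualProj w)
      = ‖v - S.dualProj w‖ ^ 2 := by
    rw [← real_inner_self_eq_norm_sq]
    simp only [inner_sub_left, inner_sub_right]; ring
  have : ‖v - S.dualProj w‖ = 0 := by
    have := norm_nonneg (v - S.dualProj w)
    nlinarith
  exact sub_eq_zero.1 (norm_eq_zero.1 this)

/-- Adding the variational inequalities at the two points and applying Cauchy-Schwarz gives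
nonexpansiveness. Its use is that the dual step is measurable in its inputs without further
assumption. -/
theorem lipschitzWith_dualProj (S : Stage E F C) : LipschitzWith 1 S.dualProj := by
  refine LipschitzWith.mk_one fun w w' => ?_
  rw [dist_eq_norm, dist_eq_norm]
  obtain ⟨h1, h2⟩ := S.dualProj_mem_and_inner_le w
  obtain ⟨h1', h2'⟩ := S.dualProj_mem_and_inner_le w'
  have a := h2 _ h1'
  have b := h2' _ h1
  set u := S.dualProj w
  set u' := S.dualProj w'
  have e : inner ℝ (w - u) (u' - u) + inner ℝ (w' - u') (u - u')
      = ‖u - u'‖ ^ 2 - inner ℝ (w - w') (u - u') := by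
    rw [← real_inner_self_eq_norm_sq]
    simp only [inner_sub_left, inner_sub_right]; ring
  have c := real_inner_le_norm (w - w') (u - u')
  by_contra! hlt
  have := norm_nonneg (w - w')
  nlinarith

/-- Completing the square turns the proximal objective into a multiple of the squared distance to d
- η⁻¹(-r + Ap), up to a constant. -/
theorem dualStep_eq_dualProj (A : E →L[ℝ] F) (r : F) {η : ℝ} (hη : 0 < η) (p : E) (d : F) :
    S.dualStep A r η p d = S.dualProj (d - η⁻¹ • (-r + A p)) := by
  rw [dualStep, if_pos hη]
  set g : F := -r + A p
  have hexp : ∀ y, inner ℝ g y + η / 2 * ‖y - d‖ ^ 2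
      = η / 2 * ‖(d - η⁻¹ • g) - y‖ ^ 2 + (inner ℝ g d - ‖g‖ ^ 2 / (2 * η)) := by
    intro y
    have e : (d - η⁻¹ • g) - y = -((y - d) + η⁻¹ • g) := by abel
    rw [e, norm_neg, norm_add_sq_real, norm_smul, inner_smul_right, Real.norm_eq_abs, mul_pow,
      sq_abs, inner_sub_left, real_inner_comm y g, real_inner_comm d g]
    field_simp
    ring
  obtain ⟨h1, h2⟩ := S.dualProj_mem_and_inner_le (d - η⁻¹ • g)
  obtain ⟨h3, h4⟩ := argminOn_spec (S := (S.dualCone : Set F))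
    (f := fun y => inner ℝ g y + η / 2 * ‖y - d‖ ^ 2) ⟨S.dualProj (d - η⁻¹ • g), h1, by
      intro y hy
      simp only [mem_ofPred_eq, hexp]
      have h := h2 y hy
      have e : (d - η⁻¹ • g) - y = (d - η⁻¹ • g - S.dualProj (d - η⁻¹ • g))
        - (y - S.dualProj (d - η⁻¹ • g)) := by abel
      have hle : ‖(d - η⁻¹ • g) - S.dualProj (d - η⁻¹ • g)‖ ^ 2 ≤ ‖(d - η⁻¹ • g) - y‖ ^ 2 := by
        rw [e, norm_sub_sq_real (d - η⁻¹ • g - S.dualProj (d - η⁻¹ • g))]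
        nlinarith [sq_nonneg ‖y - S.dualProj (d - η⁻¹ • g)‖]
      have := mul_le_mul_of_nonneg_left hle (half_pos hη).le
      linarith⟩
  generalize argminOn (S.dualCone : Set F) (fun y => inner ℝ g y + η / 2 * ‖y - d‖ ^ 2) = v
    at h3 h4 ⊢
  refine eq_dualProj h3 ?_
  refine (norm_eq_iInf_iff_real_inner_le_zero S.convex_dualCone h3).1 ?_
  haveI : Nonempty (S.dualCone : Set F) := ⟨⟨0, S.zero_mem_dualCone⟩⟩
  refine le_antisymm (le_ciInf fun y => ?_)
    (ciInf_le ⟨0, by rintro _ ⟨y, rfl⟩; exact norm_nonneg _⟩ (⟨_, h3⟩ : (S.dualCone : Set F)))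
  have h := h4 y.2
  simp only [mem_ofPred_eq, hexp] at h
  refine (pow_le_pow_iff_left₀ (norm_nonneg _) (norm_nonneg _) two_ne_zero).1 ?_
  have h' : η / 2 * _ ≤ η / 2 * _ := le_of_add_le_add_right h
  exact le_of_mul_le_mul_left h' (half_pos hη)

theorem dualStep_mem (A : E →L[ℝ] F) (r : F) {η : ℝ} (hη : 0 < η) (p : E) (d : F) :
    S.dualStep A r η p d ∈ S.dualCone := by
  rw [dualStep_eq_dualProj A r hη]
  exact (S.dualProj_mem_and_inner_le _).1

theorem dualStep_inner_nonneg (A : E →L[ℝ] F) (r : F) {η : ℝ} (hη : 0 < η) (p : E) (d : F)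
    {y : F} (hy : y ∈ S.dualCone) :
    0 ≤ inner ℝ (-r + A p + η • (S.dualStep A r η p d - d)) (y - S.dualStep A r η p d) := by
  rw [dualStep_eq_dualProj A r hη]
  have h := (S.dualProj_mem_and_inner_le (d - η⁻¹ • (-r + A p))).2 y hy
  set u := S.dualProj (d - η⁻¹ • (-r + A p))
  have e : -r + A p + η • (u - d) = -(η • (d - η⁻¹ • (-r + A p) - u)) := by
    rw [smul_sub, smul_sub, smul_sub, smul_smul, mul_inv_cancel₀ hη.ne', one_smul]; abel
  rw [e, inner_neg_left, inner_smul_left]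
  have := mul_nonpos_of_nonneg_of_nonpos hη.le h
  simpa using this

theorem dualStep_le (A : E →L[ℝ] F) (r : F) {η : ℝ} (hη : 0 < η) (p : E) (d : F)
    {y u : F} (hy : y ∈ S.dualCone) (hu : u = S.dualStep A r η p d) :
    inner ℝ (-r + A p) u - inner ℝ (-r + A p) y
      ≤ η / 2 * (‖y - d‖ ^ 2 - ‖u - d‖ ^ 2 - ‖y - u‖ ^ 2) := by
  have h := S.dualStep_inner_nonneg A r hη p d hy
  rw [← hu, inner_add_left, inner_smul_left, inner_sub_right] at h
  have e : ‖y - d‖ ^ 2 = ‖u - d‖ ^ 2 + ‖y - u‖ ^ 2 + 2 * inner ℝ (u - d) (y - u) := by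
    rw [show y - d = (u - d) + (y - u) by abel, norm_add_sq_real]; ring
  rw [e]
  simp only [RCLike.conj_to_real] at h
  linarith

/-- The variational inequality is tested at the new dual point plus an arbitrary y of the dual cone,
which makes the vector nonnegative on the whole dual cone. Summed over the steps, this produces the
feasibility residual. -/
theorem dualStep_add_mem (A : E →L[ℝ] F) (r : F) {η : ℝ} (hη : 0 < η) (p : E) (d : F) :
    A p - r + η • (S.dualStep A r η p d - d) ∈ S.K := by
  refine mem_of_forall_dual fun y hy => ?_
  have h := S.dualStep_inner_nonneg A r hη p d
    (S.dualCone.add_mem hy (S.dualStep_mem A r hη p d))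
  rw [add_sub_cancel_right] at h
  rwa [show A p - r = -r + A p by abel]

end Stage

namespace Stage

variable {E F C : Type*} [NormedAddCommGroup E] [NormedSpace ℝ E]
    [NormedAddCommGroup F] [InnerProductSpace ℝ F] [FiniteDimensional ℝ F]
    [MeasurableSpace E] [MeasurableSpace F] [MeasurableSpace C]
    {S : Stage E F C}

/-! ### The primal-dual loop -/

/-- The error term contributed to the gap estimate by a step from `p` that uses the functional
`g` in place of a subgradient of `v`, compared with the point `x`. -/
noncomputable def noise (S : Stage E F C) (τ M : ℝ) (v : E → ℝ) (g : StrongDual ℝ E)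
    (p x : E) : ℝ :=
  (‖g‖ + M) ^ 2 / (τ * S.α) + (g (x - p) + v p - v x)

theorem norm_mul_mul_le {A : E →L[ℝ] F} {β η : ℝ} (hβ : 0 < β) (hA : 2 * ‖A‖ ^ 2 ≤ β * η)
    (u : E) (w : F) : inner ℝ (A u) w ≤ β / 4 * ‖u‖ ^ 2 + η / 2 * ‖w‖ ^ 2 := by
  have h1 : inner ℝ (A u) w ≤ ‖A‖ * ‖u‖ * ‖w‖ :=
    (real_inner_le_norm _ _).trans
      (mul_le_mul_of_nonneg_right (A.le_opNorm u) (norm_nonneg _))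
  have h2 := mul_le_quarter_mul_sq_add_sq_div hβ (‖A‖ * ‖w‖) ‖u‖
  have h3 : (‖A‖ * ‖w‖) ^ 2 / β ≤ η / 2 * ‖w‖ ^ 2 := by
    rw [div_le_iff₀ hβ]
    have := mul_le_mul_of_nonneg_right hA (sq_nonneg ‖w‖)
    nlinarith
  linarith [show ‖A‖ * ‖u‖ * ‖w‖ = ‖A‖ * ‖w‖ * ‖u‖ by ring]

/-- The bracketed terms are a potential, evaluated at the new state on the left and at the old state
on the right. After extrapolation the only coupling that does not telescope is ⟪A(q - p), d - e⟫.
The prox term τ B(p, q) supplies (τα/2)‖q - p‖²: half of it pays for this coupling, the other half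
for replacing v(q) and g at q by their values at p. -/
theorem IsValid.step_gap_le (hS : S.IsValid) {A : E →L[ℝ] F} {r : F} {c : C} {τ η M : ℝ}
    {v : E → ℝ} (hτ : 0 < τ) (hη : 0 < η) (hA : 2 * ‖A‖ ^ 2 ≤ τ * S.α * η)
    (hv : ∀ x ∈ S.X, ∀ x' ∈ S.X, |v x - v x'| ≤ M * ‖x - x'‖) {g : StrongDual ℝ E}
    {p q x : E} {y d e u : F} (hp : p ∈ S.X) (hx : x ∈ S.X) (hy : y ∈ S.dualCone)
    (hq : q = S.primalStep A r c τ g p (d - e + d)) (hu : u = S.dualStep A r η q d) :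
    (S.lagrangian A r c v q y - S.lagrangian A r c v x u) + η / 2 * ‖y - u‖ ^ 2
        + (τ * S.bregman q x - inner ℝ (A (x - q)) (u - d) + η / 2 * ‖u - d‖ ^ 2)
      ≤ η / 2 * ‖y - d‖ ^ 2
        + (τ * S.bregman p x - inner ℝ (A (x - p)) (d - e) + η / 2 * ‖d - e‖ ^ 2)
        + S.noise τ M v g p x := by
  have hβ : 0 < τ * S.α := mul_pos hτ hS.α_pos
  have hqX : q ∈ S.X := hq ▸ hS.primalStep_mem A r c τ g hp _
  have h1 := hS.primalStep_le A r c hτ g hp (d - e + d) hx hq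
  have h2 := dualStep_le A r hη q d hy hu
  have h3 := norm_mul_mul_le hβ hA (q - p) (d - e)
  have h4 := mul_le_quarter_mul_sq_add_sq_div hβ (‖g‖ + M) ‖q - p‖
  have h5 : g (p - q) ≤ ‖g‖ * ‖q - p‖ := by
    rw [norm_sub_rev]
    exact (le_abs_self _).trans (g.le_opNorm _)
  have h6 := (le_abs_self _).trans (hv q hqX p hp)
  have h7 := mul_le_mul_of_nonneg_left (hS.le_bregman hp hqX) hτ.le
  simp only [lagrangian, noise]
  simp only [inner_sub_left, inner_sub_right, inner_add_left, inner_add_right, inner_neg_left,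
    map_sub] at h1 h2 h3 h5 ⊢
  linarith

theorem IsValid.iter_mem (hS : S.IsValid) (A : E →L[ℝ] F) (r : F) (c : C) (s : StepSizes)
    (G : ℕ → E → StrongDual ℝ E) (k : ℕ) : (S.iter A r c s G k).1 ∈ S.X := by
  induction k with
  | zero => exact hS.x₀_mem
  | succ k ih => exact hS.primalStep_mem A r c s.τ _ ih _

theorem iter_dual_mem {A : E →L[ℝ] F} {r : F} {c : C} {s : StepSizes} (hη : 0 < s.η)
    (G : ℕ → E → StrongDual ℝ E) (k : ℕ) : (S.iter A r c s G (k + 1)).2.1 ∈ S.dualCone :=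
  dualStep_mem A r hη _ _

theorem IsValid.sum_gap_le (hS : S.IsValid) {A : E →L[ℝ] F} {r : F} {c : C} {s : StepSizes}
    {M : ℝ} {v : E → ℝ} (hθ : s.θ = 1) (hτ : 0 < s.τ) (hη : 0 < s.η)
    (hA : 2 * ‖A‖ ^ 2 ≤ s.τ * S.α * s.η)
    (hv : ∀ x ∈ S.X, ∀ x' ∈ S.X, |v x - v x'| ≤ M * ‖x - x'‖) (G : ℕ → E → StrongDual ℝ E)
    {x : E} {y : F} (hx : x ∈ S.X) (hy : y ∈ S.dualCone) (n : ℕ) :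
    ∑ k ∈ Finset.range n, (S.lagrangian A r c v (S.iter A r c s G (k + 1)).1 y
          - S.lagrangian A r c v x (S.iter A r c s G (k + 1)).2.1)
        + s.η / 2 * ‖y - (S.iter A r c s G n).2.1‖ ^ 2
      ≤ s.τ * S.Ω ^ 2 + s.η / 2 * ‖y - S.y₀‖ ^ 2
        + ∑ k ∈ Finset.range n, S.noise s.τ M v (G k (S.iter A r c s G k).1)
            (S.iter A r c s G k).1 x := by
  set z := S.iter A r c s G with hz
  have hzX : ∀ k, (z k).1 ∈ S.X := hS.iter_mem A r c s G
  have key : ∀ n, ∑ k ∈ Finset.range n, (S.lagrangian A r c v (z (k + 1)).1 y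
          - S.lagrangian A r c v x (z (k + 1)).2.1) + s.η / 2 * ‖y - (z n).2.1‖ ^ 2
        + (s.τ * S.bregman (z n).1 x - inner ℝ (A (x - (z n).1)) ((z n).2.1 - (z n).2.2)
          + s.η / 2 * ‖(z n).2.1 - (z n).2.2‖ ^ 2)
      ≤ s.τ * S.bregman S.x₀ x + s.η / 2 * ‖y - S.y₀‖ ^ 2
        + ∑ k ∈ Finset.range n, S.noise s.τ M v (G k (z k).1) (z k).1 x := by
    intro n
    induction n with
    | zero => simp [hz, iter, add_comm]
    | succ n ih =>
      have h := hS.step_gap_le (c := c) (r := r) hτ hη hA hv (g := G n (z n).1) (q := (z (n + 1)).1)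
        (d := (z n).2.1) (e := (z n).2.2) (u := (z (n + 1)).2.1) (hzX n) hx hy
        (by simp only [hz, iter, spdt, hθ, one_smul]) (by simp only [hz, iter, spdt])
      have e : (z (n + 1)).2.2 = (z n).2.1 := by simp only [hz, iter, spdt]
      rw [Finset.sum_range_succ, Finset.sum_range_succ, e]
      linarith
  have hβ : 0 < s.τ * S.α := mul_pos hτ hS.α_pos
  -- The potential at the last state is nonnegative, again by the step-size condition. At the start
  -- its coupling vanishes because y₋₁ = y₀.
  have h1 := norm_mul_mul_le hβ hA (x - (z n).1) ((z n).2.1 - (z n).2.2)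
  have h2 := mul_le_mul_of_nonneg_left (hS.le_bregman (hzX n) hx) hτ.le
  have h3 := mul_le_mul_of_nonneg_left (hS.bregman_le hS.x₀_mem hx) hτ.le
  have h4 : 0 ≤ s.τ * S.α * ‖x - (z n).1‖ ^ 2 := by positivity
  have := key n
  linarith

/-! ### Saddle points -/

/-- Complementary slackness: y maximizes a linear function over a cone, and comparing with 0 and 2y
forces its value to be zero. -/
theorem IsSaddle.inner_eq_zero {A : E →L[ℝ] F} {r : F} {c : C} {v : E → ℝ} {x : E} {y : F}
    (h : S.IsSaddle A r c v x y) : inner ℝ (r - A x) y = 0 := by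
  obtain ⟨hx, hy, hs⟩ := h
  have h0 := hs x hx 0 S.zero_mem_dualCone
  have h2 := hs x hx (y + y) (S.dualCone.add_mem hy hy)
  simp only [lagrangian, inner_zero_right, inner_add_right] at h0 h2
  linarith

theorem IsSaddle.mem_K {A : E →L[ℝ] F} {r : F} {c : C} {v : E → ℝ} {x : E} {y : F}
    (h : S.IsSaddle A r c v x y) : A x - r ∈ S.K := by
  refine mem_of_forall_dual fun w hw => ?_
  have h1 := h.2.2 x h.1 (y + w) (S.dualCone.add_mem h.2.1 hw)
  simp only [lagrangian, inner_add_right] at h1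
  have e : inner ℝ (A x - r) w = - inner ℝ (r - A x) w := by
    rw [← inner_neg_left, neg_sub]
  linarith

theorem IsSaddle.lagrangian_eq {A : E →L[ℝ] F} {r : F} {c : C} {v : E → ℝ} {x : E} {y : F}
    (h : S.IsSaddle A r c v x y) : S.lagrangian A r c v x y = S.h x c + v x := by
  rw [lagrangian, h.inner_eq_zero, zero_add]

theorem lagrangian_le_of_mem {A : E →L[ℝ] F} {r : F} (c : C) (v : E → ℝ) {x : E} {y : F}
    (hx : A x - r ∈ S.K) (hy : y ∈ S.dualCone) : S.lagrangian A r c v x y ≤ S.h x c + v x := by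
  have h := S.inner_nonneg_of_mem hx hy
  have e : inner ℝ (A x - r) y = - inner ℝ (r - A x) y := by
    rw [← inner_neg_left, neg_sub]
  rw [lagrangian]
  linarith

theorem IsSaddle.value_eq {A : E →L[ℝ] F} {r : F} {c : C} {v : E → ℝ} {x : E} {y : F}
    (h : S.IsSaddle A r c v x y) : S.value A r c v = S.h x c + v x := by
  refine IsLeast.csInf_eq ⟨⟨x, ⟨h.1, h.mem_K⟩, rfl⟩, ?_⟩
  rintro _ ⟨x', ⟨hx', hf⟩, rfl⟩
  rw [← h.lagrangian_eq]
  exact (h.2.2 x' hx' y h.2.1).trans (lagrangian_le_of_mem c v hf h.2.1)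

theorem IsSaddle.value_le_lagrangian {A : E →L[ℝ] F} {r : F} {c : C} {v : E → ℝ} {x : E} {y : F}
    (h : S.IsSaddle A r c v x y) {x' : E} (hx' : x' ∈ S.X) :
    S.value A r c v ≤ S.lagrangian A r c v x' y := by
  rw [h.value_eq, ← h.lagrangian_eq]
  exact h.2.2 x' hx' y h.2.1

theorem IsSaddle.lagrangian_le_value {A : E →L[ℝ] F} {r : F} {c : C} {v : E → ℝ} {x : E} {y : F}
    (h : S.IsSaddle A r c v x y) {y' : F} (hy' : y' ∈ S.dualCone) :
    S.lagrangian A r c v x y' ≤ S.value A r c v := by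
  rw [h.value_eq]
  exact lagrangian_le_of_mem c v h.mem_K hy'

theorem lagrangian_sub_rhs (A : E →L[ℝ] F) (r r' : F) (c : C) (v : E → ℝ) (x : E) (y : F) :
    S.lagrangian A r' c v x y = S.lagrangian A r c v x y + inner ℝ (r' - r) y := by
  simp only [lagrangian, inner_sub_left]; ring

/-- An optimal dual solution is a subgradient of the value function. -/
theorem IsSaddle.value_add_inner_le {A : E →L[ℝ] F} {r r' : F} {c : C} {v : E → ℝ}
    {x x' : E} {y y' : F} (h : S.IsSaddle A r c v x y) (h' : S.IsSaddle A r' c v x' y') :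
    S.value A r c v + inner ℝ (r' - r) y ≤ S.value A r' c v := by
  have h1 := h.value_le_lagrangian h'.1
  have h2 := h'.lagrangian_le_value h.2.1
  rw [lagrangian_sub_rhs A r r'] at h2
  linarith

theorem IsSaddle.gap_nonneg {A : E →L[ℝ] F} {r : F} {c : C} {v : E → ℝ} {x : E} {y : F}
    (h : S.IsSaddle A r c v x y) {x' : E} (hx' : x' ∈ S.X) {y' : F} (hy' : y' ∈ S.dualCone) :
    0 ≤ S.lagrangian A r c v x' y - S.lagrangian A r c v x y' :=
  sub_nonneg.2 (h.2.2 x' hx' y' hy')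

/-! ### Averages -/

theorem avgPrimal_eq {A : E →L[ℝ] F} {r : F} {c : C} {s : StepSizes} (hw : s.w = 1)
    (G : ℕ → E → StrongDual ℝ E) (N : ℕ) :
    S.avgPrimal A r c s G N
      = (N : ℝ)⁻¹ • ∑ k ∈ Finset.range N, (S.iter A r c s G (k + 1)).1 := by
  simp [avgPrimal, hw]

theorem avgDual_eq {A : E →L[ℝ] F} {r : F} {c : C} {s : StepSizes} (hw : s.w = 1)
    (G : ℕ → E → StrongDual ℝ E) (N : ℕ) :
    S.avgDual A r c s G N
      = (N : ℝ)⁻¹ • ∑ k ∈ Finset.range N, (S.iter A r c s G (k + 1)).2.1 := by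
  simp [avgDual, hw]

theorem IsValid.avgPrimal_mem (hS : S.IsValid) {A : E →L[ℝ] F} {r : F} {c : C} {s : StepSizes}
    (hw : s.w = 1) (G : ℕ → E → StrongDual ℝ E) {N : ℕ} (hN : 1 ≤ N) :
    S.avgPrimal A r c s G N ∈ S.X := by
  rw [avgPrimal_eq hw, Finset.smul_sum]
  refine hS.convex.sum_mem (fun _ _ => by positivity) ?_ fun k _ => hS.iter_mem A r c s G _
  have : (N : ℝ) ≠ 0 := by positivity
  simp [this]

theorem avgDual_mem {A : E →L[ℝ] F} {r : F} {c : C} {s : StepSizes}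
    (hw : s.w = 1) (hη : 0 < s.η) (G : ℕ → E → StrongDual ℝ E) (N : ℕ) :
    S.avgDual A r c s G N ∈ S.dualCone := by
  rw [avgDual_eq hw]
  exact S.dualCone.smul_mem (Submodule.sum_mem _ fun k _ => iter_dual_mem hη G k) (by positivity)

/-- The Lagrangian is convex in x, which allows Jensen's inequality, and affine in y, so the dual
average commutes with it exactly. -/
theorem IsValid.gap_avg_le (hS : S.IsValid) {A : E →L[ℝ] F} {r : F} {c : C} {s : StepSizes}
    (hw : s.w = 1) {v : E → ℝ} (hv : ConvexOn ℝ S.X v) (G : ℕ → E → StrongDual ℝ E) {N : ℕ}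
    (hN : 1 ≤ N) (x : E) (y : F) :
    S.lagrangian A r c v (S.avgPrimal A r c s G N) y
        - S.lagrangian A r c v x (S.avgDual A r c s G N)
      ≤ (N : ℝ)⁻¹ * ∑ k ∈ Finset.range N, (S.lagrangian A r c v (S.iter A r c s G (k + 1)).1 y
          - S.lagrangian A r c v x (S.iter A r c s G (k + 1)).2.1) := by
  have hN0 : (N : ℝ) ≠ 0 := by positivity
  have hA : ConvexOn ℝ S.X fun x => inner ℝ (r - A x) y := by
    refine ⟨hS.convex, fun u _ w _ a b _ _ hab => le_of_eq ?_⟩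
    simp only [inner_sub_left, map_add, map_smul, inner_add_left, inner_smul_left, smul_eq_mul,
      RCLike.conj_to_real]
    rw [← eq_sub_iff_add_eq'] at hab
    subst hab; ring
  have hL : ConvexOn ℝ S.X fun x => S.lagrangian A r c v x y := (hA.add (hS.convexOn_h c)).add hv
  have h1 := hL.map_sum_le (t := Finset.range N) (w := fun _ => (N : ℝ)⁻¹)
    (p := fun k => (S.iter A r c s G (k + 1)).1) (fun _ _ => by positivity) (by simp [hN0])
    (fun k _ => hS.iter_mem A r c s G _)
  rw [← Finset.smul_sum, ← avgPrimal_eq hw] at h1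
  have h2 : S.lagrangian A r c v x (S.avgDual A r c s G N)
      = (N : ℝ)⁻¹ * ∑ k ∈ Finset.range N,
        S.lagrangian A r c v x (S.iter A r c s G (k + 1)).2.1 := by
    simp only [avgDual_eq hw, lagrangian, inner_smul_right, inner_sum, Finset.sum_add_distrib,
      Finset.sum_const, Finset.card_range, nsmul_eq_mul]
    field_simp
  rw [h2, Finset.sum_sub_distrib, mul_sub]
  simp only [smul_eq_mul, ← Finset.mul_sum] at h1
  linarith

/-- The residual of the averaged constraint is controlled by the dual iterates. -/
theorem avgPrimal_residual_mem {A : E →L[ℝ] F} {r : F} {c : C} {s : StepSizes} (hw : s.w = 1)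
    (hη : 0 < s.η) (G : ℕ → E → StrongDual ℝ E) {N : ℕ} (hN : 1 ≤ N) :
    A (S.avgPrimal A r c s G N) - r - (s.η / N) • (S.y₀ - (S.iter A r c s G N).2.1) ∈ S.K := by
  set z := S.iter A r c s G with hz
  have hsum : ∀ n, ∑ k ∈ Finset.range n, (A (z (k + 1)).1 - r + s.η • ((z (k + 1)).2.1 - (z k).2.1))
      = A (∑ k ∈ Finset.range n, (z (k + 1)).1) - (n : ℝ) • r + s.η • ((z n).2.1 - S.y₀) := by
    intro n
    rw [Finset.sum_add_distrib, ← Finset.smul_sum, Finset.sum_range_sub (fun k => (z k).2.1),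
      Finset.sum_sub_distrib, map_sum]
    simp [hz, iter, Nat.cast_smul_eq_nsmul]
  -- Every step puts its own corrected residual into K, and the corrections telescope.
  have hmem : ∑ k ∈ Finset.range N, (A (z (k + 1)).1 - r + s.η • ((z (k + 1)).2.1 - (z k).2.1))
      ∈ S.K := Submodule.sum_mem _ fun k _ => dualStep_add_mem A r hη _ _
  have := S.K.smul_mem hmem (show (0 : ℝ) ≤ (N : ℝ)⁻¹ by positivity)
  have hN0 : (N : ℝ) ≠ 0 := by positivity
  rw [hsum] at this
  convert this using 1
  rw [avgPrimal_eq hw, map_smul, ← hz]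
  match_scalars <;> field_simp

theorem IsValid.gap_avg_le_of_sum (hS : S.IsValid) {A : E →L[ℝ] F} {r : F} {c : C} {s : StepSizes}
    {M : ℝ} {v : E → ℝ} (hw : s.w = 1) (hθ : s.θ = 1) (hτ : 0 < s.τ) (hη : 0 < s.η)
    (hA : 2 * ‖A‖ ^ 2 ≤ s.τ * S.α * s.η) (hc : ConvexOn ℝ S.X v)
    (hv : ∀ x ∈ S.X, ∀ x' ∈ S.X, |v x - v x'| ≤ M * ‖x - x'‖) (G : ℕ → E → StrongDual ℝ E)
    {x : E} {y : F} (hx : x ∈ S.X) (hy : y ∈ S.dualCone) {N : ℕ} (hN : 1 ≤ N) :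
    S.lagrangian A r c v (S.avgPrimal A r c s G N) y
        - S.lagrangian A r c v x (S.avgDual A r c s G N)
      ≤ (N : ℝ)⁻¹ * (s.τ * S.Ω ^ 2 + s.η / 2 * ‖y - S.y₀‖ ^ 2
        + ∑ k ∈ Finset.range N, S.noise s.τ M v (G k (S.iter A r c s G k).1)
            (S.iter A r c s G k).1 x) := by
  refine (hS.gap_avg_le hw hc G hN x y).trans (mul_le_mul_of_nonneg_left ?_ (by positivity))
  have h := hS.sum_gap_le (r := r) (c := c) hθ hτ hη hA hv G hx hy N
  have : 0 ≤ s.η / 2 * ‖y - (S.iter A r c s G N).2.1‖ ^ 2 := by positivity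
  linarith

/-- The averaged dual point is an inexact subgradient of the value function. -/
theorem IsValid.value_add_inner_le (hS : S.IsValid) {A : E →L[ℝ] F} {r r' : F} {c : C}
    {s : StepSizes} {M : ℝ} {v : E → ℝ} (hw : s.w = 1) (hθ : s.θ = 1) (hτ : 0 < s.τ)
    (hη : 0 < s.η) (hA : 2 * ‖A‖ ^ 2 ≤ s.τ * S.α * s.η) (hc : ConvexOn ℝ S.X v)
    (hv : ∀ x ∈ S.X, ∀ x' ∈ S.X, |v x - v x'| ≤ M * ‖x - x'‖) (G : ℕ → E → StrongDual ℝ E)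
    {N : ℕ} (hN : 1 ≤ N) {x x' : E} {y y' : F} (h : S.IsSaddle A r c v x y)
    (h' : S.IsSaddle A r' c v x' y') :
    S.value A r c v + inner ℝ (r' - r) (S.avgDual A r c s G N)
      ≤ S.value A r' c v + (N : ℝ)⁻¹ * (s.τ * S.Ω ^ 2 + s.η / 2 * ‖y - S.y₀‖ ^ 2
        + ∑ k ∈ Finset.range N, S.noise s.τ M v (G k (S.iter A r c s G k).1)
            (S.iter A r c s G k).1 x') := by
  -- The comparison pair mixes the dual solution for r with the primal solution for r'. Neither
  -- depends on the functionals G used in the loop, which is what later permits taking expectations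
  -- of the noise.
  have h1 := hS.gap_avg_le_of_sum (r := r) (c := c) hw hθ hτ hη hA hc hv G h'.1 h.2.1 hN
  have h2 := h.value_le_lagrangian (hS.avgPrimal_mem (A := A) (r := r) (c := c) hw G hN)
  have h3 := h'.lagrangian_le_value (S.avgDual_mem (A := A) (r := r) (c := c) hw hη G N)
  rw [lagrangian_sub_rhs A r r'] at h3
  linarith

/-- The dual iterates stay close to an optimal dual solution. -/
theorem IsValid.norm_dual_sub_sq_le (hS : S.IsValid) {A : E →L[ℝ] F} {r : F} {c : C}
    {s : StepSizes} {M : ℝ} {v : E → ℝ} (hθ : s.θ = 1) (hτ : 0 < s.τ)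
    (hη : 0 < s.η) (hA : 2 * ‖A‖ ^ 2 ≤ s.τ * S.α * s.η)
    (hv : ∀ x ∈ S.X, ∀ x' ∈ S.X, |v x - v x'| ≤ M * ‖x - x'‖) (G : ℕ → E → StrongDual ℝ E)
    (n : ℕ) {x : E} {y : F} (h : S.IsSaddle A r c v x y) :
    s.η / 2 * ‖y - (S.iter A r c s G n).2.1‖ ^ 2
      ≤ s.τ * S.Ω ^ 2 + s.η / 2 * ‖y - S.y₀‖ ^ 2
        + ∑ k ∈ Finset.range n, S.noise s.τ M v (G k (S.iter A r c s G k).1)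
            (S.iter A r c s G k).1 x := by
  have h1 := hS.sum_gap_le (r := r) (c := c) hθ hτ hη hA hv G h.1 h.2.1 n
  have h2 : 0 ≤ ∑ k ∈ Finset.range n, (S.lagrangian A r c v (S.iter A r c s G (k + 1)).1 y
          - S.lagrangian A r c v x (S.iter A r c s G (k + 1)).2.1) :=
    Finset.sum_nonneg fun k _ => h.gap_nonneg (hS.iter_mem A r c s G _) (iter_dual_mem hη G k)
  linarith

end Stage

theorem measurable_clm_apply {Q E F : Type*} [MeasurableSpace Q]
    [NormedAddCommGroup E] [NormedSpace ℝ E] [FiniteDimensional ℝ E]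
    [MeasurableSpace E] [BorelSpace E] [NormedAddCommGroup F] [NormedSpace ℝ F]
    [FiniteDimensional ℝ F] [MeasurableSpace F] [BorelSpace F] {A : Q → E →L[ℝ] F} {p : Q → E}
    (hA : Measurable A) (hp : Measurable p) : Measurable fun q => A q (p q) := by
  have hc : Continuous fun w : (E →L[ℝ] F) × E => w.1 w.2 := by fun_prop
  exact hc.measurable.comp (hA.prodMk hp)

/-- Needed because the lengths of the inner loops depend on the realization and on the preceding
decision. -/
theorem measurable_of_nat_index {Q V : Type*} [MeasurableSpace Q] [MeasurableSpace V]
    {f : ℕ → Q → V} (hf : ∀ n, Measurable (f n)) {N : Q → ℕ} (hN : Measurable N) :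
    Measurable fun q => f (N q) q :=
  (measurable_from_prod_countable_right (f := fun w : ℕ × Q => f w.1 w.2) hf).comp
    (hN.prodMk measurable_id)

namespace Stage

variable {E F C : Type*} [NormedAddCommGroup E] [NormedSpace ℝ E] [FiniteDimensional ℝ E]
    [MeasurableSpace E] [BorelSpace E]
    [NormedAddCommGroup F] [InnerProductSpace ℝ F] [FiniteDimensional ℝ F]
    [MeasurableSpace F] [BorelSpace F] [MeasurableSpace C]
    {S : Stage E F C}

/-! ### Measurability of the iterates -/

theorem measurable_dualStep {Q : Type*} [MeasurableSpace Q] {A : Q → E →L[ℝ] F} {r : Q → F}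
    {η : Q → ℝ} {p : Q → E} {d : Q → F} (hA : Measurable A) (hr : Measurable r)
    (hη : Measurable η) (hp : Measurable p) (hd : Measurable d) :
    Measurable fun q => S.dualStep (A q) (r q) (η q) (p q) (d q) := by
  have e : (fun q => S.dualStep (A q) (r q) (η q) (p q) (d q)) = fun q =>
      if 0 < η q then S.dualProj (d q - (η q)⁻¹ • (-r q + A q (p q))) else d q := by
    funext q
    split_ifs with h
    · exact dualStep_eq_dualProj _ _ h _ _
    · rw [dualStep, if_neg h]
  rw [e]
  refine Measurable.ite (measurableSet_lt measurable_const hη) ?_ hd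
  exact S.lipschitzWith_dualProj.continuous.measurable.comp
    (hd.sub (hη.inv.smul (hr.neg.add (measurable_clm_apply hA hp))))

theorem IsValid.measurable_iter (hS : S.IsValid) {Q : Type*} [MeasurableSpace Q]
    {A : Q → E →L[ℝ] F} {r : Q → F} {c : Q → C} {s : Q → StepSizes}
    {G : Q → ℕ → E → StrongDual ℝ E} (hA : Measurable A) (hr : Measurable r) (hc : Measurable c)
    (hθ : ∀ q, (s q).θ = 1) (hτ : Measurable fun q => (s q).τ) (hη : Measurable fun q => (s q).η)
    (hG : ∀ k, Measurable fun w : Q × E => G w.1 k w.2) (k : ℕ) :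
    Measurable fun q => S.iter (A q) (r q) (c q) (s q) (G q) k := by
  induction k with
  | zero => exact measurable_const
  | succ k ih =>
    have hp : Measurable fun q => S.primalStep (A q) (r q) (c q) (s q).τ
        (G q k (S.iter (A q) (r q) (c q) (s q) (G q) k).1)
        (S.iter (A q) (r q) (c q) (s q) (G q) k).1
        ((S.iter (A q) (r q) (c q) (s q) (G q) k).2.1
          - (S.iter (A q) (r q) (c q) (s q) (G q) k).2.2
          + (S.iter (A q) (r q) (c q) (s q) (G q) k).2.1) :=
      hS.measurable_primalStep.comp (hA.prodMk (hr.prodMk (hc.prodMk (hτ.prodMk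
        (((hG k).comp (measurable_id.prodMk ih.fst)).prodMk (ih.fst.prodMk
          ((ih.snd.fst.sub ih.snd.snd).add ih.snd.fst)))))))
    simp only [iter, spdt, hθ, one_smul]
    exact hp.prodMk ((measurable_dualStep hA hr hη hp ih.snd.fst).prodMk ih.snd.fst)

theorem IsValid.measurable_avgPrimal (hS : S.IsValid) {Q : Type*} [MeasurableSpace Q]
    {A : Q → E →L[ℝ] F} {r : Q → F} {c : Q → C} {s : Q → StepSizes}
    {G : Q → ℕ → E → StrongDual ℝ E} (hA : Measurable A) (hr : Measurable r) (hc : Measurable c)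
    (hw : ∀ q, (s q).w = 1)
    (hθ : ∀ q, (s q).θ = 1) (hτ : Measurable fun q => (s q).τ) (hη : Measurable fun q => (s q).η)
    (hG : ∀ k, Measurable fun w : Q × E => G w.1 k w.2) (N : ℕ) :
    Measurable fun q => S.avgPrimal (A q) (r q) (c q) (s q) (G q) N := by
  simp only [avgPrimal_eq (hw _)]
  exact (Finset.measurable_fun_sum _ fun k _ =>
    (hS.measurable_iter hA hr hc hθ hτ hη hG (k + 1)).fst).const_smul _

theorem IsValid.measurable_avgDual (hS : S.IsValid) {Q : Type*} [MeasurableSpace Q]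
    {A : Q → E →L[ℝ] F} {r : Q → F} {c : Q → C} {s : Q → StepSizes}
    {G : Q → ℕ → E → StrongDual ℝ E} (hA : Measurable A) (hr : Measurable r) (hc : Measurable c)
    (hw : ∀ q, (s q).w = 1)
    (hθ : ∀ q, (s q).θ = 1) (hτ : Measurable fun q => (s q).τ) (hη : Measurable fun q => (s q).η)
    (hG : ∀ k, Measurable fun w : Q × E => G w.1 k w.2) {N : Q → ℕ} (hN : Measurable N) :
    Measurable fun q => S.avgDual (A q) (r q) (c q) (s q) (G q) (N q) := by
  refine measurable_of_nat_index
    (f := fun n q => S.avgDual (A q) (r q) (c q) (s q) (G q) n) (fun n => ?_) hN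
  simp only [avgDual_eq (hw _)]
  exact (Finset.measurable_fun_sum _ fun k _ =>
    (hS.measurable_iter hA hr hc hθ hτ hη hG (k + 1)).snd.fst).const_smul _

theorem iter_congr {A : E →L[ℝ] F} {r : F} {c : C} {s : StepSizes}
    {G G' : ℕ → E → StrongDual ℝ E} {k : ℕ} (h : ∀ j < k, ∀ p, G j p = G' j p) :
    S.iter A r c s G k = S.iter A r c s G' k := by
  induction k with
  | zero => rfl
  | succ k ih =>
    simp only [iter, ih fun j hj => h j (hj.trans k.lt_succ_self), h k k.lt_succ_self]

/-! ### Stochastic functionals -/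

section Stochastic

variable {W Z : Type*} [MeasurableSpace W] [MeasurableSpace Z] {ν : Measure W}
  [IsProbabilityMeasure ν] {ρ : Measure Z} [IsProbabilityMeasure ρ]

/-- The iterate after `k` steps is independent of the sample used in the next step. -/
theorem IsValid.indepFun_iter (hS : S.IsValid) (A : E →L[ℝ] F) (r : F) (c : C) {s : StepSizes}
    (hθ : s.θ = 1) {g : E → Z → StrongDual ℝ E} (hg : Measurable fun w : E × Z => g w.1 w.2)
    {z : ℕ → W → Z} (hz : ∀ k, Measurable (z k)) (hi : iIndepFun z ν) (k : ℕ) :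
    IndepFun (fun ω => S.iter A r c s (fun j p => g p (z j ω)) k) (z k) ν := by
  have hd : Disjoint (Finset.range k) {k} := by simp
  have h := hi.indepFun_finset (Finset.range k) {k} hd hz
  -- Functionals of index k or more are replaced by 0, which does not affect the k-th iterate; this
  -- exhibits it as a function of the first k samples only.
  have hm : Measurable fun q : Finset.range k → Z => S.iter A r c s
      (fun j p => if h : j ∈ Finset.range k then g p (q ⟨j, h⟩) else 0) k := by
    refine hS.measurable_iter measurable_const measurable_const measurable_const
      (fun _ => hθ) measurable_const measurable_const (fun j => ?_) k
    by_cases hj : j ∈ Finset.range k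
    · simp only [hj, dif_pos]
      exact hg.comp (measurable_snd.prodMk ((measurable_pi_apply _).comp measurable_fst))
    · simp only [hj, dif_neg, not_false_eq_true]
      exact measurable_const
  have h2 := h.comp hm (measurable_pi_apply (⟨k, by simp⟩ : ({k} : Finset ℕ)))
  have e : (fun ω => S.iter A r c s (fun j p => g p (z j ω)) k)
      = (fun q : Finset.range k → Z => S.iter A r c s
          (fun j p => if h : j ∈ Finset.range k then g p (q ⟨j, h⟩) else 0) k)
        ∘ fun ω i => z i ω := by
    funext ω
    refine iter_congr fun j hj p => ?_
    simp [hj]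
  rw [e]
  exact h2

theorem integrable_norm_sq_of_lintegral_le {V : Type*} [NormedAddCommGroup V]
    {μ : Measure Z} {f : Z → V} (hf : AEStronglyMeasurable f μ) {M : ℝ}
    (h : ∫⁻ z, ‖f z‖ₑ ^ 2 ∂μ ≤ ENNReal.ofReal (M ^ 2)) :
    Integrable (fun z => ‖f z‖ ^ 2) μ ∧ ∫ z, ‖f z‖ ^ 2 ∂μ ≤ M ^ 2 := by
  have e : ∀ z, ‖f z‖ₑ ^ 2 = ENNReal.ofReal (‖f z‖ ^ 2) := fun z => by
    rw [ENNReal.ofReal_pow (norm_nonneg _), ofReal_norm]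
  simp only [e] at h
  have hi : Integrable (fun z => ‖f z‖ ^ 2) μ := by
    refine ⟨hf.norm.pow 2, ?_⟩
    rw [hasFiniteIntegral_iff_ofReal (Filter.Eventually.of_forall fun z => by positivity)]
    exact h.trans_lt ENNReal.ofReal_lt_top
  refine ⟨hi, ?_⟩
  rw [← ofReal_integral_eq_lintegral_ofReal hi
    (Filter.Eventually.of_forall fun z => by positivity)] at h
  exact (ENNReal.ofReal_le_ofReal_iff (sq_nonneg M)).1 h

theorem integrable_of_lintegral_le {V : Type*} [NormedAddCommGroup V]
    {f : Z → V} (hf : AEStronglyMeasurable f ρ) {M : ℝ}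
    (h : ∫⁻ z, ‖f z‖ₑ ^ 2 ∂ρ ≤ ENNReal.ofReal (M ^ 2)) : Integrable f ρ :=
  ((memLp_two_iff_integrable_sq_norm hf).2
    (integrable_norm_sq_of_lintegral_le hf h).1).integrable (by norm_num)

/-- The value functions are controlled only on X. A Lipschitz extension agrees with v there and
supplies the measurability and boundedness needed for integration. -/
theorem IsValid.exists_continuous_eqOn (hS : S.IsValid) {v : E → ℝ} {M : ℝ} (hM : 0 ≤ M)
    (hv : ∀ x ∈ S.X, ∀ x' ∈ S.X, |v x - v x'| ≤ M * ‖x - x'‖) :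
    ∃ v' : E → ℝ, Continuous v' ∧ EqOn v v' S.X ∧ ∃ B, ∀ x ∈ S.X, |v' x| ≤ B := by
  have hl : LipschitzOnWith M.toNNReal v S.X := LipschitzOnWith.of_dist_le_mul fun x hx y hy => by
    rw [Real.dist_eq, dist_eq_norm, Real.coe_toNNReal M hM]
    exact hv x hx y hy
  obtain ⟨v', h1, h2⟩ := hl.extend_real
  obtain ⟨B, hB⟩ := hS.isCompact.exists_bound_of_continuousOn h1.continuous.continuousOn
  exact ⟨v', h1.continuous, h2, B, hB⟩

/-- The error term has small expectation when the functional is a stochastic `e`-subgradient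
evaluated at a point that is independent of the sample. -/
theorem IsValid.integral_noise_le (hS : S.IsValid) {τ M e : ℝ} (hτ : 0 < τ) (hM : 0 ≤ M)
    {v : E → ℝ} (hv : ∀ x ∈ S.X, ∀ x' ∈ S.X, |v x - v x'| ≤ M * ‖x - x'‖)
    {g : E → Z → StrongDual ℝ E} (hg : Measurable fun w : E × Z => g w.1 w.2)
    (hgM : ∀ p ∈ S.X, ∫⁻ z, ‖g p z‖ₑ ^ 2 ∂ρ ≤ ENNReal.ofReal (M ^ 2)) {x : E} (hx : x ∈ S.X)
    (he : ∀ p ∈ S.X, ∫ z, g p z (x - p) ∂ρ + v p - v x ≤ e)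
    {p : W → E} (hp : Measurable p) (hpX : ∀ ω, p ω ∈ S.X) {z : W → Z} (hz : Measurable z)
    (hlaw : ν.map z = ρ) (hi : IndepFun p z ν) :
    Integrable (fun ω => S.noise τ M v (g (p ω) (z ω)) (p ω) x) ν ∧
      ∫ ω, S.noise τ M v (g (p ω) (z ω)) (p ω) x ∂ν ≤ 4 * M ^ 2 / (τ * S.α) + e := by
  obtain ⟨v', hv'c, hvv', B, hB⟩ := hS.exists_continuous_eqOn hM hv
  obtain ⟨R, hR0, hR⟩ := hS.exists_norm_sub_le
  have hβ : 0 < τ * S.α := mul_pos hτ hS.α_pos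
  set π := ν.map p with hπ
  haveI : IsProbabilityMeasure π := Measure.isProbabilityMeasure_map hp.aemeasurable
  have hjoint : ν.map (fun ω => (p ω, z ω)) = π.prod ρ := by
    rw [(indepFun_iff_map_prod_eq_prod_map_map hp.aemeasurable hz.aemeasurable).1 hi, hlaw]
  have hπX : ∀ᵐ a ∂π, a ∈ S.X :=
    (ae_map_iff hp.aemeasurable hS.isCompact.measurableSet).2 (Filter.Eventually.of_forall hpX)
  have hπX' : ∀ᵐ w ∂π.prod ρ, w.1 ∈ S.X :=
    Measure.quasiMeasurePreserving_fst.ae hπX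
  have hsq : ∫⁻ w, ‖g w.1 w.2‖ₑ ^ 2 ∂π.prod ρ ≤ ENNReal.ofReal (M ^ 2) := by
    rw [lintegral_prod _ (hg.enorm.pow_const 2).aemeasurable]
    calc ∫⁻ a, ∫⁻ b, ‖g a b‖ₑ ^ 2 ∂ρ ∂π ≤ ∫⁻ _, ENNReal.ofReal (M ^ 2) ∂π :=
          lintegral_mono_ae (hπX.mono fun a ha => hgM a ha)
      _ = ENNReal.ofReal (M ^ 2) := by simp
  have hgs : AEStronglyMeasurable (fun w : E × Z => g w.1 w.2) (π.prod ρ) :=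
    hg.aestronglyMeasurable
  obtain ⟨hsqi, hsqle⟩ := integrable_norm_sq_of_lintegral_le hgs hsq
  have hgi := integrable_of_lintegral_le hgs hsq
  have hlin_meas : Measurable fun w : E × Z => g w.1 w.2 (x - w.1) :=
    measurable_clm_apply hg (measurable_const.sub measurable_fst)
  have hlin : Integrable (fun w : E × Z => g w.1 w.2 (x - w.1)) (π.prod ρ) := by
    refine (hgi.norm.mul_const R).mono' hlin_meas.aestronglyMeasurable
      (hπX'.mono fun w hw => ?_)
    exact ((g w.1 w.2).le_opNorm _).trans
      (mul_le_mul_of_nonneg_left (hR x hx _ hw) (norm_nonneg _))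
  have hvi : Integrable (fun w : E × Z => v' w.1) (π.prod ρ) :=
    (integrable_const B).mono' (hv'c.measurable.comp measurable_fst).aestronglyMeasurable
      (hπX'.mono fun w hw => hB _ hw)
  have hJ : Integrable (fun w : E × Z => g w.1 w.2 (x - w.1) + v' w.1 - v x) (π.prod ρ) :=
    (hlin.add hvi).sub (integrable_const _)
  have hJle : ∫ w, (g w.1 w.2 (x - w.1) + v' w.1 - v x) ∂π.prod ρ ≤ e := by
    rw [integral_prod _ hJ]
    calc ∫ a, ∫ b, (g a b (x - a) + v' a - v x) ∂ρ ∂π ≤ ∫ _, e ∂π := by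
          refine integral_mono_ae hJ.integral_prod_left (integrable_const _)
            (hπX.mono fun a ha => ?_)
          have hgm : AEStronglyMeasurable (g a) ρ :=
            (hg.comp (measurable_const.prodMk measurable_id)).aestronglyMeasurable
          have hgai : Integrable (fun b => g a b (x - a)) ρ :=
            (integrable_of_lintegral_le hgm (hgM a ha)).apply_continuousLinearMap _
          change ∫ b, (g a b (x - a) + v' a - v x) ∂ρ ≤ e
          have hgai' : Integrable (fun b => g a b (x - a) + v' a) ρ :=
            hgai.add (integrable_const _)
          rw [integral_sub hgai' (integrable_const _), integral_add hgai (integrable_const _)]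
          simpa [← hvv' ha] using he a ha
      _ = e := by simp
  have hQi : Integrable (fun w : E × Z => (‖g w.1 w.2‖ + M) ^ 2 / (τ * S.α)) (π.prod ρ) := by
    refine Integrable.div_const ?_ _
    have := (hsqi.add (hgi.norm.const_mul (2 * M))).add (integrable_const (M ^ 2))
    refine this.congr (Filter.Eventually.of_forall fun w => ?_)
    simp only [Pi.add_apply]; ring
  have hQle : ∫ w, (‖g w.1 w.2‖ + M) ^ 2 / (τ * S.α) ∂π.prod ρ ≤ 4 * M ^ 2 / (τ * S.α) := by
    have hint : Integrable (fun w : E × Z =>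
        (2 * ‖g w.1 w.2‖ ^ 2 + 2 * M ^ 2) / (τ * S.α)) (π.prod ρ) :=
      ((hsqi.const_mul 2).add (integrable_const (2 * M ^ 2))).div_const (τ * S.α)
    refine (integral_mono hQi hint fun w => ?_).trans ?_
    · change (‖g w.1 w.2‖ + M) ^ 2 / (τ * S.α) ≤ (2 * ‖g w.1 w.2‖ ^ 2 + 2 * M ^ 2) / (τ * S.α)
      gcongr
      nlinarith [sq_nonneg (‖g w.1 w.2‖ - M)]
    · rw [integral_div]
      gcongr
      have : ∫ w, (2 * ‖g w.1 w.2‖ ^ 2 + 2 * M ^ 2) ∂π.prod ρ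
          = 2 * ∫ w, ‖g w.1 w.2‖ ^ 2 ∂π.prod ρ + 2 * M ^ 2 := by
        rw [integral_add (hsqi.const_mul 2) (integrable_const _), integral_const_mul]
        simp
      rw [this]
      linarith
  have hΨi := hQi.add hJ
  have hΨle : ∫ w, ((fun w : E × Z => (‖g w.1 w.2‖ + M) ^ 2 / (τ * S.α))
      + fun w : E × Z => g w.1 w.2 (x - w.1) + v' w.1 - v x) w ∂π.prod ρ
      ≤ 4 * M ^ 2 / (τ * S.α) + e := by
    simp only [Pi.add_apply]
    rw [integral_add hQi hJ]
    exact add_le_add hQle hJle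
  have hpz : Measurable fun ω => (p ω, z ω) := hp.prodMk hz
  have heq : ∀ ω, S.noise τ M v (g (p ω) (z ω)) (p ω) x
      = ((fun w : E × Z => (‖g w.1 w.2‖ + M) ^ 2 / (τ * S.α))
      + fun w : E × Z => g w.1 w.2 (x - w.1) + v' w.1 - v x) (p ω, z ω) := fun ω => by
    simp only [noise, Pi.add_apply, hvv' (hpX ω)]
  rw [← hjoint] at hΨi hΨle
  rw [integral_map hpz.aemeasurable hΨi.aestronglyMeasurable] at hΨle
  have hcomp := hΨi.comp_measurable hpz
  refine ⟨hcomp.congr (Filter.Eventually.of_forall fun ω => (heq ω).symm), ?_⟩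
  simp only [heq]
  exact hΨle

/-- The accumulated error of a loop that draws independent samples. -/
theorem IsValid.integral_sum_noise_le (hS : S.IsValid) {M e : ℝ} (A : E →L[ℝ] F) (r : F) (c : C)
    {s : StepSizes} (hθ : s.θ = 1) (hτ : 0 < s.τ) (hM : 0 ≤ M)
    {v : E → ℝ} (hv : ∀ x ∈ S.X, ∀ x' ∈ S.X, |v x - v x'| ≤ M * ‖x - x'‖)
    {g : E → Z → StrongDual ℝ E} (hg : Measurable fun w : E × Z => g w.1 w.2)
    (hgM : ∀ p ∈ S.X, ∫⁻ z, ‖g p z‖ₑ ^ 2 ∂ρ ≤ ENNReal.ofReal (M ^ 2)) {x : E} (hx : x ∈ S.X)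
    (he : ∀ p ∈ S.X, ∫ z, g p z (x - p) ∂ρ + v p - v x ≤ e)
    {z : ℕ → W → Z} (hz : ∀ k, Measurable (z k)) (hlaw : ∀ k, ν.map (z k) = ρ)
    (hi : iIndepFun z ν) (n : ℕ) :
    Integrable (fun ω => ∑ k ∈ Finset.range n, S.noise s.τ M v
        (g (S.iter A r c s (fun j p => g p (z j ω)) k).1 (z k ω))
        (S.iter A r c s (fun j p => g p (z j ω)) k).1 x) ν ∧
      ∫ ω, ∑ k ∈ Finset.range n, S.noise s.τ M v
        (g (S.iter A r c s (fun j p => g p (z j ω)) k).1 (z k ω))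
        (S.iter A r c s (fun j p => g p (z j ω)) k).1 x ∂ν
      ≤ n * (4 * M ^ 2 / (s.τ * S.α) + e) := by
  have h : ∀ k, Integrable (fun ω => S.noise s.τ M v
        (g (S.iter A r c s (fun j p => g p (z j ω)) k).1 (z k ω))
        (S.iter A r c s (fun j p => g p (z j ω)) k).1 x) ν ∧
      ∫ ω, S.noise s.τ M v (g (S.iter A r c s (fun j p => g p (z j ω)) k).1 (z k ω))
        (S.iter A r c s (fun j p => g p (z j ω)) k).1 x ∂ν
      ≤ 4 * M ^ 2 / (s.τ * S.α) + e := fun k =>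
    hS.integral_noise_le hτ hM hv hg hgM hx he
      (p := fun ω => (S.iter A r c s (fun j p => g p (z j ω)) k).1)
      (hS.measurable_iter measurable_const measurable_const measurable_const
        (fun _ => hθ) measurable_const measurable_const
        (fun j => hg.comp (measurable_snd.prodMk ((hz j).comp measurable_fst))) k).fst
      (fun ω => hS.iter_mem A r c s _ k) (hz k) (hlaw k)
      ((hS.indepFun_iter A r c hθ hg hz hi k).comp measurable_fst measurable_id)
  refine ⟨integrable_finsetSum _ fun k _ => (h k).1, ?_⟩
  rw [integral_finsetSum _ fun k _ => (h k).1]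
  refine (Finset.sum_le_sum fun k _ => (h k).2).trans ?_
  simp [mul_add]

end Stochastic

end Stage

/-! ### Estimates for the step sizes -/

/-- In τΩ² the maximum is bounded by the sum of its entries; in the variance term it is bounded
below by its first entry. The two M-terms have coefficients √3 and 4/√3, whose sum is below 4√3. -/
theorem max_stepSize_budget {α Ω M b : ℝ} {N : ℕ} (hα : 0 < α) (hΩ : 0 < Ω) (hM : 0 ≤ M)
    (hb : 0 < b) (hN : 1 ≤ N) :
    max (M * √(3 * N) / (Ω * √α)) b * Ω ^ 2
        + N * (4 * M ^ 2 / (max (M * √(3 * N) / (Ω * √α)) b * α))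
      ≤ b * Ω ^ 2 + 4 * √3 * M * Ω * √N / √α := by
  set τ := max (M * √(3 * N) / (Ω * √α)) b
  have hτ : 0 < τ := lt_max_of_lt_right hb
  have hq : 0 < √α := Real.sqrt_pos.2 hα
  have hn : 0 < √(N : ℝ) := Real.sqrt_pos.2 (by positivity)
  have ht : 0 < √(3 : ℝ) := by positivity
  have ht2 : √(3 : ℝ) ^ 2 = 3 := Real.sq_sqrt (by norm_num)
  have hq2 : √α ^ 2 = α := Real.sq_sqrt hα.le
  have hn2 : √(N : ℝ) ^ 2 = N := Real.sq_sqrt (by positivity)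
  have h3N : √(3 * (N : ℝ)) = √3 * √N := Real.sqrt_mul (by norm_num) _
  have hle : τ ≤ M * √(3 * N) / (Ω * √α) + b :=
    max_le (le_add_of_nonneg_right hb.le) (le_add_of_nonneg_left (by positivity))
  have hge : M * √(3 * N) / (Ω * √α) ≤ τ := le_max_left _ _
  rw [h3N] at hle hge
  generalize √(3 : ℝ) = t at *
  generalize hqq : √α = q at *
  generalize √(N : ℝ) = n at *
  rw [div_le_iff₀ (by positivity)] at hge
  rw [← hq2, ← hn2]
  have h1 : τ * Ω ^ 2 ≤ M * t * n * Ω / q + b * Ω ^ 2 := by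
    have := mul_le_mul_of_nonneg_right hle (sq_nonneg Ω)
    have e : (M * (t * n) / (Ω * q) + b) * Ω ^ 2 = M * t * n * Ω / q + b * Ω ^ 2 := by
      field_simp
    linarith
  have h2 : n ^ 2 * (4 * M ^ 2 / (τ * q ^ 2)) ≤ 4 * M * n * Ω / (t * q) := by
    rw [mul_div_assoc', div_le_div_iff₀ (by positivity) (by positivity)]
    have := mul_le_mul_of_nonneg_left hge (show 0 ≤ 4 * M * n * q by positivity)
    nlinarith
  have h3 : M * t * n * Ω / q + 4 * M * n * Ω / (t * q) ≤ 4 * t * M * Ω * n / q := by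
    have e : 4 * t * M * Ω * n / q - (M * t * n * Ω / q + 4 * M * n * Ω / (t * q))
        = (3 * t ^ 2 - 4) * (M * n * Ω / (t * q)) := by
      field_simp; ring
    have : 0 ≤ (3 * t ^ 2 - 4) * (M * n * Ω / (t * q)) := by
      rw [ht2]; positivity
    linarith
  linarith

namespace Stage

variable {E F C : Type*} [NormedAddCommGroup E] [NormedSpace ℝ E]
    [NormedAddCommGroup F] [InnerProductSpace ℝ F] [FiniteDimensional ℝ F]
    {S : Stage E F C} {N : ℕ} {M a : ℝ}

theorem aggressive_η_pos (hα : 0 < S.α) (ha : 0 < a) : 0 < (S.aggressive N M a).η := by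
  simp only [aggressive]; positivity

theorem aggressive_τ_pos (hα : 0 < S.α) (ha : 0 < a) : 0 < (S.aggressive N M a).τ :=
  lt_max_of_lt_right (aggressive_η_pos (N := N) (M := M) hα ha)

/-- Equality holds when τ equals its second entry, which is η; enlarging τ only helps. -/
theorem aggressive_le (hα : 0 < S.α) (ha : 0 < a) :
    2 * a ^ 2 ≤ (S.aggressive N M a).τ * S.α * (S.aggressive N M a).η := by
  have h : (S.aggressive N M a).η ≤ (S.aggressive N M a).τ := le_max_right _ _
  have hη := aggressive_η_pos (N := N) (M := M) hα ha
  have e : (S.aggressive N M a).η * S.α * (S.aggressive N M a).η = 2 * a ^ 2 := by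
    simp only [aggressive]
    have h2 : √(2 : ℝ) ^ 2 = 2 := Real.sq_sqrt (by norm_num)
    have hq2 : √S.α ^ 2 = S.α := Real.sq_sqrt hα.le
    have hq : 0 < √S.α := Real.sqrt_pos.2 hα
    field_simp
    rw [h2, hq2, mul_comm]
  rw [← e]
  gcongr

theorem conservative_η_pos (hα : 0 < S.α) (ha : 0 < a) (hN : 1 ≤ N) :
    0 < (S.conservative N M a).η := by
  simp only [conservative]; positivity

theorem conservative_τ_pos (hα : 0 < S.α) (ha : 0 < a) (hN : 1 ≤ N) :
    0 < (S.conservative N M a).τ :=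
  lt_max_of_lt_right (by positivity)

theorem conservative_le (hα : 0 < S.α) (ha : 0 < a) (hN : 1 ≤ N) :
    2 * a ^ 2 ≤ (S.conservative N M a).τ * S.α * (S.conservative N M a).η := by
  have h : √2 * a / √(S.α * N) ≤ (S.conservative N M a).τ := le_max_right _ _
  have hη := conservative_η_pos (N := N) (M := M) hα ha hN
  have e : √2 * a / √(S.α * N) * S.α * (S.conservative N M a).η = 2 * a ^ 2 := by
    simp only [conservative]
    have h2 : √(2 : ℝ) ^ 2 = 2 := Real.sq_sqrt (by norm_num)
    have hq2 : √S.α ^ 2 = S.α := Real.sq_sqrt hα.le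
    have hq : 0 < √S.α := Real.sqrt_pos.2 hα
    have hn : 0 < √(N : ℝ) := Real.sqrt_pos.2 (by positivity)
    rw [Real.sqrt_mul hα.le, Real.sqrt_mul (by norm_num : (0 : ℝ) ≤ 2)]
    field_simp
    rw [h2, hq2, mul_comm]
  rw [← e]
  gcongr

/-- The first summand of N₂ gives N^{3/2} ≥ 12√2 a Ω²/(√α ε), making the deterministic part of τΩ²
at most Nε/12. The second gives a lower bound on √N, making the variance and dual-distance terms at
most Nε/6. With the inherited bias Nε/6 the total is 5Nε/12. -/
theorem conservative_gap_le {ε D : ℝ} (hα : 0 < S.α) (hΩ : 0 < S.Ω) (ha : 0 < a) (hM : 0 ≤ M)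
    (hε : 0 < ε) (hN : 1 ≤ N)
    (h : (12 * √2 * a * S.Ω ^ 2 / (√S.α * ε)) ^ (2 / 3 : ℝ)
      + (6 * (a * D ^ 2 + 4 * √3 * M * S.Ω) / (√S.α * ε)) ^ 2 ≤ N) :
    (N : ℝ)⁻¹ * ((S.conservative N M a).τ * S.Ω ^ 2 + (S.conservative N M a).η / 2 * D ^ 2
      + N * (4 * M ^ 2 / ((S.conservative N M a).τ * S.α) + ε / 6)) ≤ ε / 2 := by
  have hq : 0 < √S.α := Real.sqrt_pos.2 hα
  have hN0 : (0 : ℝ) < N := by positivity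
  have hn : 0 < √(N : ℝ) := Real.sqrt_pos.2 hN0
  have hn2 : √(N : ℝ) ^ 2 = N := Real.sq_sqrt hN0.le
  have h2 : √(2 : ℝ) ≤ 2 := by rw [Real.sqrt_le_left (by norm_num)]; norm_num
  have hbud := max_stepSize_budget hα hΩ hM (b := √2 * a / √(S.α * N)) (by positivity) hN
  have hcub : 12 * √2 * a * S.Ω ^ 2 / (√S.α * ε) ≤ √(N : ℝ) ^ 3 := by
    set T := 12 * √2 * a * S.Ω ^ 2 / (√S.α * ε) with hT
    have hT0 : 0 ≤ T := by positivity
    have e1 : T ^ (2 / 3 : ℝ) = (T ^ (1 / 3 : ℝ)) ^ 2 := by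
      rw [← Real.rpow_natCast, ← Real.rpow_mul hT0]; norm_num
    have e2 : (T ^ (1 / 3 : ℝ)) ^ 3 = T := by
      rw [← Real.rpow_natCast, ← Real.rpow_mul hT0]; norm_num
    rw [← e2]
    refine pow_le_pow_left₀ (by positivity) (Real.le_sqrt_of_sq_le ?_) 3
    rw [← e1]
    linarith [sq_nonneg (6 * (a * D ^ 2 + 4 * √3 * M * S.Ω) / (√S.α * ε))]
  have hlin : 6 * (a * D ^ 2 + 4 * √3 * M * S.Ω) / (√S.α * ε) ≤ √(N : ℝ) := by
    refine Real.le_sqrt_of_sq_le ?_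
    have : 0 ≤ (12 * √2 * a * S.Ω ^ 2 / (√S.α * ε)) ^ (2 / 3 : ℝ) := by positivity
    linarith
  have hη : (S.conservative N M a).η = √2 * √N * a / √S.α := by
    simp only [conservative]
    rw [Real.sqrt_mul (by norm_num : (0 : ℝ) ≤ 2)]
  have hs : √(S.α * N) = √S.α * √N := Real.sqrt_mul hα.le _
  rw [div_le_iff₀ (by positivity)] at hcub hlin
  rw [inv_mul_le_iff₀ hN0, hη]
  change max _ (√2 * a / √(S.α * N)) * S.Ω ^ 2 + _
    + _ * (_ / (max _ (√2 * a / √(S.α * N)) * _) + _) ≤ _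
  rw [hs] at hbud ⊢
  set τ := max (M * √(3 * N) / (S.Ω * √S.α)) (√2 * a / (√S.α * √N))
  have k1 : √2 * a / (√S.α * √N) * S.Ω ^ 2 ≤ √N ^ 2 * (ε / 12) := by
    rw [div_mul_eq_mul_div, div_le_iff₀ (by positivity)]
    linarith
  have k2 : 4 * √3 * M * S.Ω * √N / √S.α + √2 * √N * a / √S.α / 2 * D ^ 2 ≤ √N ^ 2 * (ε / 6) := by
    have e : 4 * √3 * M * S.Ω * √N / √S.α + √2 * √N * a / √S.α / 2 * D ^ 2
        = √N * (4 * √3 * M * S.Ω + √2 / 2 * (a * D ^ 2)) / √S.α := by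
      field_simp
    rw [e, div_le_iff₀ hq]
    have h3 : √2 / 2 * (a * D ^ 2) ≤ a * D ^ 2 := by
      have : 0 ≤ a * D ^ 2 := by positivity
      nlinarith
    have h4 := mul_le_mul_of_nonneg_left hlin hn.le
    have h5 := mul_le_mul_of_nonneg_left h3 hn.le
    nlinarith
  rw [hn2] at k1 k2
  rw [mul_add]
  have : 0 < N * ε := mul_pos hN0 hε
  linarith

theorem aggressive_zero_gap_le {ε D : ℝ} (hα : 0 < S.α) (ha : 0 < a) (hε : 0 < ε) (hN : 1 ≤ N)
    (h : 3 * √2 * a * (2 * S.Ω ^ 2 + D ^ 2) / (√S.α * ε) ≤ N) :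
    (N : ℝ)⁻¹ * ((S.aggressive N 0 a).τ * S.Ω ^ 2 + (S.aggressive N 0 a).η / 2 * D ^ 2)
      ≤ ε / 6 := by
  have hq : 0 < √S.α := Real.sqrt_pos.2 hα
  have hN0 : (0 : ℝ) < N := by positivity
  have hτ : (S.aggressive N 0 a).τ = √2 * a / √S.α := by
    simp only [aggressive, zero_mul, zero_div]
    exact max_eq_right (by positivity)
  rw [inv_mul_le_iff₀ hN0, hτ]
  simp only [aggressive]
  rw [div_le_iff₀ (by positivity)] at h
  have e : √2 * a / √S.α * S.Ω ^ 2 + √2 * a / √S.α / 2 * D ^ 2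
      = √2 * a * (2 * S.Ω ^ 2 + D ^ 2) / 2 / √S.α := by
    field_simp
  rw [e, div_le_iff₀ hq]
  linarith

end Stage

/-! ### Expected value functions -/

/-- The subgradient inequalities at the convex combination, towards the two endpoints, add up to the
convexity inequality under the integral. The exceptional null sets may depend on the pair of points,
and d need not be measurable, because the functionals cancel before integration. -/
theorem convexOn_integral_of_subgradient {E Z : Type*} [NormedAddCommGroup E] [NormedSpace ℝ E]
    [MeasurableSpace Z] {μ : Measure Z} {X : Set E} (hX : Convex ℝ X) {V : E → Z → ℝ}
    (hV : ∀ u ∈ X, Integrable (V u) μ) {d : E → Z → StrongDual ℝ E}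
    (hd : ∀ u ∈ X, ∀ u' ∈ X, ∀ᵐ z ∂μ, V u z + d u z (u' - u) ≤ V u' z) :
    ConvexOn ℝ X fun u => ∫ z, V u z ∂μ := by
  refine ⟨hX, fun u₁ h₁ u₂ h₂ a b ha hb hab => ?_⟩
  have hu := hX h₁ h₂ ha hb hab
  rw [smul_eq_mul, smul_eq_mul, ← integral_const_mul, ← integral_const_mul,
    ← integral_add ((hV _ h₁).const_mul a) ((hV _ h₂).const_mul b)]
  refine integral_mono_ae (hV _ hu) (((hV _ h₁).const_mul a).add ((hV _ h₂).const_mul b)) ?_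
  filter_upwards [hd _ hu _ h₁, hd _ hu _ h₂] with z hz₁ hz₂
  set u := a • u₁ + b • u₂ with hu'
  have e : a * d u z (u₁ - u) + b * d u z (u₂ - u) = 0 := by
    rw [← smul_eq_mul, ← smul_eq_mul, ← map_smul, ← map_smul, ← map_add, smul_sub, smul_sub]
    have : a • u₁ - a • u + (b • u₂ - b • u) = 0 := by
      have : (a + b) • u = u := by rw [hab, one_smul]
      rw [add_smul] at this
      rw [sub_add_sub_comm, this, sub_self]
    rw [this, map_zero]
  change V u z ≤ a * V u₁ z + b * V u₂ z
  have h3 := mul_le_mul_of_nonneg_left hz₁ ha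
  have h4 := mul_le_mul_of_nonneg_left hz₂ hb
  have h5 : a * V u z + b * V u z = V u z := by rw [← add_mul, hab, one_mul]
  linarith

theorem abs_integral_sub_le_of_subgradient {E Z : Type*} [NormedAddCommGroup E] [NormedSpace ℝ E]
    [MeasurableSpace Z] {μ : Measure Z} [IsProbabilityMeasure μ] {X : Set E} {V : E → Z → ℝ}
    (hV : ∀ u ∈ X, Integrable (V u) μ) {d : E → Z → StrongDual ℝ E} {M : ℝ}
    (hd : ∀ u ∈ X, ∀ u' ∈ X, ∀ᵐ z ∂μ, V u z + d u z (u' - u) ≤ V u' z)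
    (hM : ∀ u ∈ X, ∀ᵐ z ∂μ, ‖d u z‖ ≤ M) {u u' : E} (hu : u ∈ X) (hu' : u' ∈ X) :
    |∫ z, V u z ∂μ - ∫ z, V u' z ∂μ| ≤ M * ‖u - u'‖ := by
  have key : ∀ u ∈ X, ∀ u' ∈ X, ∫ z, V u z ∂μ - ∫ z, V u' z ∂μ ≤ M * ‖u - u'‖ := by
    intro u hu u' hu'
    rw [← integral_sub (hV u hu) (hV u' hu')]
    calc ∫ z, (V u z - V u' z) ∂μ ≤ ∫ _, M * ‖u - u'‖ ∂μ := by
          refine integral_mono_ae ((hV u hu).sub (hV u' hu')) (integrable_const _) ?_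
          filter_upwards [hd u hu u' hu', hM u hu] with z h1 h2
          change V u z - V u' z ≤ M * ‖u - u'‖
          have h3 : -(d u z (u' - u)) ≤ ‖d u z‖ * ‖u' - u‖ :=
            (neg_le_abs _).trans ((d u z).le_opNorm _)
          rw [norm_sub_rev u u']
          have := mul_le_mul_of_nonneg_right h2 (norm_nonneg (u' - u))
          linarith
      _ = M * ‖u - u'‖ := by simp
  rw [abs_le]
  have h1 := key u hu u' hu'
  have h2 := key u' hu' u hu
  rw [norm_sub_rev] at h2
  constructor <;> linarith

/-- Chain rule: a subgradient y in the right-hand side becomes Bᵀy in the preceding decision. -/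
theorem Scenario.rhs_sub {E' E F C : Type*}
    [NormedAddCommGroup E'] [NormedSpace ℝ E'] [NormedAddCommGroup E] [NormedSpace ℝ E]
    [NormedAddCommGroup F] [InnerProductSpace ℝ F] (ξ : Scenario E' E F C) (u u' : E') (y : F) :
    inner ℝ (ξ.rhs u' - ξ.rhs u) y = (innerSL ℝ y).comp ξ.B (u' - u) := by
  simp only [rhs, add_sub_add_left_eq_sub, ContinuousLinearMap.comp_apply, innerSL_apply_apply,
    ← map_sub]
  exact real_inner_comm _ _

/-! ### Measurability of the data and of the sampling kernel -/

section ScenarioMeasurable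

variable {E' E F C : Type*} [NormedAddCommGroup E'] [NormedSpace ℝ E'] [FiniteDimensional ℝ E']
    [MeasurableSpace E'] [BorelSpace E'] [NormedAddCommGroup E] [NormedSpace ℝ E]
    [FiniteDimensional ℝ E] [MeasurableSpace E] [BorelSpace E]
    [NormedAddCommGroup F] [InnerProductSpace ℝ F] [FiniteDimensional ℝ F]
    [MeasurableSpace F] [BorelSpace F] [MeasurableSpace C]

theorem Scenario.measurable_A : Measurable (Scenario.A : Scenario E' E F C → _) := measurable_fst

theorem Scenario.measurable_B : Measurable (Scenario.B : Scenario E' E F C → _) :=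
  measurable_snd.snd.fst

theorem Scenario.measurable_c : Measurable (Scenario.c : Scenario E' E F C → _) :=
  measurable_snd.snd.snd

theorem Scenario.measurable_rhs :
    Measurable fun q : E' × Scenario E' E F C => q.2.rhs q.1 :=
  measurable_snd.snd.fst.add
    (measurable_clm_apply (Scenario.measurable_B.comp measurable_snd) measurable_fst)

theorem measurable_innerSL_comp {Q : Type*} [MeasurableSpace Q] {y : Q → F} {B : Q → E' →L[ℝ] F}
    (hy : Measurable y) (hB : Measurable B) :
    Measurable fun q => (innerSL ℝ (y q)).comp (B q) := by
  have hc : Continuous fun w : F × (E' →L[ℝ] F) => (innerSL ℝ w.1).comp w.2 := by fun_prop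
  exact hc.measurable.comp (hy.prodMk hB)

end ScenarioMeasurable

/-- It suffices to test on the π-system of cylinders with finitely many constrained coordinates,
where the product measure is a finite product of kernel values. -/
theorem measurable_infinitePi_kernel {X Z : Type*} [MeasurableSpace X] [MeasurableSpace Z]
    (κ : Kernel X Z) [IsMarkovKernel κ] :
    Measurable fun x => Measure.infinitePi fun _ : ℕ => κ x := by
  refine Measurable.measure_of_isPiSystem_of_isProbabilityMeasure
    generateFrom_squareCylinders.symm
    (isPiSystem_squareCylinders (fun _ => MeasurableSpace.isPiSystem_measurableSet)
      fun _ => MeasurableSet.univ) ?_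
  rintro _ ⟨s, t, ht, rfl⟩
  have ht' : ∀ i, MeasurableSet (t i) := fun i => ht i (mem_univ i)
  simp only [Measure.infinitePi_pi _ fun i _ => ht' i]
  exact Finset.measurable_fun_prod _ fun i _ => Kernel.measurable_coe κ (ht' i)

theorem integral_add_sub_integral_le {Z : Type*} [MeasurableSpace Z] {μ : Measure Z}
    [IsProbabilityMeasure μ] {f g h : Z → ℝ} (hf : Integrable f μ) (hg : Integrable g μ)
    (hh : Integrable h μ) {e : ℝ} (hle : ∀ᵐ z ∂μ, f z + g z - h z ≤ e) :
    ∫ z, f z ∂μ + ∫ z, g z ∂μ - ∫ z, h z ∂μ ≤ e := by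
  have hfg : Integrable (fun z => f z + g z) μ := hf.add hg
  rw [← integral_add hf hg, ← integral_sub hfg hh]
  exact (integral_mono_ae (hfg.sub hh) (integrable_const e) hle).trans_eq (by simp)

theorem Stage.IsValid.measurable_avgDual_conservative {E F C : Type*} [NormedAddCommGroup E]
    [NormedSpace ℝ E] [FiniteDimensional ℝ E] [MeasurableSpace E] [BorelSpace E]
    [NormedAddCommGroup F] [InnerProductSpace ℝ F] [FiniteDimensional ℝ F]
    [MeasurableSpace F] [BorelSpace F] [MeasurableSpace C]
    {S : Stage E F C} (hS : S.IsValid) {Q : Type*} [MeasurableSpace Q]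
    {A : Q → E →L[ℝ] F} {r : Q → F} {c : Q → C} {M : ℝ}
    {G : Q → ℕ → E → StrongDual ℝ E} (hA : Measurable A) (hr : Measurable r) (hc : Measurable c)
    (hG : ∀ k, Measurable fun w : Q × E => G w.1 k w.2) {N : Q → ℕ} (hN : Measurable N) :
    Measurable fun q => S.avgDual (A q) (r q) (c q) (S.conservative (N q) M ‖A q‖) (G q) (N q) := by
  have hNr : Measurable fun q => (N q : ℝ) :=
    (measurable_from_nat (f := fun n : ℕ => (n : ℝ))).comp hN
  refine hS.measurable_avgDual hA hr hc (fun _ => rfl) (fun _ => rfl) ?_ ?_ hG hN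
  · simp only [Stage.conservative]
    exact (((hNr.const_mul 3).sqrt.const_mul M).div_const _).max
      ((hA.norm.const_mul _).div (hNr.const_mul _).sqrt)
  · simp only [Stage.conservative]
    exact ((hNr.const_mul 2).sqrt.mul hA.norm).div_const _

namespace Problem

variable {E₁ F₁ C₁ E₂ F₂ C₂ E₃ F₃ C₃ : Type*}
    [NormedAddCommGroup E₁] [NormedSpace ℝ E₁] [FiniteDimensional ℝ E₁]
    [MeasurableSpace E₁] [BorelSpace E₁]
    [NormedAddCommGroup F₁] [InnerProductSpace ℝ F₁] [FiniteDimensional ℝ F₁]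
    [MeasurableSpace F₁] [BorelSpace F₁] [MeasurableSpace C₁]
    [NormedAddCommGroup E₂] [NormedSpace ℝ E₂] [FiniteDimensional ℝ E₂]
    [MeasurableSpace E₂] [BorelSpace E₂]
    [NormedAddCommGroup F₂] [InnerProductSpace ℝ F₂] [FiniteDimensional ℝ F₂]
    [MeasurableSpace F₂] [BorelSpace F₂] [MeasurableSpace C₂]
    [NormedAddCommGroup E₃] [NormedSpace ℝ E₃] [FiniteDimensional ℝ E₃]
    [MeasurableSpace E₃] [BorelSpace E₃]
    [NormedAddCommGroup F₃] [InnerProductSpace ℝ F₃] [FiniteDimensional ℝ F₃]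
    [MeasurableSpace F₃] [BorelSpace F₃] [MeasurableSpace C₃]
    {P : Problem E₁ F₁ C₁ E₂ F₂ C₂ E₃ F₃ C₃}
    {y₂ : E₁ → Scenario E₁ E₂ F₂ C₂ → F₂} {y₃ : E₂ → Scenario E₂ E₃ F₃ C₃ → F₃}

/-! ### The third stage -/

theorem one_le_N₃ (y₃ : E₂ → Scenario E₂ E₃ F₃ C₃ → F₃) (ε : ℝ) (x : E₂)
    (ξ : Scenario E₂ E₃ F₃ C₃) : 1 ≤ P.N₃ y₃ ε x ξ := le_max_left _ _

theorem one_le_N₂ (y₂ : E₁ → Scenario E₁ E₂ F₂ C₂ → F₂) (ε M₃ : ℝ) (x : E₁)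
    (ξ : Scenario E₁ E₂ F₂ C₂) : 1 ≤ P.N₂ y₂ ε M₃ x ξ := le_max_left _ _

namespace Assumptions

theorem measurable_N₃ (hP : P.Assumptions y₂ y₃) (ε : ℝ) :
    Measurable fun q : E₂ × Scenario E₂ E₃ F₃ C₃ => P.N₃ y₃ ε q.1 q.2 := by
  unfold N₃
  refine measurable_const.max (Nat.measurable_ceil.comp (Measurable.div_const ?_ _))
  exact ((Scenario.measurable_A.comp measurable_snd).norm.const_mul _).mul
    (((hP.measurable_y₃.sub_const _).norm.pow_const 2).const_add _)

theorem measurable_G₃ (hP : P.Assumptions y₂ y₃) (ε : ℝ) :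
    Measurable fun q : E₂ × Scenario E₂ E₃ F₃ C₃ => P.G₃ y₃ ε q.1 q.2 := by
  have hA : Measurable fun q : E₂ × Scenario E₂ E₃ F₃ C₃ => q.2.A :=
    Scenario.measurable_A.comp measurable_snd
  have hη : Measurable fun q : E₂ × Scenario E₂ E₃ F₃ C₃ => √2 * ‖q.2.A‖ / √P.S₃.α :=
    (hA.norm.const_mul _).div_const _
  refine measurable_innerSL_comp ?_ (Scenario.measurable_B.comp measurable_snd)
  refine hP.valid₃.measurable_avgDual hA Scenario.measurable_rhs
    (Scenario.measurable_c.comp measurable_snd) (fun _ => rfl) (fun _ => rfl) ?_ hη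
    (fun _ => measurable_const) (hP.measurable_N₃ ε)
  simp only [Stage.aggressive, zero_mul, zero_div]
  exact measurable_const.max hη

/-- With v = 0, M = 0 and zero functionals the noise vanishes identically, so the inexact
subgradient inequality holds for each realization and not only in mean. -/
theorem V₃_add_G₃_le (hP : P.Assumptions y₂ y₃) {ε : ℝ} (hε : 0 < ε)
    {ξ : Scenario E₂ E₃ F₃ C₃} (hA : ξ.A ≠ 0) {p x : E₂} {a b : E₃}
    (h : P.S₃.IsSaddle ξ.A (ξ.rhs p) ξ.c 0 a (y₃ p ξ))
    (h' : P.S₃.IsSaddle ξ.A (ξ.rhs x) ξ.c 0 b (y₃ x ξ)) :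
    P.V₃ p ξ + P.G₃ y₃ ε p ξ (x - p) ≤ P.V₃ x ξ + ε / 6 := by
  have hα := hP.valid₃.α_pos
  have ha : 0 < ‖ξ.A‖ := norm_pos_iff.2 hA
  have hN := P.one_le_N₃ y₃ ε p ξ
  have h1 := hP.valid₃.value_add_inner_le (s := P.S₃.aggressive (P.N₃ y₃ ε p ξ) 0 ‖ξ.A‖)
    (v := 0) (M := 0) rfl rfl (Stage.aggressive_τ_pos hα ha) (Stage.aggressive_η_pos hα ha)
    (Stage.aggressive_le hα ha) (convexOn_const 0 hP.valid₃.convex) (by simp) (fun _ _ => 0)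
    hN h h'
  have h2 := Stage.aggressive_zero_gap_le (S := P.S₃) (D := ‖y₃ p ξ - P.S₃.y₀‖) hα ha hε hN
    ((Nat.le_ceil _).trans (by exact_mod_cast le_max_right _ _))
  rw [Scenario.rhs_sub] at h1
  simp only [Stage.noise, norm_zero, add_zero, ne_eq, OfNat.ofNat_ne_zero,
    not_false_eq_true, zero_pow, zero_div, _root_.zero_apply, Pi.zero_apply, sub_self,
    Finset.sum_const_zero] at h1
  exact h1.trans (add_le_add_right h2 _)

theorem V₃_subgradient (hP : P.Assumptions y₂ y₃) : ∀ᵐ ξ₂ ∂P.μ, ∀ u ∈ P.S₂.X, ∀ u' ∈ P.S₂.X,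
    ∀ᵐ ξ ∂P.κ ξ₂, P.V₃ u ξ + (innerSL ℝ (y₃ u ξ)).comp ξ.B (u' - u) ≤ P.V₃ u' ξ := by
  filter_upwards [hP.saddle₃] with ξ₂ hs u hu u' hu'
  filter_upwards [hs u hu, hs u' hu'] with ξ ⟨a, ha⟩ ⟨b, hb⟩
  rw [← Scenario.rhs_sub]
  exact ha.value_add_inner_le hb

theorem convexOn_v₃ (hP : P.Assumptions y₂ y₃) :
    ∀ᵐ ξ₂ ∂P.μ, ConvexOn ℝ P.S₂.X (P.v₃ ξ₂) := by
  filter_upwards [hP.V₃_subgradient, hP.integrable_V₃] with ξ₂ hs hi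
  exact convexOn_integral_of_subgradient hP.valid₂.convex hi hs

theorem v₃_subgradient (hP : P.Assumptions y₂ y₃) {ε M₃ : ℝ} (hε : 0 < ε)
    (hb : P.IsBound₃ y₃ ε M₃) : ∀ᵐ ξ₂ ∂P.μ, ∀ p ∈ P.S₂.X, ∀ x ∈ P.S₂.X,
      ∫ ξ, P.G₃ y₃ ε p ξ (x - p) ∂P.κ ξ₂ + P.v₃ ξ₂ p - P.v₃ ξ₂ x ≤ ε / 6 := by
  haveI := hP.isMarkov_κ
  filter_upwards [hP.A₃_ne, hP.saddle₃, hP.integrable_V₃, hb.2] with ξ₂ hA hs hi hb p hp x hx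
  have hG : Integrable (fun ξ => P.G₃ y₃ ε p ξ (x - p)) (P.κ ξ₂) :=
    (Stage.integrable_of_lintegral_le ((hP.measurable_G₃ ε).comp
      (measurable_const.prodMk measurable_id)).aestronglyMeasurable
      (hb.2 p hp)).apply_continuousLinearMap _
  refine integral_add_sub_integral_le hG (hi p hp) (hi x hx) ?_
  filter_upwards [hA, hs p hp, hs x hx] with ξ hA ⟨a, ha⟩ ⟨b, hb⟩
  have := hP.V₃_add_G₃_le hε hA ha hb
  linarith

end Assumptions

/-! ### The second stage -/

/-- The properties of a realization `ξ²` on which the analysis of the middle loop relies. -/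
structure Regular (P : Problem E₁ F₁ C₁ E₂ F₂ C₂ E₃ F₃ C₃)
    (y₃ : E₂ → Scenario E₂ E₃ F₃ C₃ → F₃) (ε M₃ : ℝ) (ξ₂ : Scenario E₁ E₂ F₂ C₂) : Prop where
  A_ne : ξ₂.A ≠ 0
  convexOn : ConvexOn ℝ P.S₂.X (P.v₃ ξ₂)
  lipschitz : ∀ x ∈ P.S₂.X, ∀ x' ∈ P.S₂.X, |P.v₃ ξ₂ x - P.v₃ ξ₂ x'| ≤ M₃ * ‖x - x'‖
  moment : ∀ x ∈ P.S₂.X, ∫⁻ ξ₃, ‖P.G₃ y₃ ε x ξ₃‖ₑ ^ 2 ∂(P.κ ξ₂) ≤ ENNReal.ofReal (M₃ ^ 2)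
  subgradient : ∀ p ∈ P.S₂.X, ∀ x ∈ P.S₂.X,
    ∫ ξ, P.G₃ y₃ ε p ξ (x - p) ∂P.κ ξ₂ + P.v₃ ξ₂ p - P.v₃ ξ₂ x ≤ ε / 6

theorem Assumptions.ae_regular (hP : P.Assumptions y₂ y₃) {ε M₃ : ℝ} (hε : 0 < ε)
    (hb : P.IsBound₃ y₃ ε M₃) : ∀ᵐ ξ₂ ∂P.μ, P.Regular y₃ ε M₃ ξ₂ := by
  filter_upwards [hP.A₂_ne, hP.convexOn_v₃, hb.2, hP.v₃_subgradient hε hb] with ξ₂ h1 h2 h3 h4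
  exact ⟨h1, h2, h3.1, h3.2, h4⟩

/-- The parameters of the middle loop. -/
noncomputable def middleSteps (P : Problem E₁ F₁ C₁ E₂ F₂ C₂ E₃ F₃ C₃)
    (y₂ : E₁ → Scenario E₁ E₂ F₂ C₂ → F₂) (ε M₃ : ℝ) (u : E₁) (ξ₂ : Scenario E₁ E₂ F₂ C₂) :
    StepSizes :=
  P.S₂.conservative (P.N₂ y₂ ε M₃ u ξ₂) M₃ ‖ξ₂.A‖

/-- The state of the middle loop after `k` steps. -/
noncomputable def middleIter (P : Problem E₁ F₁ C₁ E₂ F₂ C₂ E₃ F₃ C₃)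
    (y₂ : E₁ → Scenario E₁ E₂ F₂ C₂ → F₂) (y₃ : E₂ → Scenario E₂ E₃ F₃ C₃ → F₃) (ε M₃ : ℝ) (u : E₁)
    (ξ₂ : Scenario E₁ E₂ F₂ C₂) (ζ : ℕ → Scenario E₂ E₃ F₃ C₃) (k : ℕ) : E₂ × F₂ × F₂ :=
  P.S₂.iter ξ₂.A (ξ₂.rhs u) ξ₂.c (P.middleSteps y₂ ε M₃ u ξ₂)
    (fun j x => P.G₃ y₃ ε x (ζ j)) k

/-- The accumulated error of the first `n` steps of the middle loop, compared with `x`. -/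
noncomputable def middleNoise (P : Problem E₁ F₁ C₁ E₂ F₂ C₂ E₃ F₃ C₃)
    (y₂ : E₁ → Scenario E₁ E₂ F₂ C₂ → F₂) (y₃ : E₂ → Scenario E₂ E₃ F₃ C₃ → F₃) (ε M₃ : ℝ) (u : E₁)
    (ξ₂ : Scenario E₁ E₂ F₂ C₂) (x : E₂) (n : ℕ) (ζ : ℕ → Scenario E₂ E₃ F₃ C₃) : ℝ :=
  ∑ k ∈ Finset.range n, P.S₂.noise (P.middleSteps y₂ ε M₃ u ξ₂).τ M₃ (P.v₃ ξ₂)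
    (P.G₃ y₃ ε (P.middleIter y₂ y₃ ε M₃ u ξ₂ ζ k).1 (ζ k))
    (P.middleIter y₂ y₃ ε M₃ u ξ₂ ζ k).1 x

/-- The law of the realizations of `ξ³` drawn in a middle loop, given `ξ²`. -/
noncomputable def κInf (P : Problem E₁ F₁ C₁ E₂ F₂ C₂ E₃ F₃ C₃) [IsMarkovKernel P.κ] :
    Kernel (Scenario E₁ E₂ F₂ C₂) (ℕ → Scenario E₂ E₃ F₃ C₃) where
  toFun s := Measure.infinitePi fun _ : ℕ => P.κ s
  measurable' := measurable_infinitePi_kernel P.κ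

instance [IsMarkovKernel P.κ] : IsMarkovKernel P.κInf :=
  ⟨fun s => inferInstanceAs (IsProbabilityMeasure (Measure.infinitePi fun _ : ℕ => P.κ s))⟩

namespace Assumptions

/-- With ξ² frozen, the coordinates under the infinite product are the independent samples of the
loop. The index n is free because part (b) also needs the noise of partial loops. -/
theorem integral_middleNoise_le (hP : P.Assumptions y₂ y₃) {ε M₃ : ℝ} (hM : 0 ≤ M₃)
    {ξ₂ : Scenario E₁ E₂ F₂ C₂} (hR : P.Regular y₃ ε M₃ ξ₂) (u : E₁) {x : E₂} (hx : x ∈ P.S₂.X)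
    (n : ℕ) :
    Integrable (P.middleNoise y₂ y₃ ε M₃ u ξ₂ x n) (Measure.infinitePi fun _ : ℕ => P.κ ξ₂) ∧
      ∫ ζ, P.middleNoise y₂ y₃ ε M₃ u ξ₂ x n ζ ∂(Measure.infinitePi fun _ : ℕ => P.κ ξ₂)
        ≤ n * (4 * M₃ ^ 2 / ((P.middleSteps y₂ ε M₃ u ξ₂).τ * P.S₂.α) + ε / 6) := by
  haveI := hP.isMarkov_κ
  exact hP.valid₂.integral_sum_noise_le ξ₂.A (ξ₂.rhs u) ξ₂.c
    (s := P.middleSteps y₂ ε M₃ u ξ₂) rfl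
    (Stage.conservative_τ_pos hP.valid₂.α_pos (norm_pos_iff.2 hR.A_ne) (P.one_le_N₂ y₂ ε M₃ u ξ₂))
    hM hR.lipschitz (hP.measurable_G₃ ε) hR.moment hx (fun p hp => hR.subgradient p hp x hx)
    (ν := Measure.infinitePi fun _ : ℕ => P.κ ξ₂) (z := fun k ζ => ζ k)
    (fun k => measurable_pi_apply k) (fun k => Measure.infinitePi_map_eval _ k)
    (iIndepFun_infinitePi (X := fun _ => id) fun _ => measurable_id) n

theorem V₂_add_G₂_le (hP : P.Assumptions y₂ y₃) {ε M₃ : ℝ}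
    {ξ₂ : Scenario E₁ E₂ F₂ C₂} (hR : P.Regular y₃ ε M₃ ξ₂) {p x : E₁} {a b : E₂}
    (h : P.S₂.IsSaddle ξ₂.A (ξ₂.rhs p) ξ₂.c (P.v₃ ξ₂) a (y₂ p ξ₂))
    (h' : P.S₂.IsSaddle ξ₂.A (ξ₂.rhs x) ξ₂.c (P.v₃ ξ₂) b (y₂ x ξ₂))
    (ζ : ℕ → Scenario E₂ E₃ F₃ C₃) :
    P.V₂ p ξ₂ + P.G₂ y₂ y₃ ε M₃ p ξ₂ ζ (x - p) ≤ P.V₂ x ξ₂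
      + (P.N₂ y₂ ε M₃ p ξ₂ : ℝ)⁻¹ * ((P.middleSteps y₂ ε M₃ p ξ₂).τ * P.S₂.Ω ^ 2
        + (P.middleSteps y₂ ε M₃ p ξ₂).η / 2 * ‖y₂ p ξ₂ - P.S₂.y₀‖ ^ 2
        + P.middleNoise y₂ y₃ ε M₃ p ξ₂ b (P.N₂ y₂ ε M₃ p ξ₂) ζ) := by
  have hα := hP.valid₂.α_pos
  have ha : 0 < ‖ξ₂.A‖ := norm_pos_iff.2 hR.A_ne
  have hN := P.one_le_N₂ y₂ ε M₃ p ξ₂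
  have h1 := hP.valid₂.value_add_inner_le (s := P.middleSteps y₂ ε M₃ p ξ₂)
    rfl rfl (Stage.conservative_τ_pos hα ha hN) (Stage.conservative_η_pos hα ha hN)
    (Stage.conservative_le hα ha hN) hR.convexOn hR.lipschitz
    (fun j x => P.G₃ y₃ ε x (ζ j)) hN h h'
  rwa [Scenario.rhs_sub] at h1

theorem measurable_N₂ (hP : P.Assumptions y₂ y₃) (ε M₃ : ℝ) :
    Measurable fun q : E₁ × Scenario E₁ E₂ F₂ C₂ => P.N₂ y₂ ε M₃ q.1 q.2 := by
  have hA : Measurable fun q : E₁ × Scenario E₁ E₂ F₂ C₂ => ‖q.2.A‖ :=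
    (Scenario.measurable_A.comp measurable_snd).norm
  unfold N₂
  refine measurable_const.max (Nat.measurable_ceil.comp (Measurable.add ?_ ?_))
  · exact (((hA.const_mul _).mul_const _).div_const _).pow_const _
  · exact ((((hA.mul ((hP.measurable_y₂.sub_const _).norm.pow_const 2)).add_const _).const_mul
      _).div_const _).pow_const _

theorem measurable_G₂ (hP : P.Assumptions y₂ y₃) (ε M₃ : ℝ) :
    Measurable fun q : E₁ × (Scenario E₁ E₂ F₂ C₂ × (ℕ → Scenario E₂ E₃ F₃ C₃)) =>
      P.G₂ y₂ y₃ ε M₃ q.1 q.2.1 q.2.2 := by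
  have h1 : Measurable fun q : E₁ × (Scenario E₁ E₂ F₂ C₂ × (ℕ → Scenario E₂ E₃ F₃ C₃)) => q.1 :=
    measurable_fst
  have h2 : Measurable fun q : E₁ × (Scenario E₁ E₂ F₂ C₂ × (ℕ → Scenario E₂ E₃ F₃ C₃)) => q.2.1 :=
    measurable_fst.comp measurable_snd
  have h3 : Measurable fun q : E₁ × (Scenario E₁ E₂ F₂ C₂ × (ℕ → Scenario E₂ E₃ F₃ C₃)) => q.2.2 :=
    measurable_snd.comp measurable_snd
  have h12 := h1.prodMk h2
  have hN := (hP.measurable_N₂ ε M₃).comp h12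
  have hG : ∀ k, Measurable fun w : (E₁ × (Scenario E₁ E₂ F₂ C₂ × (ℕ → Scenario E₂ E₃ F₃ C₃))) × E₂ =>
      P.G₃ y₃ ε w.2 (w.1.2.2 k) := fun k => by
    have hw : Measurable fun w : (E₁ × (Scenario E₁ E₂ F₂ C₂ × (ℕ → Scenario E₂ E₃ F₃ C₃))) × E₂ =>
        w.1.2.2 k :=
      (measurable_pi_apply k).comp (h3.comp measurable_fst)
    have hw' : Measurable fun w : (E₁ × (Scenario E₁ E₂ F₂ C₂ × (ℕ → Scenario E₂ E₃ F₃ C₃))) × E₂ => w.2 :=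
      measurable_snd
    have h := (hP.measurable_G₃ ε).comp (hw'.prodMk hw)
    exact h
  have hA := Scenario.measurable_A.comp h2
  have hr := Scenario.measurable_rhs.comp h12
  have hc := Scenario.measurable_c.comp h2
  have hB := Scenario.measurable_B.comp h2
  have hy := hP.valid₂.measurable_avgDual_conservative (M := M₃)
      (G := fun (q : E₁ × (Scenario E₁ E₂ F₂ C₂ × (ℕ → Scenario E₂ E₃ F₃ C₃))) j x =>
        P.G₃ y₃ ε x (q.2.2 j)) hA hr hc hG hN
  have h := measurable_innerSL_comp hy hB
  exact h

theorem middle_gap_le (hP : P.Assumptions y₂ y₃) {ε M₃ : ℝ} (hε : 0 < ε) (hM : 0 ≤ M₃)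
    {ξ₂ : Scenario E₁ E₂ F₂ C₂} (hA : ξ₂.A ≠ 0) (p : E₁) :
    (P.N₂ y₂ ε M₃ p ξ₂ : ℝ)⁻¹ * ((P.middleSteps y₂ ε M₃ p ξ₂).τ * P.S₂.Ω ^ 2
        + (P.middleSteps y₂ ε M₃ p ξ₂).η / 2 * ‖y₂ p ξ₂ - P.S₂.y₀‖ ^ 2
        + P.N₂ y₂ ε M₃ p ξ₂
          * (4 * M₃ ^ 2 / ((P.middleSteps y₂ ε M₃ p ξ₂).τ * P.S₂.α) + ε / 6)) ≤ ε / 2 :=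
  Stage.conservative_gap_le hP.valid₂.α_pos (hP.valid₂.Ω_pos hP.nontrivial₂)
    (norm_pos_iff.2 hA) hM hε (P.one_le_N₂ y₂ ε M₃ p ξ₂)
    ((Nat.le_ceil _).trans (by exact_mod_cast le_max_right _ _))

theorem V₂_subgradient (hP : P.Assumptions y₂ y₃) : ∀ u ∈ P.S₁.X, ∀ u' ∈ P.S₁.X,
    ∀ᵐ ξ ∂P.μ, P.V₂ u ξ + (innerSL ℝ (y₂ u ξ)).comp ξ.B (u' - u) ≤ P.V₂ u' ξ := by
  intro u hu u' hu'
  filter_upwards [hP.saddle₂ u hu, hP.saddle₂ u' hu'] with ξ ⟨a, ha⟩ ⟨b, hb⟩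
  rw [← Scenario.rhs_sub]
  exact ha.value_add_inner_le hb

theorem convexOn_v₂ (hP : P.Assumptions y₂ y₃) : ConvexOn ℝ P.S₁.X P.v₂ :=
  convexOn_integral_of_subgradient hP.valid₁.convex hP.integrable_V₂ hP.V₂_subgradient

theorem lintegral_G₂_le (hP : P.Assumptions y₂ y₃) [IsMarkovKernel P.κ] {ε M₃ M₂ : ℝ}
    (hb : P.IsBound₂ y₂ y₃ ε M₃ M₂) {p : E₁} (hp : p ∈ P.S₁.X) :
    ∫⁻ z, ‖P.G₂ y₂ y₃ ε M₃ p z.1 z.2‖ₑ ^ 2 ∂(P.μ ⊗ₘ P.κInf) ≤ ENNReal.ofReal (M₂ ^ 2) := by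
  haveI := hP.isProbability_μ
  rw [Measure.lintegral_compProd]
  · exact hb.2.2 p hp
  · exact ((hP.measurable_G₂ ε M₃).comp
      (measurable_const.prodMk measurable_id)).enorm.pow_const 2

/-- The integral is disintegrated: given ξ², the pathwise inequality `V₂_add_G₂_le` is averaged over
the ξ³-samples, where the mean noise and the choice of N₂ bring the error to ε/2; then ξ² is
averaged. -/
theorem v₂_subgradient (hP : P.Assumptions y₂ y₃) [IsMarkovKernel P.κ] {ε M₃ M₂ : ℝ} (hε : 0 < ε)
    (hb₃ : P.IsBound₃ y₃ ε M₃) (hb : P.IsBound₂ y₂ y₃ ε M₃ M₂) {p x : E₁} (hp : p ∈ P.S₁.X)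
    (hx : x ∈ P.S₁.X) :
    ∫ z, P.G₂ y₂ y₃ ε M₃ p z.1 z.2 (x - p) ∂(P.μ ⊗ₘ P.κInf) + P.v₂ p - P.v₂ x ≤ ε / 2 := by
  haveI := hP.isProbability_μ
  have hG : Integrable (fun z : Scenario E₁ E₂ F₂ C₂ × (ℕ → Scenario E₂ E₃ F₃ C₃) =>
      P.G₂ y₂ y₃ ε M₃ p z.1 z.2 (x - p)) (P.μ ⊗ₘ P.κInf) :=
    (Stage.integrable_of_lintegral_le ((hP.measurable_G₂ ε M₃).comp
      (measurable_const.prodMk measurable_id)).aestronglyMeasurable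
      (hP.lintegral_G₂_le hb hp)).apply_continuousLinearMap _
  have hGae : ∀ᵐ s ∂P.μ, Integrable (fun ζ => P.G₂ y₂ y₃ ε M₃ p s ζ (x - p)) (P.κInf s) :=
    ((Measure.integrable_compProd_iff hG.aestronglyMeasurable).1 hG).1
  rw [Measure.integral_compProd hG]
  have hGi : Integrable (fun s => ∫ ζ, P.G₂ y₂ y₃ ε M₃ p s ζ (x - p) ∂P.κInf s) P.μ :=
    Integrable.integral_compProd (κ := Kernel.const Unit P.μ)
      (η := Kernel.prodMkLeft Unit P.κInf) (a := ()) hG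
  refine integral_add_sub_integral_le hGi (hP.integrable_V₂ p hp)
    (hP.integrable_V₂ x hx) ?_
  filter_upwards [hP.ae_regular hε hb₃, hP.saddle₂ p hp, hP.saddle₂ x hx, hGae]
    with s hR ⟨a, ha⟩ ⟨b, hb⟩ hGs
  obtain ⟨hn1, hn2⟩ := hP.integral_middleNoise_le hb₃.1 hR p hb.1 (P.N₂ y₂ ε M₃ p s)
  change Integrable _ (P.κInf s) at hn1
  change ∫ ζ, _ ∂P.κInf s ≤ _ at hn2
  have hgap := hP.middle_gap_le hε hb₃.1 hR.A_ne p
  have hpt := hP.V₂_add_G₂_le hR ha hb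
  set K := (P.middleSteps y₂ ε M₃ p s).τ * P.S₂.Ω ^ 2
    + (P.middleSteps y₂ ε M₃ p s).η / 2 * ‖y₂ p s - P.S₂.y₀‖ ^ 2
  set n := P.N₂ y₂ ε M₃ p s
  have hWi : Integrable (fun ζ => (n : ℝ)⁻¹ * (K + P.middleNoise y₂ y₃ ε M₃ p s b n ζ))
      (P.κInf s) := ((integrable_const K).add hn1).const_mul _
  -- The values of V² and the comparison point b are constant in ζ, so only the noise has to be
  -- averaged.
  have hint := integral_add_sub_integral_le hGs (integrable_const (P.V₂ p s - P.V₂ x s)) hWi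
    (e := 0) (Filter.Eventually.of_forall fun ζ => by linarith [hpt ζ])
  rw [integral_const_mul, integral_add (integrable_const K) hn1] at hint
  simp only [integral_const, probReal_univ, one_smul] at hint
  have h3 := mul_le_mul_of_nonneg_left (add_le_add_right hn2 K)
    (show 0 ≤ (n : ℝ)⁻¹ by positivity)
  linarith

end Assumptions

end Problem

/-! ### The outer loop as an abstract loop with independent samples -/

namespace Stage

section Estimates

variable {E F C : Type*} [NormedAddCommGroup E] [NormedSpace ℝ E]
    [NormedAddCommGroup F] [InnerProductSpace ℝ F] [FiniteDimensional ℝ F]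
    {S : Stage E F C} {N : ℕ} {M a ε D : ℝ}

theorem aggressive_budget (hα : 0 < S.α) (hΩ : 0 < S.Ω) (ha : 0 < a) (hM : 0 ≤ M)
    (hε : 0 < ε) (hN : 1 ≤ N) (h : (24 * √3 * M * S.Ω / (√S.α * ε)) ^ 2 ≤ N) :
    (S.aggressive N M a).τ * S.Ω ^ 2 + N * (4 * M ^ 2 / ((S.aggressive N M a).τ * S.α) + ε / 2)
      ≤ (S.aggressive N M a).η * S.Ω ^ 2 + N * ε * (2 / 3) := by
  have hq : 0 < √S.α := Real.sqrt_pos.2 hα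
  have hN0 : (0 : ℝ) < N := by positivity
  have hn : 0 < √(N : ℝ) := Real.sqrt_pos.2 hN0
  have hn2 : √(N : ℝ) ^ 2 = N := Real.sq_sqrt hN0.le
  have hbud := max_stepSize_budget hα hΩ hM (aggressive_η_pos (N := N) (M := M) hα ha) hN
  have hlin := Real.le_sqrt_of_sq_le h
  rw [div_le_iff₀ (by positivity)] at hlin
  have k : 4 * √3 * M * S.Ω * √N / √S.α ≤ √N ^ 2 * (ε / 6) := by
    rw [div_le_iff₀ hq]
    have := mul_le_mul_of_nonneg_left hlin hn.le
    linarith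
  rw [hn2] at k
  change (S.aggressive N M a).τ * S.Ω ^ 2
    + N * (4 * M ^ 2 / ((S.aggressive N M a).τ * S.α)) ≤ _ at hbud
  linarith

theorem aggressive_η_bound (hα : 0 < S.α) (hε : 0 < ε)
    (h : 6 * √2 * a * (2 * S.Ω ^ 2 + D ^ 2) / (√S.α * ε) ≤ N) :
    6 * (S.aggressive N M a).η * (2 * S.Ω ^ 2 + D ^ 2) ≤ N * ε := by
  have hq : 0 < √S.α := Real.sqrt_pos.2 hα
  rw [div_le_iff₀ (by positivity)] at h
  simp only [aggressive]
  have e : 6 * (√2 * a / √S.α) * (2 * S.Ω ^ 2 + D ^ 2)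
      = 6 * √2 * a * (2 * S.Ω ^ 2 + D ^ 2) / √S.α := by ring
  rw [e, div_le_iff₀ hq]
  linarith

theorem aggressive_gap_le (hα : 0 < S.α) (hΩ : 0 < S.Ω) (ha : 0 < a) (hM : 0 ≤ M)
    (hε : 0 < ε) (hN : 1 ≤ N)
    (h : 6 * √2 * a * (2 * S.Ω ^ 2 + D ^ 2) / (√S.α * ε)
      + (24 * √3 * M * S.Ω / (√S.α * ε)) ^ 2 ≤ N) :
    (N : ℝ)⁻¹ * ((S.aggressive N M a).τ * S.Ω ^ 2 + (S.aggressive N M a).η / 2 * D ^ 2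
      + N * (4 * M ^ 2 / ((S.aggressive N M a).τ * S.α) + ε / 2)) ≤ ε := by
  have hN0 : (0 : ℝ) < N := by positivity
  have h0 : 0 ≤ 6 * √2 * a * (2 * S.Ω ^ 2 + D ^ 2) / (√S.α * ε) := by positivity
  have h1 := aggressive_budget hα hΩ ha hM hε hN (by linarith)
  have h2 := aggressive_η_bound (S := S) (N := N) (M := M) (D := D) hα hε
    ((le_add_of_nonneg_right (sq_nonneg _)).trans h)
  have := mul_pos hN0 hε
  rw [inv_mul_le_iff₀ hN0]
  linarith

/-- Both conclusions follow from 12η ≤ Nε, 12ηΩ² ≤ Nε and 6ηD ≤ Nε. The summand 3√α in the second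
entry of N₁ yields the first of these, through √2 ≤ 3/2. -/
theorem aggressive_residual_le {D' : ℝ} (hα : 0 < S.α) (hΩ : 0 < S.Ω) (ha : 0 < a) (hM : 0 ≤ M)
    (hε : 0 < ε) (hD : 0 ≤ D) (hN : 1 ≤ N)
    (h : 6 * √2 * a * (2 * S.Ω ^ 2 + D' ^ 2) / (√S.α * ε)
      + (24 * √3 * M * S.Ω / (√S.α * ε)) ^ 2 ≤ N)
    (h' : 6 * a * (√(2 * S.α) * D + 2 * S.Ω + 3 * √S.α) / (S.α * ε) ≤ N) :
    6 * ((S.aggressive N M a).η * D) ≤ N * ε ∧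
    8 * (S.aggressive N M a).η * ((S.aggressive N M a).τ * S.Ω ^ 2
      + N * (4 * M ^ 2 / ((S.aggressive N M a).τ * S.α) + ε / 2)) ≤ (N * ε) ^ 2 := by
  have hq : 0 < √S.α := Real.sqrt_pos.2 hα
  have hq2 : √S.α ^ 2 = S.α := Real.sq_sqrt hα.le
  have hN0 : (0 : ℝ) < N := by positivity
  have hNε := mul_pos hN0 hε
  have hη := aggressive_η_pos (S := S) (N := N) (M := M) hα ha
  have h0 : 0 ≤ 6 * √2 * a * (2 * S.Ω ^ 2 + D' ^ 2) / (√S.α * ε) := by positivity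
  have h1 := aggressive_budget hα hΩ ha hM hε hN (by linarith)
  have h2 := aggressive_η_bound (S := S) (N := N) (M := M) (D := D') hα hε
    ((le_add_of_nonneg_right (sq_nonneg _)).trans h)
  rw [div_le_iff₀ (by positivity), Real.sqrt_mul (by norm_num : (0 : ℝ) ≤ 2)] at h'
  have h3 : 6 * a * (√2 * D + 3) ≤ N * ε * √S.α := by
    have : 6 * a * (√2 * D + 3) * √S.α ≤ N * ε * √S.α * √S.α := by
      have : 0 ≤ 12 * a * S.Ω := by positivity
      nlinarith
    exact le_of_mul_le_mul_right this hq
  have hηq : (S.aggressive N M a).η * √S.α = √2 * a := by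
    simp only [aggressive]; field_simp
  have h22 : √(2 : ℝ) ≤ 3 / 2 := by rw [Real.sqrt_le_left (by norm_num)]; norm_num
  have hs2 : 0 ≤ √(2 : ℝ) := by positivity
  generalize (S.aggressive N M a).η = η at *
  have hD6 : 6 * (η * D) ≤ N * ε := by
    refine le_of_mul_le_mul_right ?_ hq
    have : 6 * (η * D) * √S.α = 6 * a * (√2 * D) := by
      calc 6 * (η * D) * √S.α = 6 * D * (η * √S.α) := by ring
        _ = _ := by rw [hηq]; ring
    rw [this]
    linarith
  have h12 : 12 * η ≤ N * ε := by
    refine le_of_mul_le_mul_right ?_ hq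
    have e1 : 12 * η * √S.α = 12 * (√2 * a) := by rw [← hηq]; ring
    have e2 : 0 ≤ 6 * a * (√2 * D) := by positivity
    have := mul_le_mul_of_nonneg_right h22 ha.le
    rw [e1]
    linarith
  refine ⟨hD6, ?_⟩
  have h5 : 12 * (η * S.Ω ^ 2) ≤ N * ε := by
    have : 0 ≤ η * D' ^ 2 := by positivity
    linarith
  have h6 := mul_le_mul_of_nonneg_left h1 (show 0 ≤ 8 * η by positivity)
  have h7 := mul_le_mul h12 h5 (by positivity) hNε.le
  have h8 := mul_le_mul_of_nonneg_right h12 hNε.le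
  nlinarith

end Estimates

variable {E F C : Type*} [NormedAddCommGroup E] [NormedSpace ℝ E] [FiniteDimensional ℝ E]
    [MeasurableSpace E] [BorelSpace E]
    [NormedAddCommGroup F] [InnerProductSpace ℝ F] [FiniteDimensional ℝ F]
    [MeasurableSpace F] [BorelSpace F] [MeasurableSpace C]
    {S : Stage E F C}

/-- Strict superlevel sets of h are only relatively open in X, but p takes values in X, so they pull
back like open sets. -/
theorem IsValid.measurable_h_comp (hS : S.IsValid) (c : C) {W : Type*} [MeasurableSpace W]
    {p : W → E} (hp : Measurable p) (hpX : ∀ ω, p ω ∈ S.X) : Measurable fun ω => S.h (p ω) c := by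
  refine measurable_of_Ioi fun b => ?_
  obtain ⟨u, hu, he⟩ := lowerSemicontinuousOn_iff_preimage_Ioi.1 (hS.lsc_h c) b
  have : (fun ω => S.h (p ω) c) ⁻¹' Ioi b = p ⁻¹' u := by
    ext ω
    have := Set.ext_iff.1 he (p ω)
    simpa [hpX ω] using this
  rw [this]
  exact hp hu.measurableSet

section Loop

variable {W Z : Type*} [MeasurableSpace W] [MeasurableSpace Z] {ν : Measure W}
  [IsProbabilityMeasure ν] {ρ : Measure Z} [IsProbabilityMeasure ρ]

/-- The quality of the output of a loop with aggressive step sizes. -/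
theorem IsValid.aggressive_loop (hS : S.IsValid) (hX : S.X.Nontrivial) {A : E →L[ℝ] F}
    (hA : A ≠ 0) {r : F} {c : C} {N : ℕ} (hN : 1 ≤ N) {M ε : ℝ} (hε : 0 < ε) (hM : 0 ≤ M)
    {v : E → ℝ} (hc : ConvexOn ℝ S.X v)
    (hv : ∀ x ∈ S.X, ∀ x' ∈ S.X, |v x - v x'| ≤ M * ‖x - x'‖)
    {g : E → Z → StrongDual ℝ E} (hg : Measurable fun w : E × Z => g w.1 w.2)
    (hgM : ∀ p ∈ S.X, ∫⁻ z, ‖g p z‖ₑ ^ 2 ∂ρ ≤ ENNReal.ofReal (M ^ 2)) {x : E} {y : F}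
    (hs : S.IsSaddle A r c v x y)
    (he : ∀ p ∈ S.X, ∫ z, g p z (x - p) ∂ρ + v p - v x ≤ ε / 2)
    {z : ℕ → W → Z} (hz : ∀ k, Measurable (z k)) (hlaw : ∀ k, ν.map (z k) = ρ)
    (hi : iIndepFun z ν)
    (hN₁ : 6 * √2 * ‖A‖ * (2 * S.Ω ^ 2 + ‖S.y₀‖ ^ 2) / (√S.α * ε)
      + (24 * √3 * M * S.Ω / (√S.α * ε)) ^ 2 ≤ N)
    (hN₂ : 6 * ‖A‖ * (√(2 * S.α) * ‖y - S.y₀‖ + 2 * S.Ω + 3 * √S.α) / (S.α * ε) ≤ N) :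
    let xbar : W → E := fun ω =>
      S.avgPrimal A r c (S.aggressive N M ‖A‖) (fun k p => g p (z k ω)) N
    Integrable (fun ω => S.h (xbar ω) c + v (xbar ω) - (S.h x c + v x)) ν ∧
    ∫ ω, (S.h (xbar ω) c + v (xbar ω) - (S.h x c + v x)) ∂ν ≤ ε ∧
    ∃ δ : W → F, Integrable δ ν ∧ (∀ ω, A (xbar ω) - r - δ ω ∈ S.K) ∧ ∫ ω, ‖δ ω‖ ∂ν ≤ ε := by
  intro xbar
  have hα := hS.α_pos
  have ha : 0 < ‖A‖ := norm_pos_iff.2 hA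
  have hΩ := hS.Ω_pos hX
  set s := S.aggressive N M ‖A‖ with hsdef
  have hτ : 0 < s.τ := aggressive_τ_pos hα ha
  have hη : 0 < s.η := aggressive_η_pos hα ha
  have hsA : 2 * ‖A‖ ^ 2 ≤ s.τ * S.α * s.η := aggressive_le hα ha
  have hN0 : (0 : ℝ) < N := by positivity
  have hG : ∀ k, Measurable fun w : W × E => g w.2 (z k w.1) := fun k =>
    hg.comp (measurable_snd.prodMk ((hz k).comp measurable_fst))
  have hxX : ∀ ω, xbar ω ∈ S.X := fun ω => hS.avgPrimal_mem rfl _ hN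
  have hxm : Measurable xbar := hS.measurable_avgPrimal measurable_const measurable_const
    measurable_const (fun _ => rfl) (fun _ => rfl) measurable_const measurable_const hG N
  set yN : W → F := fun ω => (S.iter A r c s (fun k p => g p (z k ω)) N).2.1 with hyN
  have hym : Measurable yN := (hS.measurable_iter measurable_const measurable_const
    measurable_const (fun _ => rfl) measurable_const measurable_const hG N).snd.fst
  set T : W → ℝ := fun ω => ∑ k ∈ Finset.range N, S.noise s.τ M v
        (g (S.iter A r c s (fun j p => g p (z j ω)) k).1 (z k ω))
        (S.iter A r c s (fun j p => g p (z j ω)) k).1 x with hT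
  obtain ⟨hTi, hTle⟩ : Integrable T ν ∧ ∫ ω, T ω ∂ν ≤ N * (4 * M ^ 2 / (s.τ * S.α) + ε / 2) :=
    hS.integral_sum_noise_le A r c (s := s) rfl hτ hM hv hg hgM hs.1 he hz hlaw hi N
  -- With y = 0 the constraint term disappears at the averaged primal point, while feasibility of x
  -- keeps its Lagrangian below its objective value.
  have hupper : ∀ ω, S.h (xbar ω) c + v (xbar ω) - (S.h x c + v x)
      ≤ (N : ℝ)⁻¹ * (s.τ * S.Ω ^ 2 + s.η / 2 * ‖S.y₀‖ ^ 2 + T ω) := by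
    intro ω
    have h1 := hS.gap_avg_le_of_sum (A := A) (r := r) (c := c) (s := s) rfl rfl hτ hη hsA hc hv
      (fun k p => g p (z k ω)) hs.1 S.zero_mem_dualCone hN
    have h2 := lagrangian_le_of_mem c v hs.mem_K
      (avgDual_mem (S := S) (A := A) (r := r) (c := c) (s := s) rfl hη
        (fun k p => g p (z k ω)) N)
    have h3 : S.lagrangian A r c v (xbar ω) 0 = S.h (xbar ω) c + v (xbar ω) := by
      simp [lagrangian]
    rw [zero_sub, norm_neg] at h1
    change S.lagrangian A r c v (xbar ω) 0 - _ ≤ _ at h1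
    rw [h3] at h1
    linarith
  obtain ⟨R, hR⟩ := hS.isCompact.exists_bound_of_continuousOn
    (f := fun x => inner ℝ (r - A x) y) (by fun_prop)
  -- The averaged point may be infeasible, so the optimality gap can be negative. The saddle
  -- property bounds it below uniformly, which is needed for integrability.
  have hlower : ∀ ω, -R ≤ S.h (xbar ω) c + v (xbar ω) - (S.h x c + v x) := by
    intro ω
    have h1 := hs.value_le_lagrangian (hxX ω)
    rw [hs.value_eq, lagrangian] at h1
    have h2 := (le_abs_self _).trans (hR _ (hxX ω))
    linarith
  have hbound : Integrable (fun ω => (N : ℝ)⁻¹ * (s.τ * S.Ω ^ 2 + s.η / 2 * ‖S.y₀‖ ^ 2 + T ω)) ν :=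
    ((integrable_const _).add hTi).const_mul _
  obtain ⟨v', hv'c, hvv', -⟩ := hS.exists_continuous_eqOn hM hv
  have hfm : Measurable fun ω => S.h (xbar ω) c + v (xbar ω) - (S.h x c + v x) := by
    have h1 : (fun ω => v (xbar ω)) = fun ω => v' (xbar ω) := funext fun ω => hvv' (hxX ω)
    exact ((hS.measurable_h_comp c hxm hxX).add
      (h1 ▸ hv'c.measurable.comp hxm)).sub_const _
  have hfi : Integrable (fun ω => S.h (xbar ω) c + v (xbar ω) - (S.h x c + v x)) ν := by
    refine (hbound.norm.add (integrable_const |R|)).mono' hfm.aestronglyMeasurable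
      (Filter.Eventually.of_forall fun ω => ?_)
    have h1 := (hupper ω).trans (le_abs_self _)
    have h2 := hlower ω
    have h3 := le_abs_self R
    have h4 := abs_nonneg R
    rw [Real.norm_eq_abs, abs_le]
    simp only [Pi.add_apply, Real.norm_eq_abs]
    have h5 := abs_nonneg ((N : ℝ)⁻¹ * (s.τ * S.Ω ^ 2 + s.η / 2 * ‖S.y₀‖ ^ 2 + T ω))
    constructor <;> linarith
  refine ⟨hfi, ?_, ?_⟩
  · refine (integral_mono hfi hbound hupper).trans ?_
    rw [integral_const_mul, integral_add (integrable_const _) hTi]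
    simp only [integral_const, probReal_univ, one_smul]
    refine (mul_le_mul_of_nonneg_left (add_le_add_right hTle _) (by positivity)).trans ?_
    exact aggressive_gap_le hα hΩ ha hM hε hN hN₁
  · obtain ⟨hD, hU⟩ := aggressive_residual_le hα hΩ ha hM hε (norm_nonneg (y - S.y₀)) hN hN₁ hN₂
    rw [← hsdef] at hD hU
    set D := ‖y - S.y₀‖
    set U := s.τ * S.Ω ^ 2 + N * (4 * M ^ 2 / (s.τ * S.α) + ε / 2)
    -- Chosen so that ηt/N = ε/2 and so that 8ηU ≤ (Nε)² becomes 2U/η ≤ t².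
    set t := N * ε / (2 * s.η) with ht
    have ht0 : 0 < t := by positivity
    have hst : 0 < D + t := add_pos_of_nonneg_of_pos (norm_nonneg _) ht0
    -- The bound a ≤ (a²/s + s)/2 with s = D + t passes from second to first moments. As D² + t² ≤
    -- (D + t)², the resulting mean is at most D + t.
    have hdist : ∀ ω, ‖y - yN ω‖
        ≤ ((2 / s.η * (s.τ * S.Ω ^ 2 + T ω) + D ^ 2) / (D + t) + (D + t)) / 2 := by
      intro ω
      have h1 : s.η / 2 * ‖y - yN ω‖ ^ 2 ≤ s.τ * S.Ω ^ 2 + s.η / 2 * D ^ 2 + T ω :=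
        hS.norm_dual_sub_sq_le (A := A) (r := r) (c := c) (s := s) rfl hτ hη hsA hv
          (fun k p => g p (z k ω)) N hs
      have h2 : ‖y - yN ω‖ ^ 2 ≤ 2 / s.η * (s.τ * S.Ω ^ 2 + T ω) + D ^ 2 := by
        have := mul_le_mul_of_nonneg_left h1 (show 0 ≤ 2 / s.η by positivity)
        have e1 : 2 / s.η * (s.η / 2 * ‖y - yN ω‖ ^ 2) = ‖y - yN ω‖ ^ 2 := by field_simp
        have e2 : 2 / s.η * (s.τ * S.Ω ^ 2 + s.η / 2 * D ^ 2 + T ω)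
            = 2 / s.η * (s.τ * S.Ω ^ 2 + T ω) + D ^ 2 := by field_simp; ring
        rw [e1, e2] at this
        exact this
      have h3 := div_le_div_of_nonneg_right h2 hst.le
      have h4 : 2 * ‖y - yN ω‖ ≤ ‖y - yN ω‖ ^ 2 / (D + t) + (D + t) := by
        have h5 : 0 ≤ (‖y - yN ω‖ - (D + t)) ^ 2 / (D + t) := by positivity
        have e : (‖y - yN ω‖ - (D + t)) ^ 2 / (D + t)
            = ‖y - yN ω‖ ^ 2 / (D + t) + (D + t) - 2 * ‖y - yN ω‖ := by field_simp; ring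
        linarith
      linarith
    have hbi : Integrable (fun ω => ((2 / s.η * (s.τ * S.Ω ^ 2 + T ω) + D ^ 2) / (D + t)
        + (D + t)) / 2) ν :=
      ((((((integrable_const _).add hTi).const_mul _).add (integrable_const _)).div_const _).add
        (integrable_const _)).div_const _
    have hdi : Integrable (fun ω => ‖y - yN ω‖) ν :=
      hbi.mono' (hym.const_sub y).norm.aestronglyMeasurable
        (Filter.Eventually.of_forall fun ω => by rw [norm_norm]; exact hdist ω)
    have hE : ∫ ω, ‖y - yN ω‖ ∂ν ≤ D + t := by
      refine (integral_mono hdi hbi hdist).trans ?_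
      have hi1 : Integrable (fun ω => s.τ * S.Ω ^ 2 + T ω) ν := (integrable_const _).add hTi
      have hi2 : Integrable (fun ω => 2 / s.η * (s.τ * S.Ω ^ 2 + T ω)) ν := hi1.const_mul _
      have hi3 : Integrable (fun ω => 2 / s.η * (s.τ * S.Ω ^ 2 + T ω) + D ^ 2) ν :=
        hi2.add (integrable_const _)
      rw [integral_div, integral_add (hi3.div_const _) (integrable_const _), integral_div,
        integral_add hi2 (integrable_const _), integral_const_mul,
        integral_add (integrable_const _) hTi]
      simp only [integral_const, probReal_univ, one_smul]
      have h1 : 2 / s.η * (s.τ * S.Ω ^ 2 + ∫ ω, T ω ∂ν) ≤ t ^ 2 := by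
        have h2 : 2 / s.η * (s.τ * S.Ω ^ 2 + ∫ ω, T ω ∂ν) ≤ 2 / s.η * U := by
          exact mul_le_mul_of_nonneg_left (add_le_add_right hTle _) (by positivity)
        refine h2.trans ?_
        rw [ht, div_pow, div_mul_eq_mul_div, div_le_div_iff₀ hη (by positivity)]
        have := mul_le_mul_of_nonneg_left hU hη.le
        nlinarith
      have h2 : (2 / s.η * (s.τ * S.Ω ^ 2 + ∫ ω, T ω ∂ν) + D ^ 2) / (D + t) ≤ D + t := by
        rw [div_le_iff₀ hst]
        have : 0 ≤ D * t := mul_nonneg (norm_nonneg _) ht0.le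
        nlinarith
      linarith
    -- This is the residual from the telescoped dual steps. Its mean norm is at most (η/N)(2D + t),
    -- hence at most ε/3 + ε/2.
    refine ⟨fun ω => (s.η / N) • (S.y₀ - yN ω), ?_, fun ω => ?_, ?_⟩
    · have h1 : Integrable (fun ω => y - yN ω) ν :=
        (integrable_norm_iff (hym.const_sub y).aestronglyMeasurable).1 hdi
      have h2 : Integrable (fun ω => S.y₀ - y + (y - yN ω)) ν := (integrable_const _).add h1
      simp only [sub_add_sub_cancel] at h2
      exact h2.smul _
    · exact avgPrimal_residual_mem rfl hη _ hN
    · have hle : ∀ ω, ‖(s.η / N) • (S.y₀ - yN ω)‖ ≤ s.η / N * (D + ‖y - yN ω‖) := by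
        intro ω
        rw [norm_smul, Real.norm_of_nonneg (by positivity)]
        refine mul_le_mul_of_nonneg_left ?_ (by positivity)
        have : S.y₀ - yN ω = -(y - S.y₀) + (y - yN ω) := by abel
        rw [this]
        exact (norm_add_le _ _).trans (by rw [norm_neg])
      have hi' : Integrable (fun ω => s.η / N * (D + ‖y - yN ω‖)) ν :=
        ((integrable_const _).add hdi).const_mul _
      refine (integral_mono_of_nonneg (Filter.Eventually.of_forall fun ω => norm_nonneg _) hi'
        (Filter.Eventually.of_forall hle)).trans ?_
      rw [integral_const_mul, integral_add (integrable_const _) hdi]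
      simp only [integral_const, probReal_univ, one_smul]
      rw [div_mul_eq_mul_div, div_le_iff₀ hN0]
      have h1 := mul_le_mul_of_nonneg_left hE hη.le
      have h2 : s.η * t = N * ε / 2 := by rw [ht]; field_simp
      have : 0 < N * ε := mul_pos hN0 hε
      linarith

end Loop

end Stage

namespace Problem

variable {E₁ F₁ C₁ E₂ F₂ C₂ E₃ F₃ C₃ : Type*}
    [NormedAddCommGroup E₁] [NormedSpace ℝ E₁] [FiniteDimensional ℝ E₁]
    [MeasurableSpace E₁] [BorelSpace E₁]
    [NormedAddCommGroup F₁] [InnerProductSpace ℝ F₁] [FiniteDimensional ℝ F₁]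
    [MeasurableSpace F₁] [BorelSpace F₁] [MeasurableSpace C₁]
    [NormedAddCommGroup E₂] [NormedSpace ℝ E₂] [FiniteDimensional ℝ E₂]
    [MeasurableSpace E₂] [BorelSpace E₂]
    [NormedAddCommGroup F₂] [InnerProductSpace ℝ F₂] [FiniteDimensional ℝ F₂]
    [MeasurableSpace F₂] [BorelSpace F₂] [MeasurableSpace C₂]
    [NormedAddCommGroup E₃] [NormedSpace ℝ E₃] [FiniteDimensional ℝ E₃]
    [MeasurableSpace E₃] [BorelSpace E₃]
    [NormedAddCommGroup F₃] [InnerProductSpace ℝ F₃] [FiniteDimensional ℝ F₃]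
    [MeasurableSpace F₃] [BorelSpace F₃] [MeasurableSpace C₃]
    {P : Problem E₁ F₁ C₁ E₂ F₂ C₂ E₃ F₃ C₃}
    {y₂ : E₁ → Scenario E₁ E₂ F₂ C₂ → F₂} {y₃ : E₂ → Scenario E₂ E₃ F₃ C₃ → F₃}

/-! ### The outer loop -/

section Sampling

variable {Ω : Type*} [MeasurableSpace Ω] {ν : Measure Ω}
  {ξ : ℕ → Ω → Scenario E₁ E₂ F₂ C₂} {ζ : ℕ → ℕ → Ω → Scenario E₂ E₃ F₃ C₃}

theorem IsSampling.measurable (h : P.IsSampling ν ξ ζ) (i : ℕ) :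
    Measurable fun ω => (ξ i ω, fun j => ζ i j ω) :=
  (h.measurable_ξ i).prodMk (measurable_pi_lambda _ fun j => h.measurable_ζ i j)

theorem IsSampling.map_eq [IsMarkovKernel P.κ] [IsProbabilityMeasure P.μ]
    (h : P.IsSampling ν ξ ζ) (i : ℕ) :
    ν.map (fun ω => (ξ i ω, fun j => ζ i j ω)) = P.μ ⊗ₘ P.κInf := by
  ext T hT
  rw [Measure.map_apply (h.measurable i) hT, Measure.compProd_apply hT]
  exact h.law i T hT

theorem one_le_N₁ (ys : F₁) (ε M₂ : ℝ) : 1 ≤ P.N₁ ys ε M₂ := le_max_left _ _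

theorem le_N₁ (P : Problem E₁ F₁ C₁ E₂ F₂ C₂ E₃ F₃ C₃) (ys : F₁) (ε M₂ : ℝ) :
    max
      (6 * √2 * ‖P.A₁‖ * (2 * P.S₁.Ω ^ 2 + ‖P.S₁.y₀‖ ^ 2) / (√P.S₁.α * ε)
        + (24 * √3 * M₂ * P.S₁.Ω / (√P.S₁.α * ε)) ^ 2)
      (6 * ‖P.A₁‖ * (√(2 * P.S₁.α) * ‖ys - P.S₁.y₀‖ + 2 * P.S₁.Ω + 3 * √P.S₁.α)
          / (P.S₁.α * ε)
        + (6 * √3 * M₂ * (√2 * ‖P.A₁‖ + √P.S₁.α) / (P.S₁.α * ε)) ^ 2)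
      ≤ ((P.N₁ ys ε M₂ : ℕ) : ℝ) := by
  refine (Nat.le_ceil _).trans (Nat.cast_le.2 ?_)
  unfold N₁
  exact le_max_right _ _

/-- One sample of the outer loop is the whole block (ξ², (ξ³_j)_j), with law μ ⊗ₘ κInf. Blocks are
independent, so the abstract loop applies with bias ε/2. -/
theorem Assumptions.output_spec [IsProbabilityMeasure ν] (hP : P.Assumptions y₂ y₃) {xs : E₁}
    {ys : F₁} (hs : P.IsFirstStageSaddle xs ys) (hS : P.IsSampling ν ξ ζ) {ε M₃ M₂ : ℝ}
    (hε : 0 < ε) (h₃ : P.IsBound₃ y₃ ε M₃) (h₂ : P.IsBound₂ y₂ y₃ ε M₃ M₂) :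
    let xbar : Ω → E₁ := fun ω =>
      P.output y₂ y₃ ys ε M₃ M₂ (fun i => ξ i ω) (fun i j => ζ i j ω)
    (∀ ω, xbar ω ∈ P.S₁.X) ∧
      Integrable (fun ω => P.objective (xbar ω) - P.objective xs) ν ∧
      ∫ ω, (P.objective (xbar ω) - P.objective xs) ∂ν ≤ ε ∧
      ∃ δ : Ω → F₁, Integrable δ ν ∧
        (∀ᵐ ω ∂ν, P.A₁ (xbar ω) - P.b₁ - δ ω ∈ P.S₁.K) ∧
        ∫ ω, ‖δ ω‖ ∂ν ≤ ε := by
  haveI := hP.isMarkov_κ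
  haveI := hP.isProbability_μ
  intro xbar
  obtain ⟨hN₁, hN₂⟩ := max_le_iff.1 (P.le_N₁ ys ε M₂)
  have hN₂' := (le_add_of_nonneg_right (sq_nonneg _)).trans hN₂
  have hg : Measurable fun w : E₁ × (Scenario E₁ E₂ F₂ C₂ × (ℕ → Scenario E₂ E₃ F₃ C₃)) =>
    P.G₂ y₂ y₃ ε M₃ w.1 w.2.1 w.2.2 := hP.measurable_G₂ ε M₃
  have hgM : ∀ p ∈ P.S₁.X, ∫⁻ z, ‖P.G₂ y₂ y₃ ε M₃ p z.1 z.2‖ₑ ^ 2 ∂(P.μ ⊗ₘ P.κInf)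
    ≤ ENNReal.ofReal (M₂ ^ 2) := fun p hp => hP.lintegral_G₂_le h₂ hp
  have he : ∀ p ∈ P.S₁.X, ∫ z, P.G₂ y₂ y₃ ε M₃ p z.1 z.2 (xs - p) ∂(P.μ ⊗ₘ P.κInf)
    + P.v₂ p - P.v₂ xs ≤ ε / 2 := fun p hp => hP.v₂_subgradient hε h₃ h₂ hp hs.1
  have hm := hS.measurable
  have hl := hS.map_eq
  obtain ⟨h1, h2, δ, h3, h4, h5⟩ := Stage.IsValid.aggressive_loop (S := P.S₁) (A := P.A₁)
    (r := P.b₁) (c := P.c₁) (N := P.N₁ ys ε M₂) (M := M₂) (ε := ε) (v := P.v₂) (x := xs) (y := ys)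
    (W := Ω) (Z := Scenario E₁ E₂ F₂ C₂ × (ℕ → Scenario E₂ E₃ F₃ C₃)) (ν := ν)
    (ρ := P.μ ⊗ₘ P.κInf) (g := fun p z => P.G₂ y₂ y₃ ε M₃ p z.1 z.2)
    (z := fun i ω => (ξ i ω, fun j => ζ i j ω)) hP.valid₁ hP.nontrivial₁ hP.A₁_ne
    (P.one_le_N₁ ys ε M₂) hε h₂.1 hP.convexOn_v₂ h₂.2.1 hg hgM hs he hm hl hS.indep hN₁ hN₂'
  exact ⟨fun ω => hP.valid₁.avgPrimal_mem rfl _ (P.one_le_N₁ ys ε M₂), h1, h2, δ, h3,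
    Filter.Eventually.of_forall h4, h5⟩

end Sampling

end Problem

/-! ### Explicit constants -/

theorem natCast_max_ceil_le {X : ℝ} (hX : 0 ≤ X) : ((max 1 ⌈X⌉₊ : ℕ) : ℝ) ≤ X + 1 := by
  rw [Nat.cast_max, Nat.cast_one]
  exact max_le (by linarith) (Nat.ceil_lt_add_one hX).le

theorem rpow_two_thirds_le {T : ℝ} (hT : 0 ≤ T) : T ^ (2 / 3 : ℝ) ≤ 1 + T ^ 2 := by
  rcases le_total T 1 with h | h
  · linarith [Real.rpow_le_one hT h (by norm_num : (0 : ℝ) ≤ 2 / 3), sq_nonneg T]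
  · have := Real.rpow_le_rpow_of_exponent_le h (by norm_num : (2 / 3 : ℝ) ≤ (2 : ℕ))
    rw [Real.rpow_natCast] at this
    linarith

/-- The exponent 2/3 is harmless: T^{2/3} ≤ 1 + T², so both summands are O(ε⁻²), and rounding costs
only a constant when ε ≤ 1. -/
theorem max_ceil_mul_sq_le {ε p q P Q : ℝ} (hε : 0 < ε) (hε1 : ε ≤ 1) (hp : 0 ≤ p) (hpP : p ≤ P)
    (hq : 0 ≤ q) (hqQ : q ≤ Q) :
    ((max 1 ⌈(p / ε) ^ (2 / 3 : ℝ) + (q / ε) ^ 2⌉₊ : ℕ) : ℝ) * ε ^ 2 ≤ 2 + P ^ 2 + Q ^ 2 := by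
  have h1 := natCast_max_ceil_le (X := (p / ε) ^ (2 / 3 : ℝ) + (q / ε) ^ 2) (by positivity)
  have h2 := rpow_two_thirds_le (T := p / ε) (by positivity)
  have h3 : ε ^ 2 ≤ 1 := pow_le_one₀ hε.le hε1
  calc _ ≤ (2 + (p / ε) ^ 2 + (q / ε) ^ 2) * ε ^ 2 := by gcongr; linarith
    _ = 2 * ε ^ 2 + p ^ 2 + q ^ 2 := by field_simp
    _ ≤ _ := by
      have := pow_le_pow_left₀ hp hpP 2
      have := pow_le_pow_left₀ hq hqQ 2
      linarith

theorem max_ceil_max_mul_sq_le {ε p q p' q' : ℝ} (hε : 0 < ε) (hε1 : ε ≤ 1) (hp : 0 ≤ p)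
    (hp' : 0 ≤ p') :
    ((max 1 ⌈max (p / ε + (q / ε) ^ 2) (p' / ε + (q' / ε) ^ 2)⌉₊ : ℕ) : ℝ) * ε ^ 2
      ≤ 1 + p + q ^ 2 + p' + q' ^ 2 := by
  have h0 : 0 ≤ p / ε + (q / ε) ^ 2 := by positivity
  have h0' : 0 ≤ p' / ε + (q' / ε) ^ 2 := by positivity
  have h1 := natCast_max_ceil_le (X := max (p / ε + (q / ε) ^ 2) (p' / ε + (q' / ε) ^ 2))
    (le_max_of_le_left h0)
  have h2 := max_le_add_of_nonneg h0 h0'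
  have h3 : ε ^ 2 ≤ 1 := pow_le_one₀ hε.le hε1
  calc _ ≤ (p / ε + (q / ε) ^ 2 + (p' / ε + (q' / ε) ^ 2) + 1) * ε ^ 2 := by gcongr; linarith
    _ = p * ε + q ^ 2 + p' * ε + q' ^ 2 + ε ^ 2 := by field_simp; ring
    _ ≤ _ := by
      have := mul_le_of_le_one_right hp hε1
      have := mul_le_of_le_one_right hp' hε1
      linarith

/-! ### Bounds for averaged dual points that are uniform in ε -/

namespace Stage

variable {E F C : Type*} [NormedAddCommGroup E] [NormedSpace ℝ E] [FiniteDimensional ℝ E]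
    [MeasurableSpace E] [NormedAddCommGroup F] [InnerProductSpace ℝ F]
    [FiniteDimensional ℝ F] [MeasurableSpace F] [MeasurableSpace C] {S : Stage E F C}

/-- The average dual point of a loop run with exact first-order information and aggressive step
sizes stays close to an optimal dual solution. -/
theorem IsValid.norm_avgDual_aggressive_le (hS : S.IsValid) {A : E →L[ℝ] F} (hA : A ≠ 0) {r : F}
    {c : C} {N : ℕ} (hN : 1 ≤ N) {x : E} {y : F} (h : S.IsSaddle A r c 0 x y) {D : ℝ}
    (hy : ‖y‖ ≤ D) :
    ‖S.avgDual A r c (S.aggressive N 0 ‖A‖) (fun _ _ => 0) N‖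
      ≤ D + √(2 * S.Ω ^ 2 + (D + ‖S.y₀‖) ^ 2) := by
  have ha : 0 < ‖A‖ := norm_pos_iff.2 hA
  have hη := aggressive_η_pos (N := N) (M := 0) hS.α_pos ha
  -- Since τ = η, the step size cancels from the distance bound, which therefore does not involve A,
  -- N or ε.
  have hτ : (S.aggressive N 0 ‖A‖).τ = (S.aggressive N 0 ‖A‖).η := by
    simp only [aggressive, zero_mul, zero_div]
    exact max_eq_right (by positivity)
  have hk : ∀ k, ‖(S.iter A r c (S.aggressive N 0 ‖A‖) (fun _ _ => 0) k).2.1‖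
      ≤ D + √(2 * S.Ω ^ 2 + (D + ‖S.y₀‖) ^ 2) := by
    intro k
    have h1 := hS.norm_dual_sub_sq_le (M := 0) (s := S.aggressive N 0 ‖A‖) rfl
      (aggressive_τ_pos hS.α_pos ha) hη (aggressive_le hS.α_pos ha) (by simp) (fun _ _ => 0) k h
    simp only [noise, norm_zero, add_zero, ne_eq, OfNat.ofNat_ne_zero,
      not_false_eq_true, zero_pow, zero_div, _root_.zero_apply, Pi.zero_apply, sub_self,
      Finset.sum_const_zero, hτ] at h1
    have h2 : ‖y - (S.iter A r c (S.aggressive N 0 ‖A‖) (fun _ _ => 0) k).2.1‖ ^ 2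
        ≤ 2 * S.Ω ^ 2 + ‖y - S.y₀‖ ^ 2 := by
      refine le_of_mul_le_mul_left ?_ (half_pos hη)
      linarith
    have h3 : ‖y - S.y₀‖ ≤ D + ‖S.y₀‖ := (norm_sub_le _ _).trans (add_le_add_left hy _)
    have h4 := Real.le_sqrt_of_sq_le (h2.trans (add_le_add_right
      (pow_le_pow_left₀ (norm_nonneg _) h3 2) _))
    have h5 := norm_sub_le y (y - (S.iter A r c (S.aggressive N 0 ‖A‖) (fun _ _ => 0) k).2.1)
    rw [sub_sub_cancel] at h5
    linarith
  have hN0 : (0 : ℝ) < N := by positivity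
  rw [avgDual_eq rfl, norm_smul, norm_inv, Real.norm_natCast, inv_mul_le_iff₀ hN0]
  refine (norm_sum_le _ _).trans ((Finset.sum_le_sum fun k _ => hk (k + 1)).trans ?_)
  rw [Finset.sum_const, Finset.card_range, nsmul_eq_mul]

/-- Since η is proportional to a√N, division by η leaves the terms Ω²/N, MΩ/a and √α √N ε/a up to
constants. The last is bounded because Nε² ≤ c gives √N ε ≤ 1 + c. -/
theorem conservative_dual_budget {N : ℕ} {M a ε D c : ℝ} (hα : 0 < S.α) (hΩ : 0 < S.Ω) (ha : 0 < a)
    (haD : a⁻¹ ≤ D) (hM : 0 ≤ M) (hε : 0 < ε) (hN : 1 ≤ N) (hc : N * ε ^ 2 ≤ c) :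
    2 / (S.conservative N M a).η * ((S.conservative N M a).τ * S.Ω ^ 2
        + N * (4 * M ^ 2 / ((S.conservative N M a).τ * S.α) + ε / 6))
      ≤ 2 * S.Ω ^ 2 + 8 * √3 * M * S.Ω * D + √S.α * D * (1 + c) := by
  have hq : 0 < √S.α := Real.sqrt_pos.2 hα
  have hN1 : (1 : ℝ) ≤ N := by exact_mod_cast hN
  have hN0 : (0 : ℝ) < N := by positivity
  have hn : 0 < √(N : ℝ) := Real.sqrt_pos.2 hN0
  have hn2 : √(N : ℝ) ^ 2 = N := Real.sq_sqrt hN0.le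
  have h2 : (1 : ℝ) ≤ √2 := by rw [Real.one_le_sqrt]; norm_num
  have hbud := max_stepSize_budget hα hΩ hM (b := √2 * a / √(S.α * N)) (by positivity) hN
  have hη : (S.conservative N M a).η = √2 * √N * a / √S.α := by
    simp only [conservative]
    rw [Real.sqrt_mul (by norm_num : (0 : ℝ) ≤ 2)]
  have hs : √(S.α * N) = √S.α * √N := Real.sqrt_mul hα.le _
  change max _ _ * _ + _ ≤ _ at hbud
  have hτ : (S.conservative N M a).τ
    = max (M * √(3 * N) / (S.Ω * √S.α)) (√2 * a / √(S.α * N)) := rfl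
  rw [← hτ, hs] at hbud
  have hD : 0 < D := (inv_pos.2 ha).trans_le haD
  have hεn : √N * ε ≤ 1 + c := by
    have e : (√N * ε) ^ 2 = N * ε ^ 2 := by rw [mul_pow, hn2]
    nlinarith [sq_nonneg (√N * ε - 1)]
  rw [mul_add (N : ℝ), ← add_assoc]
  refine (mul_le_mul_of_nonneg_left (add_le_add_left hbud _) (by rw [hη]; positivity)).trans ?_
  have e : 2 / (S.conservative N M a).η * (√2 * a / (√S.α * √N) * S.Ω ^ 2
      + 4 * √3 * M * S.Ω * √N / √S.α + N * (ε / 6))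
      = 2 * S.Ω ^ 2 * (√N ^ 2)⁻¹ + 8 * √3 * M * S.Ω * a⁻¹ * (√2)⁻¹
        + √S.α * a⁻¹ * (√N * ε) * ((√2)⁻¹ / 3) := by
    rw [hη]
    clear hbud hτ hs hη hεn
    generalize √(N : ℝ) = n at *
    rw [← hn2]
    field_simp
    ring
  rw [e, hn2]
  have i1 : (N : ℝ)⁻¹ ≤ 1 := inv_le_one_of_one_le₀ hN1
  have i2 : (√2)⁻¹ ≤ 1 := inv_le_one_of_one_le₀ h2
  have i3 : (√2)⁻¹ / 3 ≤ 1 := by linarith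
  have t1 : 2 * S.Ω ^ 2 * (N : ℝ)⁻¹ ≤ 2 * S.Ω ^ 2 := mul_le_of_le_one_right (by positivity) i1
  have t2 : 8 * √3 * M * S.Ω * a⁻¹ * (√2)⁻¹ ≤ 8 * √3 * M * S.Ω * D :=
    (mul_le_of_le_one_right (by positivity) i2).trans (by gcongr)
  have t3 : √S.α * a⁻¹ * (√N * ε) * ((√2)⁻¹ / 3) ≤ √S.α * D * (1 + c) :=
    (mul_le_of_le_one_right (by positivity) i3).trans (by gcongr)
  linarith

end Stage

namespace Problem

variable {E₁ F₁ C₁ E₂ F₂ C₂ E₃ F₃ C₃ : Type*}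
    [NormedAddCommGroup E₁] [NormedSpace ℝ E₁] [FiniteDimensional ℝ E₁]
    [MeasurableSpace E₁] [BorelSpace E₁]
    [NormedAddCommGroup F₁] [InnerProductSpace ℝ F₁] [FiniteDimensional ℝ F₁]
    [MeasurableSpace F₁] [BorelSpace F₁] [MeasurableSpace C₁]
    [NormedAddCommGroup E₂] [NormedSpace ℝ E₂] [FiniteDimensional ℝ E₂]
    [MeasurableSpace E₂] [BorelSpace E₂]
    [NormedAddCommGroup F₂] [InnerProductSpace ℝ F₂] [FiniteDimensional ℝ F₂]
    [MeasurableSpace F₂] [BorelSpace F₂] [MeasurableSpace C₂]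
    [NormedAddCommGroup E₃] [NormedSpace ℝ E₃] [FiniteDimensional ℝ E₃]
    [MeasurableSpace E₃] [BorelSpace E₃]
    [NormedAddCommGroup F₃] [InnerProductSpace ℝ F₃] [FiniteDimensional ℝ F₃]
    [MeasurableSpace F₃] [BorelSpace F₃] [MeasurableSpace C₃]
    {P : Problem E₁ F₁ C₁ E₂ F₂ C₂ E₃ F₃ C₃}
    {y₂ : E₁ → Scenario E₁ E₂ F₂ C₂ → F₂} {y₃ : E₂ → Scenario E₂ E₃ F₃ C₃ → F₃}

theorem norm_innerSL_comp_le {E F : Type*} [NormedAddCommGroup E] [NormedSpace ℝ E]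
    [NormedAddCommGroup F] [InnerProductSpace ℝ F] (y : F) (B : E →L[ℝ] F) :
    ‖(innerSL ℝ y).comp B‖ ≤ ‖y‖ * ‖B‖ :=
  (ContinuousLinearMap.opNorm_comp_le _ _).trans_eq (by rw [innerSL_apply_norm])

/-! ### Constants for bounded data -/

/-- A bound for the dual points returned by the innermost loop when the data are bounded. -/
noncomputable def dualBound₃ (P : Problem E₁ F₁ C₁ E₂ F₂ C₂ E₃ F₃ C₃) (D : ℝ) : ℝ :=
  D + √(2 * P.S₃.Ω ^ 2 + (D + ‖P.S₃.y₀‖) ^ 2)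

theorem le_dualBound₃ (P : Problem E₁ F₁ C₁ E₂ F₂ C₂ E₃ F₃ C₃) (D : ℝ) : D ≤ P.dualBound₃ D :=
  le_add_of_nonneg_right (Real.sqrt_nonneg _)

/-- The innermost loop has uniformly bounded stochastic subgradients when the data are bounded. -/
theorem Bounded.isBound₃ {D : ℝ} (hB : P.Bounded y₂ y₃ D) (hP : P.Assumptions y₂ y₃) (ε : ℝ) :
    P.IsBound₃ y₃ ε (P.dualBound₃ D * D) := by
  haveI := hP.isMarkov_κ
  have hD := hB.pos
  have hR := P.le_dualBound₃ D
  have hM : 0 ≤ P.dualBound₃ D * D := mul_nonneg (hD.le.trans hR) hD.le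
  refine ⟨hM, ?_⟩
  filter_upwards [hP.A₃_ne, hP.saddle₃, hP.integrable_V₃, hP.V₃_subgradient, hB.norm_B₃_le,
    hB.norm_y₃_le] with ξ₂ hA hs hi hsub hBn hyn
  constructor
  · intro x hx x' hx'
    refine abs_integral_sub_le_of_subgradient hi hsub (fun u hu => ?_) hx hx'
    filter_upwards [hBn, hyn u hu] with ξ hBn hyn
    exact (norm_innerSL_comp_le _ _).trans
      (mul_le_mul (hyn.trans hR) hBn (norm_nonneg _) (hD.le.trans hR))
  · intro x hx
    have hle : ∀ᵐ ξ ∂P.κ ξ₂, ‖P.G₃ y₃ ε x ξ‖ₑ ^ 2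
        ≤ ENNReal.ofReal ((P.dualBound₃ D * D) ^ 2) := by
      filter_upwards [hA, hs x hx, hBn, hyn x hx] with ξ hA ⟨a, ha⟩ hBn hyn
      rw [ENNReal.ofReal_pow hM, ← ofReal_norm]
      gcongr
      refine (norm_innerSL_comp_le _ _).trans ?_
      exact mul_le_mul (hP.valid₃.norm_avgDual_aggressive_le hA (P.one_le_N₃ y₃ ε x ξ) ha hyn)
        hBn (norm_nonneg _) (by linarith)
    refine (lintegral_mono_ae hle).trans ?_
    simp

end Problem

namespace Problem

variable {E₁ F₁ C₁ E₂ F₂ C₂ E₃ F₃ C₃ : Type*}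
    [NormedAddCommGroup E₁] [NormedSpace ℝ E₁] [FiniteDimensional ℝ E₁]
    [MeasurableSpace E₁] [BorelSpace E₁]
    [NormedAddCommGroup F₁] [InnerProductSpace ℝ F₁] [FiniteDimensional ℝ F₁]
    [MeasurableSpace F₁] [BorelSpace F₁] [MeasurableSpace C₁]
    [NormedAddCommGroup E₂] [NormedSpace ℝ E₂] [FiniteDimensional ℝ E₂]
    [MeasurableSpace E₂] [BorelSpace E₂]
    [NormedAddCommGroup F₂] [InnerProductSpace ℝ F₂] [FiniteDimensional ℝ F₂]
    [MeasurableSpace F₂] [BorelSpace F₂] [MeasurableSpace C₂]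
    [NormedAddCommGroup E₃] [NormedSpace ℝ E₃] [FiniteDimensional ℝ E₃]
    [MeasurableSpace E₃] [BorelSpace E₃]
    [NormedAddCommGroup F₃] [InnerProductSpace ℝ F₃] [FiniteDimensional ℝ F₃]
    [MeasurableSpace F₃] [BorelSpace F₃] [MeasurableSpace C₃]
    {P : Problem E₁ F₁ C₁ E₂ F₂ C₂ E₃ F₃ C₃}
    {y₂ : E₁ → Scenario E₁ E₂ F₂ C₂ → F₂} {y₃ : E₂ → Scenario E₂ E₃ F₃ C₃ → F₃}

theorem norm_inv_smul_sum_sq_le {F : Type*} [NormedAddCommGroup F] [NormedSpace ℝ F] {N : ℕ}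
    (hN : 1 ≤ N) (f : ℕ → F) :
    ‖(N : ℝ)⁻¹ • ∑ k ∈ Finset.range N, f k‖ ^ 2
      ≤ (N : ℝ)⁻¹ * ∑ k ∈ Finset.range N, ‖f k‖ ^ 2 := by
  have hN0 : (0 : ℝ) < N := by positivity
  have h1 := norm_sum_le (Finset.range N) f
  have h2 := sq_sum_le_card_mul_sum_sq (s := Finset.range N) (f := fun k => ‖f k‖)
  rw [Finset.card_range] at h2
  rw [norm_smul, norm_inv, Real.norm_natCast, mul_pow]
  have h3 := (pow_le_pow_left₀ (norm_nonneg _) h1 2).trans h2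
  calc _ ≤ ((N : ℝ)⁻¹) ^ 2 * (N * ∑ k ∈ Finset.range N, ‖f k‖ ^ 2) := by gcongr
    _ = _ := by field_simp

/-- A bound for the number of steps of the middle loop, multiplied by `ε ^ 2`. -/
noncomputable def stepBound₂ (P : Problem E₁ F₁ C₁ E₂ F₂ C₂ E₃ F₃ C₃) (D M₃ : ℝ) : ℝ :=
  2 + (12 * √2 * D * P.S₂.Ω ^ 2 / √P.S₂.α) ^ 2
    + (6 * (D * (D + ‖P.S₂.y₀‖) ^ 2 + 4 * √3 * M₃ * P.S₂.Ω) / √P.S₂.α) ^ 2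

theorem N₂_mul_sq_le {ε D M₃ : ℝ} (hε : 0 < ε)
    (hε1 : ε ≤ 1) (hM : 0 ≤ M₃) {u : E₁} {ξ₂ : Scenario E₁ E₂ F₂ C₂} (hA : ‖ξ₂.A‖ ≤ D)
    (hy : ‖y₂ u ξ₂‖ ≤ D) : (P.N₂ y₂ ε M₃ u ξ₂ : ℝ) * ε ^ 2 ≤ P.stepBound₂ D M₃ := by
  have hΩ := P.S₂.Ω_nonneg
  have hD : 0 ≤ D := (norm_nonneg _).trans hA
  have hy' : ‖y₂ u ξ₂ - P.S₂.y₀‖ ≤ D + ‖P.S₂.y₀‖ :=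
    (norm_sub_le _ _).trans (add_le_add_left hy _)
  unfold N₂
  rw [← div_div, ← div_div]
  exact max_ceil_mul_sq_le hε hε1 (by positivity) (by gcongr) (by positivity) (by gcongr)

/-- A bound for the expected squared distance of the dual iterates of the middle loop to an optimal
dual solution. -/
noncomputable def dualSqBound₂ (P : Problem E₁ F₁ C₁ E₂ F₂ C₂ E₃ F₃ C₃) (D M₃ : ℝ) : ℝ :=
  (D + ‖P.S₂.y₀‖) ^ 2 + (2 * P.S₂.Ω ^ 2 + 8 * √3 * M₃ * P.S₂.Ω * D
    + √P.S₂.α * D * (1 + P.stepBound₂ D M₃))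

theorem dualSqBound₂_nonneg {D M₃ : ℝ} (hD : 0 ≤ D) (hM : 0 ≤ M₃) : 0 ≤ P.dualSqBound₂ D M₃ := by
  have hΩ := P.S₂.Ω_nonneg
  unfold dualSqBound₂ stepBound₂
  positivity

theorem Assumptions.lintegral_ybar₂_le (hP : P.Assumptions y₂ y₃) {ε D M₃ : ℝ} (hε : 0 < ε)
    (hε1 : ε ≤ 1) (hM : 0 ≤ M₃) {ξ₂ : Scenario E₁ E₂ F₂ C₂} (hR : P.Regular y₃ ε M₃ ξ₂) {u : E₁}
    {x : E₂} (hs : P.S₂.IsSaddle ξ₂.A (ξ₂.rhs u) ξ₂.c (P.v₃ ξ₂) x (y₂ u ξ₂))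
    (hA : ‖ξ₂.A‖ ≤ D) (hA' : D⁻¹ ≤ ‖ξ₂.A‖) (hy : ‖y₂ u ξ₂‖ ≤ D) :
    ∫⁻ ζ, ENNReal.ofReal (‖P.ybar₂ y₂ y₃ ε M₃ u ξ₂ ζ‖ ^ 2)
        ∂(Measure.infinitePi fun _ : ℕ => P.κ ξ₂)
      ≤ ENNReal.ofReal (2 * D ^ 2 + 2 * P.dualSqBound₂ D M₃) := by
  haveI := hP.isMarkov_κ
  have hα := hP.valid₂.α_pos
  have hΩ := hP.valid₂.Ω_pos hP.nontrivial₂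
  have ha : 0 < ‖ξ₂.A‖ := norm_pos_iff.2 hR.A_ne
  have hD : 0 < D := ha.trans_le hA
  have hN := P.one_le_N₂ y₂ ε M₃ u ξ₂
  have hc := N₂_mul_sq_le (P := P) (y₂ := y₂) hε hε1 hM hA hy
  have hbud := Stage.conservative_dual_budget hα hΩ ha (inv_le_of_inv_le₀ hD hA') hM hε hN hc
  have hτ := Stage.conservative_τ_pos (S := P.S₂) (M := M₃) hα ha hN
  have hη := Stage.conservative_η_pos (S := P.S₂) (M := M₃) hα ha hN
  have hsA := Stage.conservative_le (S := P.S₂) (M := M₃) hα ha hN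
  change 2 / (P.middleSteps y₂ ε M₃ u ξ₂).η * ((P.middleSteps y₂ ε M₃ u ξ₂).τ * _
    + _ * (_ / ((P.middleSteps y₂ ε M₃ u ξ₂).τ * _) + _)) ≤ _ at hbud
  change 0 < (P.middleSteps y₂ ε M₃ u ξ₂).τ at hτ
  change 0 < (P.middleSteps y₂ ε M₃ u ξ₂).η at hη
  change _ ≤ (P.middleSteps y₂ ε M₃ u ξ₂).τ * _ * (P.middleSteps y₂ ε M₃ u ξ₂).η at hsA
  have hnoise := hP.integral_middleNoise_le hM hR u hs.1
  set s := P.middleSteps y₂ ε M₃ u ξ₂ with hsdef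
  set N := P.N₂ y₂ ε M₃ u ξ₂ with hNdef
  set ρ := Measure.infinitePi fun _ : ℕ => P.κ ξ₂ with hρ
  have hN0 : (0 : ℝ) < N := by positivity
  have hy0 : ‖y₂ u ξ₂ - P.S₂.y₀‖ ^ 2 ≤ (D + ‖P.S₂.y₀‖) ^ 2 :=
    pow_le_pow_left₀ (norm_nonneg _) ((norm_sub_le _ _).trans (add_le_add_left hy _)) 2
  -- The dual estimate relative to y², followed by ‖w‖² ≤ 2D² + 2‖y² - w‖².
  have hdist : ∀ k ζ, ‖(P.middleIter y₂ y₃ ε M₃ u ξ₂ ζ k).2.1‖ ^ 2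
      ≤ 2 * D ^ 2 + 2 * (2 / s.η * (s.τ * P.S₂.Ω ^ 2 + P.middleNoise y₂ y₃ ε M₃ u ξ₂ x k ζ)
        + (D + ‖P.S₂.y₀‖) ^ 2) := by
    intro k ζ
    have h1 := hP.valid₂.norm_dual_sub_sq_le (s := s) (M := M₃) rfl hτ hη hsA hR.lipschitz
      (fun j x => P.G₃ y₃ ε x (ζ j)) k hs
    change s.η / 2 * ‖y₂ u ξ₂ - (P.middleIter y₂ y₃ ε M₃ u ξ₂ ζ k).2.1‖ ^ 2
      ≤ _ + P.middleNoise y₂ y₃ ε M₃ u ξ₂ x k ζ at h1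
    set w := (P.middleIter y₂ y₃ ε M₃ u ξ₂ ζ k).2.1
    have h2 : ‖y₂ u ξ₂ - w‖ ^ 2 ≤ 2 / s.η * (s.τ * P.S₂.Ω ^ 2
        + P.middleNoise y₂ y₃ ε M₃ u ξ₂ x k ζ) + ‖y₂ u ξ₂ - P.S₂.y₀‖ ^ 2 := by
      refine le_of_mul_le_mul_left (h1.trans_eq ?_) (half_pos hη)
      field_simp
      ring
    have h3 : ‖w‖ ≤ D + ‖y₂ u ξ₂ - w‖ := by
      have := norm_sub_le (y₂ u ξ₂) (y₂ u ξ₂ - w)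
      rw [sub_sub_cancel] at this
      linarith
    have h4 := pow_le_pow_left₀ (norm_nonneg _) h3 2
    nlinarith [sq_nonneg (D - ‖y₂ u ξ₂ - w‖)]
  set W : (ℕ → Scenario E₂ E₃ F₃ C₃) → ℝ := fun ζ => (N : ℝ)⁻¹ * ∑ k ∈ Finset.range N,
    (2 * D ^ 2 + 2 * (2 / s.η * (s.τ * P.S₂.Ω ^ 2
      + P.middleNoise y₂ y₃ ε M₃ u ξ₂ x (k + 1) ζ) + (D + ‖P.S₂.y₀‖) ^ 2)) with hW
  have hdom : ∀ ζ, ‖P.ybar₂ y₂ y₃ ε M₃ u ξ₂ ζ‖ ^ 2 ≤ W ζ := by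
    intro ζ
    have h1 : P.ybar₂ y₂ y₃ ε M₃ u ξ₂ ζ
        = (N : ℝ)⁻¹ • ∑ k ∈ Finset.range N, (P.middleIter y₂ y₃ ε M₃ u ξ₂ ζ (k + 1)).2.1 :=
      Stage.avgDual_eq rfl _ _
    rw [h1]
    refine (norm_inv_smul_sum_sq_le hN _).trans ?_
    exact mul_le_mul_of_nonneg_left (Finset.sum_le_sum fun k _ => hdist (k + 1) ζ)
      (by positivity)
  have hterm : ∀ k, Integrable (fun ζ => 2 * D ^ 2 + 2 * (2 / s.η * (s.τ * P.S₂.Ω ^ 2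
      + P.middleNoise y₂ y₃ ε M₃ u ξ₂ x (k + 1) ζ) + (D + ‖P.S₂.y₀‖) ^ 2)) ρ := fun k =>
    (integrable_const _).add ((((((integrable_const _).add (hnoise (k + 1)).1)).const_mul _).add
      (integrable_const _)).const_mul _)
  have hWi : Integrable W ρ := (integrable_finsetSum _ fun k _ => hterm k).const_mul _
  have hWle : ∫ ζ, W ζ ∂ρ ≤ 2 * D ^ 2 + 2 * P.dualSqBound₂ D M₃ := by
    rw [hW, integral_const_mul, integral_finsetSum _ fun k _ => hterm k, inv_mul_le_iff₀ hN0]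
    have hk : ∀ k ∈ Finset.range N, ∫ ζ, (2 * D ^ 2 + 2 * (2 / s.η * (s.τ * P.S₂.Ω ^ 2
        + P.middleNoise y₂ y₃ ε M₃ u ξ₂ x (k + 1) ζ) + (D + ‖P.S₂.y₀‖) ^ 2)) ∂ρ
        ≤ 2 * D ^ 2 + 2 * P.dualSqBound₂ D M₃ := by
      intro k hk
      have hi := (hnoise (k + 1)).1
      have hi1 : Integrable (fun ζ => s.τ * P.S₂.Ω ^ 2
        + P.middleNoise y₂ y₃ ε M₃ u ξ₂ x (k + 1) ζ) ρ := (integrable_const _).add hi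
      have hi2 : Integrable (fun ζ => 2 / s.η * (s.τ * P.S₂.Ω ^ 2
        + P.middleNoise y₂ y₃ ε M₃ u ξ₂ x (k + 1) ζ) + (D + ‖P.S₂.y₀‖) ^ 2) ρ :=
        (hi1.const_mul _).add (integrable_const _)
      rw [integral_add (integrable_const _) (hi2.const_mul _), integral_const, probReal_univ,
        one_smul, integral_const_mul, integral_add (hi1.const_mul _) (integrable_const _),
        integral_const_mul, integral_add (integrable_const _) hi, integral_const, integral_const,
        probReal_univ, one_smul, one_smul]
      have hkN : ((k + 1 : ℕ) : ℝ) ≤ N := by exact_mod_cast Finset.mem_range.1 hk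
      have h1 : ∫ ζ, P.middleNoise y₂ y₃ ε M₃ u ξ₂ x (k + 1) ζ ∂ρ
          ≤ N * (4 * M₃ ^ 2 / (s.τ * P.S₂.α) + ε / 6) :=
        -- Every averaged iterate has index at most N, so the budget of the full loop dominates its
        -- mean noise.
        (hnoise (k + 1)).2.trans (mul_le_mul_of_nonneg_right hkN (by positivity))
      have h2 := mul_le_mul_of_nonneg_left (add_le_add_right h1 (s.τ * P.S₂.Ω ^ 2))
        (show 0 ≤ 2 / s.η by positivity)
      have h3 := h2.trans hbud
      unfold dualSqBound₂
      linarith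
    refine (Finset.sum_le_sum hk).trans ?_
    rw [Finset.sum_const, Finset.card_range, nsmul_eq_mul]
  refine (lintegral_mono fun ζ => ENNReal.ofReal_le_ofReal (hdom ζ)).trans ?_
  rw [← ofReal_integral_eq_lintegral_ofReal hWi
    (Filter.Eventually.of_forall fun ζ => (sq_nonneg _).trans (hdom ζ))]
  exact ENNReal.ofReal_le_ofReal hWle

/-- The constant `M₂` for bounded data. -/
noncomputable def subgradBound₂ (P : Problem E₁ F₁ C₁ E₂ F₂ C₂ E₃ F₃ C₃) (D M₃ : ℝ) : ℝ :=
  √(2 * D ^ 2 + 2 * P.dualSqBound₂ D M₃) * D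

theorem Bounded.isBound₂ {D : ℝ} (hB : P.Bounded y₂ y₃ D) (hP : P.Assumptions y₂ y₃) {ε M₃ : ℝ}
    (hε : 0 < ε) (hε1 : ε ≤ 1) (hb₃ : P.IsBound₃ y₃ ε M₃) :
    P.IsBound₂ y₂ y₃ ε M₃ (P.subgradBound₂ D M₃) := by
  haveI := hP.isMarkov_κ
  haveI := hP.isProbability_μ
  have hD := hB.pos
  have hS : 0 ≤ P.dualSqBound₂ D M₃ := dualSqBound₂_nonneg hD.le hb₃.1
  have hR : D ≤ √(2 * D ^ 2 + 2 * P.dualSqBound₂ D M₃) :=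
    Real.le_sqrt_of_sq_le (by linarith [sq_nonneg D])
  have hM : 0 ≤ P.subgradBound₂ D M₃ := mul_nonneg (Real.sqrt_nonneg _) hD.le
  refine ⟨hM, fun x hx x' hx' => ?_, fun x hx => ?_⟩
  · refine abs_integral_sub_le_of_subgradient hP.integrable_V₂ hP.V₂_subgradient
      (fun u hu => ?_) hx hx'
    filter_upwards [hB.norm_B₂_le, hB.norm_y₂_le u hu] with ξ hBn hyn
    exact (norm_innerSL_comp_le _ _).trans
      (mul_le_mul (hyn.trans hR) hBn (norm_nonneg _) (hD.le.trans hR))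
  · have hle : ∀ᵐ ξ₂ ∂P.μ, ∫⁻ ζ, ‖P.G₂ y₂ y₃ ε M₃ x ξ₂ ζ‖ₑ ^ 2
        ∂(Measure.infinitePi fun _ : ℕ => P.κ ξ₂)
        ≤ ENNReal.ofReal ((P.subgradBound₂ D M₃) ^ 2) := by
      filter_upwards [hP.ae_regular hε hb₃, hP.saddle₂ x hx, hB.norm_A₂_le, hB.le_norm_A₂,
        hB.norm_y₂_le x hx, hB.norm_B₂_le] with ξ₂ hReg ⟨a, ha⟩ hA hA' hy hBn
      have h1 := hP.lintegral_ybar₂_le hε hε1 hb₃.1 hReg ha hA hA' hy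
      have h2 : ∀ ζ, ‖P.G₂ y₂ y₃ ε M₃ x ξ₂ ζ‖ₑ ^ 2
          ≤ ENNReal.ofReal (D ^ 2) * ENNReal.ofReal (‖P.ybar₂ y₂ y₃ ε M₃ x ξ₂ ζ‖ ^ 2) := by
        intro ζ
        rw [← ENNReal.ofReal_mul (sq_nonneg D), ← mul_pow, ← ofReal_norm,
          ← ENNReal.ofReal_pow (norm_nonneg _)]
        refine ENNReal.ofReal_le_ofReal (pow_le_pow_left₀ (norm_nonneg _) ?_ 2)
        refine (norm_innerSL_comp_le _ _).trans ?_
        rw [mul_comm]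
        exact mul_le_mul_of_nonneg_right hBn (norm_nonneg _)
      refine (lintegral_mono h2).trans ?_
      rw [lintegral_const_mul' _ _ ENNReal.ofReal_ne_top]
      refine (mul_le_mul_right h1 _).trans_eq ?_
      rw [← ENNReal.ofReal_mul (sq_nonneg D), subgradBound₂, mul_pow,
        Real.sq_sqrt (by positivity), mul_comm]
    refine (lintegral_mono_ae hle).trans ?_
    simp

end Problem

namespace Problem

variable {E₁ F₁ C₁ E₂ F₂ C₂ E₃ F₃ C₃ : Type*}
    [NormedAddCommGroup E₁] [NormedSpace ℝ E₁] [FiniteDimensional ℝ E₁]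
    [MeasurableSpace E₁] [BorelSpace E₁]
    [NormedAddCommGroup F₁] [InnerProductSpace ℝ F₁] [FiniteDimensional ℝ F₁]
    [MeasurableSpace F₁] [BorelSpace F₁] [MeasurableSpace C₁]
    [NormedAddCommGroup E₂] [NormedSpace ℝ E₂] [FiniteDimensional ℝ E₂]
    [MeasurableSpace E₂] [BorelSpace E₂]
    [NormedAddCommGroup F₂] [InnerProductSpace ℝ F₂] [FiniteDimensional ℝ F₂]
    [MeasurableSpace F₂] [BorelSpace F₂] [MeasurableSpace C₂]
    [NormedAddCommGroup E₃] [NormedSpace ℝ E₃] [FiniteDimensional ℝ E₃]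
    [MeasurableSpace E₃] [BorelSpace E₃]
    [NormedAddCommGroup F₃] [InnerProductSpace ℝ F₃] [FiniteDimensional ℝ F₃]
    [MeasurableSpace F₃] [BorelSpace F₃] [MeasurableSpace C₃]
    {P : Problem E₁ F₁ C₁ E₂ F₂ C₂ E₃ F₃ C₃}
    {y₂ : E₁ → Scenario E₁ E₂ F₂ C₂ → F₂} {y₃ : E₂ → Scenario E₂ E₃ F₃ C₃ → F₃}

/-! ### The numbers of samples -/

/-- A bound for the number of steps of the outer loop, multiplied by `ε ^ 2`. -/
noncomputable def stepBound₁ (P : Problem E₁ F₁ C₁ E₂ F₂ C₂ E₃ F₃ C₃) (ys : F₁) (M₂ : ℝ) : ℝ :=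
  1 + 6 * √2 * ‖P.A₁‖ * (2 * P.S₁.Ω ^ 2 + ‖P.S₁.y₀‖ ^ 2) / √P.S₁.α
    + (24 * √3 * M₂ * P.S₁.Ω / √P.S₁.α) ^ 2
    + 6 * ‖P.A₁‖ * (√(2 * P.S₁.α) * ‖ys - P.S₁.y₀‖ + 2 * P.S₁.Ω + 3 * √P.S₁.α) / P.S₁.α
    + (6 * √3 * M₂ * (√2 * ‖P.A₁‖ + √P.S₁.α) / P.S₁.α) ^ 2

theorem N₁_mul_sq_le (hα : 0 < P.S₁.α) (ys : F₁) {ε : ℝ} (M₂ : ℝ) (hε : 0 < ε) (hε1 : ε ≤ 1) :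
    (P.N₁ ys ε M₂ : ℝ) * ε ^ 2 ≤ P.stepBound₁ ys M₂ := by
  have hΩ := P.S₁.Ω_nonneg
  unfold N₁
  simp only [← div_div]
  exact max_ceil_max_mul_sq_le hε hε1 (by positivity) (by positivity)

variable {Ω : Type*} [MeasurableSpace Ω] {ν : Measure Ω}
  {ξ : ℕ → Ω → Scenario E₁ E₂ F₂ C₂} {ζ : ℕ → ℕ → Ω → Scenario E₂ E₃ F₃ C₃}

/-- A property of `(x¹, ξ²)` that holds almost surely for every fixed `x¹ ∈ X¹` holds almost surely
along the iterates of the outer loop. -/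
theorem Assumptions.ae_outerIter [IsProbabilityMeasure ν] (hP : P.Assumptions y₂ y₃)
    (hS : P.IsSampling ν ξ ζ) (ys : F₁) (ε M₃ M₂ : ℝ) {p : E₁ × Scenario E₁ E₂ F₂ C₂ → Prop}
    (hp : MeasurableSet {q | p q}) (h : ∀ x ∈ P.S₁.X, ∀ᵐ s ∂P.μ, p (x, s)) (i : ℕ) :
    ∀ᵐ ω ∂ν, p ((P.outerIter y₂ y₃ ys ε M₃ M₂ (fun i => ξ i ω) (fun i j => ζ i j ω) i).1,
      ξ i ω) := by
  haveI := hP.isMarkov_κ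
  haveI := hP.isProbability_μ
  have hm := hS.measurable
  have hg : Measurable fun w : E₁ × (Scenario E₁ E₂ F₂ C₂ × (ℕ → Scenario E₂ E₃ F₃ C₃)) =>
    P.G₂ y₂ y₃ ε M₃ w.1 w.2.1 w.2.2 := hP.measurable_G₂ ε M₃
  have hind := Stage.IsValid.indepFun_iter (S := P.S₁) hP.valid₁ P.A₁ P.b₁ P.c₁ (W := Ω)
    (Z := Scenario E₁ E₂ F₂ C₂ × (ℕ → Scenario E₂ E₃ F₃ C₃)) (ν := ν)
    (s := P.outerSteps ys ε M₂) rfl (g := fun p z => P.G₂ y₂ y₃ ε M₃ p z.1 z.2)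
    (z := fun i ω => (ξ i ω, fun j => ζ i j ω)) hg hm hS.indep i
  have hind' := hind.comp measurable_fst measurable_fst
  have hG : ∀ k, Measurable fun w : Ω × E₁ =>
      P.G₂ y₂ y₃ ε M₃ w.2 (ξ k w.1) (fun j => ζ k j w.1) := fun k => by
    have h1 : Measurable fun w : Ω × E₁ => (ξ k w.1, fun j => ζ k j w.1) :=
      (hm k).comp measurable_fst
    have h2 : Measurable fun w : Ω × E₁ => w.2 := measurable_snd
    have h3 := hg.comp (h2.prodMk h1)
    exact h3
  have hx : Measurable fun ω =>
      (P.outerIter y₂ y₃ ys ε M₃ M₂ (fun i => ξ i ω) (fun i j => ζ i j ω) i).1 :=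
    (hP.valid₁.measurable_iter (A := fun _ : Ω => P.A₁) (r := fun _ => P.b₁) (c := fun _ => P.c₁)
      (s := fun _ => P.outerSteps ys ε M₂) (G := fun ω k x => P.G₂ y₂ y₃ ε M₃ x (ξ k ω)
        (fun j => ζ k j ω)) measurable_const measurable_const
      measurable_const (fun _ => rfl) measurable_const measurable_const hG i).fst
  have hξ := hS.measurable_ξ i
  have hlaw : ν.map (ξ i) = P.μ := by
    have h1 := congrArg Measure.fst (hS.map_eq i)
    rw [Measure.fst_compProd, Measure.fst, Measure.map_map measurable_fst (hm i)] at h1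
    exact h1
  have hmap := (indepFun_iff_map_prod_eq_prod_map_map hx.aemeasurable hξ.aemeasurable).1 hind'
  have hprod : ∀ᵐ q ∂(ν.map fun ω =>
      (P.outerIter y₂ y₃ ys ε M₃ M₂ (fun i => ξ i ω) (fun i j => ζ i j ω) i).1).prod P.μ, p q := by
    -- The i-th iterate is independent of ξ i, so their joint law is a product; Fubini reduces the
    -- claim to fixed x¹ in X¹.
    rw [Measure.ae_prod_iff_ae_ae hp]
    refine (ae_map_iff hx.aemeasurable ?_).2 (Filter.Eventually.of_forall fun ω => h _
      (hP.valid₁.iter_mem P.A₁ P.b₁ P.c₁ _ _ i))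
    have h2 := measurable_measure_prodMk_left (ν := P.μ) hp.compl
    exact h2 (measurableSet_singleton 0)
  rw [hlaw] at hmap
  rw [← hmap] at hprod
  exact (ae_map_iff (hx.prodMk hξ).aemeasurable hp).1 hprod

theorem Bounded.samples₃_le [IsProbabilityMeasure ν] {D : ℝ} (hB : P.Bounded y₂ y₃ D)
    (hP : P.Assumptions y₂ y₃) (hS : P.IsSampling ν ξ ζ) (ys : F₁) {ε M₃ : ℝ} (M₂ : ℝ)
    (hε : 0 < ε) (hε1 : ε ≤ 1) (hM : 0 ≤ M₃) :
    ∀ᵐ ω ∂ν, (P.samples₃ y₂ y₃ ys ε M₃ M₂ (fun i => ξ i ω) (fun i j => ζ i j ω) : ℝ)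
      ≤ P.stepBound₁ ys M₂ * P.stepBound₂ D M₃ / ε ^ 4 := by
  have hmeas : MeasurableSet {q : E₁ × Scenario E₁ E₂ F₂ C₂ |
      (P.N₂ y₂ ε M₃ q.1 q.2 : ℝ) * ε ^ 2 ≤ P.stepBound₂ D M₃} :=
    measurableSet_le ((measurable_from_top.comp (hP.measurable_N₂ ε M₃)).mul_const _)
      measurable_const
  have hall := ae_all_iff.2 (hP.ae_outerIter hS ys ε M₃ M₂ hmeas fun x hx => by
    filter_upwards [hB.norm_A₂_le, hB.norm_y₂_le x hx] with s hA hy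
    exact N₂_mul_sq_le (P := P) (y₂ := y₂) hε hε1 hM hA hy)
  filter_upwards [hall] with ω hω
  have hc : 0 ≤ P.stepBound₂ D M₃ := by unfold stepBound₂; positivity
  rw [samples₃, Nat.cast_sum, le_div_iff₀ (by positivity)]
  calc (∑ i ∈ Finset.range (P.N₁ ys ε M₂), (P.N₂ y₂ ε M₃ (P.outerIter y₂ y₃ ys ε M₃ M₂
          (fun i => ξ i ω) (fun i j => ζ i j ω) i).1 (ξ i ω) : ℝ)) * ε ^ 4
      = (∑ i ∈ Finset.range (P.N₁ ys ε M₂), (P.N₂ y₂ ε M₃ (P.outerIter y₂ y₃ ys ε M₃ M₂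
          (fun i => ξ i ω) (fun i j => ζ i j ω) i).1 (ξ i ω) : ℝ) * ε ^ 2) * ε ^ 2 := by
        rw [← Finset.sum_mul]; ring
    _ ≤ (∑ _i ∈ Finset.range (P.N₁ ys ε M₂), P.stepBound₂ D M₃) * ε ^ 2 := by
        gcongr with i
        exact hω i
    _ = (P.N₁ ys ε M₂ * ε ^ 2) * P.stepBound₂ D M₃ := by
        rw [Finset.sum_const, Finset.card_range, nsmul_eq_mul]; ring
    _ ≤ _ := mul_le_mul_of_nonneg_right (N₁_mul_sq_le hP.valid₁.α_pos ys M₂ hε hε1) hc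

end Problem

end DSA

/-! ### Assembly of the two claims -/

theorem mainTheorem1
    {E₁ F₁ C₁ E₂ F₂ C₂ E₃ F₃ C₃ : Type*}
    [NormedAddCommGroup E₁] [NormedSpace ℝ E₁] [FiniteDimensional ℝ E₁]
    [MeasurableSpace E₁] [BorelSpace E₁]
    [NormedAddCommGroup F₁] [InnerProductSpace ℝ F₁] [FiniteDimensional ℝ F₁]
    [MeasurableSpace F₁] [BorelSpace F₁] [MeasurableSpace C₁]
    [NormedAddCommGroup E₂] [NormedSpace ℝ E₂] [FiniteDimensional ℝ E₂]
    [MeasurableSpace E₂] [BorelSpace E₂]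
    [NormedAddCommGroup F₂] [InnerProductSpace ℝ F₂] [FiniteDimensional ℝ F₂]
    [MeasurableSpace F₂] [BorelSpace F₂] [MeasurableSpace C₂]
    [NormedAddCommGroup E₃] [NormedSpace ℝ E₃] [FiniteDimensional ℝ E₃]
    [MeasurableSpace E₃] [BorelSpace E₃]
    [NormedAddCommGroup F₃] [InnerProductSpace ℝ F₃] [FiniteDimensional ℝ F₃]
    [MeasurableSpace F₃] [BorelSpace F₃] [MeasurableSpace C₃]
    (P : DSA.Problem E₁ F₁ C₁ E₂ F₂ C₂ E₃ F₃ C₃)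
    (y₂ : E₁ → DSA.Scenario E₁ E₂ F₂ C₂ → F₂) (y₃ : E₂ → DSA.Scenario E₂ E₃ F₃ C₃ → F₃)
    (hP : P.Assumptions y₂ y₃)
    (xs : E₁) (ys : F₁) (hs : P.IsFirstStageSaddle xs ys) :
    (∀ (Ω : Type*) [MeasurableSpace Ω] (ν : Measure Ω) [IsProbabilityMeasure ν]
        (ξ : ℕ → Ω → DSA.Scenario E₁ E₂ F₂ C₂) (ζ : ℕ → ℕ → Ω → DSA.Scenario E₂ E₃ F₃ C₃),
      P.IsSampling ν ξ ζ →
      ∀ ε M₃ M₂ : ℝ, 0 < ε → P.IsBound₃ y₃ ε M₃ → P.IsBound₂ y₂ y₃ ε M₃ M₂ →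
        let xbar : Ω → E₁ := fun ω =>
          P.output y₂ y₃ ys ε M₃ M₂ (fun i => ξ i ω) (fun i j => ζ i j ω)
        (∀ ω, xbar ω ∈ P.S₁.X) ∧
        Integrable (fun ω => P.objective (xbar ω) - P.objective xs) ν ∧
        ∫ ω, (P.objective (xbar ω) - P.objective xs) ∂ν ≤ ε ∧
        ∃ δ : Ω → F₁, Integrable δ ν ∧
          (∀ᵐ ω ∂ν, P.A₁ (xbar ω) - P.b₁ - δ ω ∈ P.S₁.K) ∧
          ∫ ω, ‖δ ω‖ ∂ν ≤ ε) ∧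
    (∀ D : ℝ, P.Bounded y₂ y₃ D →
      ∃ M₃ M₂ Q : ℝ, ∀ ε : ℝ, 0 < ε → ε ≤ 1 →
        P.IsBound₃ y₃ ε M₃ ∧ P.IsBound₂ y₂ y₃ ε M₃ M₂ ∧
        (P.samples₂ ys ε M₂ : ℝ) ≤ Q / ε ^ 2 ∧
        ∀ (Ω : Type*) [MeasurableSpace Ω] (ν : Measure Ω) [IsProbabilityMeasure ν]
          (ξ : ℕ → Ω → DSA.Scenario E₁ E₂ F₂ C₂) (ζ : ℕ → ℕ → Ω → DSA.Scenario E₂ E₃ F₃ C₃),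
          P.IsSampling ν ξ ζ →
          ∀ᵐ ω ∂ν, (P.samples₃ y₂ y₃ ys ε M₃ M₂ (fun i => ξ i ω) (fun i j => ζ i j ω) : ℝ)
            ≤ Q / ε ^ 4) := by
  refine ⟨fun Ω _ ν _ ξ ζ hS ε M₃ M₂ hε h₃ h₂ => hP.output_spec hs hS hε h₃ h₂, fun D hB => ?_⟩
  set M₃ := P.dualBound₃ D * D
  set M₂ := P.subgradBound₂ D M₃
  -- One Q serves both counts: it dominates `stepBound₁` alone and its product with `stepBound₂`.
  -- The constants are fixed before ε is introduced.
  refine ⟨M₃, M₂, P.stepBound₁ ys M₂ * (1 + P.stepBound₂ D M₃), fun ε hε hε1 => ?_⟩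
  have h₃ : P.IsBound₃ y₃ ε M₃ := hB.isBound₃ hP ε
  have hc₁ := DSA.Problem.N₁_mul_sq_le hP.valid₁.α_pos ys M₂ hε hε1
  have hs₁ : 0 ≤ P.stepBound₁ ys M₂ := le_trans (by positivity) hc₁
  have hs₂ : 0 ≤ P.stepBound₂ D M₃ := by unfold DSA.Problem.stepBound₂; positivity
  refine ⟨h₃, hB.isBound₂ hP hε hε1 h₃, ?_, fun Ω _ ν _ ξ ζ hS => ?_⟩
  · rw [le_div_iff₀ (by positivity)]
    exact hc₁.trans (le_mul_of_one_le_right hs₁ (by linarith))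
  · filter_upwards [hB.samples₃_le hP hS ys M₂ hε hε1 h₃.1] with ω hω
    refine hω.trans ?_
    gcongr
    linarith
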